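/- **Setting.** Let $\mathsf Y\subset\mathbb R^d$ be a bounded convex Borel set and $\mu$ the Lebesgue measure restricted to $\mathsf Y$. Let $\mathbb P_0,\mathbb P_1$ be two probability measures under each of which $(X_k,Y_k)_{k\in\mathbb Z}$ is a stationary hidden Markov model: $(X_k)$ is a stationary Markov chain with values in a measurable space $\mathsf X$, and $Y_k\in\mathsf Y$ is a noisy observation of $X_k$, the observations being conditionally independent given the chain. For $i\in\{0,1\}$ and every integer $t\ge1$, the $t$-step transition kernel of the chain under $\mathbb P_i$ has a density $x'\mapsto q_i^t(x,x')$ with respect to a fixed probability measure $\lambda$ on $\mathsf X$, and there are an integer $m_0\ge1$ and real numbers $0<\sigma^-\le\sigma^+$ with $\sigma^-\le q_i^{m_0}(x,x')\le\sigma^+$ for all $i,x,x'$. Under both hypotheses the law of $Y_k$ given $X_k=x$ has the same density $y\mapsto g(x,y)$ with respect to $\mu$, where $0<\inf_{x\in\mathsf X,y\in\mathsf Y} g(x,y)\le\sup_{x\in\mathsf X,y\in\mathsf Y} g(x,y)<\infty$, the function $g(x,\cdot)$ is $C^3$ on $\mathsf Y$ for every $x$, and all third partial derivatives of $g$ in $y$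 are bounded uniformly in $x\in\mathsf X$, $y\in\mathsf Y$. For a family of joint densities (or joint probabilities) $p$ write $p(v\mid u)=p(u,v)/p(u)$, with $p(v\mid u)=p(v)$ if the block $u$ is void; $Y_{a:b}=(Y_a,\dots,Y_b)$; $\mathbb E_0$ is the expectation under $\mathbb P_0$. For $N\ge2$, an $N$-point quantizer consists of a partition of $\mathsf Y$ into $N$ Borel cells of non-zero volume, $N$ distinct points, and the map $\xi_N$ sending each element of a cell to the point of that cell; $Z_{N,k}=\xi_N(Y_k)$, and $p_{i,N}(z_{1:n})=\mathbb P_i[Z_{N,1:n}=z_{1:n}]$. **Proposition.** Under each $\mathbb P_i$ the process $(Y_k)_{k\in\mathbb Z}$ is stationary and ergodic, and there are densities $p_i$ of its finite-dimensional laws such that the following holds. 1. For each $i$ and $n\ge1$, $p_i$ is a density of $Y_{1:n}$ under $\mathbb P_i$ with respect to $\mu^{\otimes n}$; $p_i(y_{1:n})>0$ for every $y_{1:n}\in\mathsf Y^n$; and $\mathbb E_0|\log p_i(Y_0)|<\infty$. 2. For each $i$, the sequence $(\log p_i(Y_0\mid Y_{-m:-1}))_{m\ge0}$ converges in $L^1(\mathbb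 P_0)$. 3. For every family of $N$-point quantizers, $N\ge2$: * for each $i$ and $n\ge1$, $y_{1:n}\mapsto p_i(y_{1:n})$ is $C^3$ on $\mathsf Y^n$; * all third partial derivatives of $\log p_i(y_{1:n})$ with respect to coordinates of $y_k,y_\ell,y_r$ are bounded uniformly in $n\ge1$, $y_{1:n}\in\mathsf Y^n$, $1\le k,\ell,r\le n$ and the coordinates; * there are constants $C_e,\epsilon>0$ such that for all $i$, $N\ge2$ and $m\ge0$, $\max(\eta_i(m),\eta_{i,N}(m))\le C_e/(1+m)^{6+\epsilon}$, where $$\eta_i(m)=\sup_{m'\ge m}\mathbb E_0\left|\log p_i(Y_0\mid Y_{-m:-1})-\log p_i(Y_0\mid Y_{-m':-1})\right|$$ and $\eta_{i,N}(m)$ is defined in the same way with $p_{i,N}$ and $Z_{N,\cdot}$ in place of $p_i$ and $Y$; * there are sequences $(\varphi_k)_{k\ge 0}$, $(\psi_k)_{k\ge 0}$ of non-negative numbers with $\sum_k\varphi_k<\infty$ and $\sum_k\psi_k<\infty$ such that for all $i$ and all integers $m'\ge m\ge0$, $k\ge0$, $$\mathbb E_0\left\|\nabla_{y_0}\log p_i(Y_{0:k}\mid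 Y_{-m:-1})-\nabla_{y_0}\log p_i(Y_{0:k}\mid Y_{-m':-1})\right\|\le\varphi_m,\qquad \mathbb E_0\left\|\nabla_{y_0}\log p_i(Y_k\mid Y_{-m:k-1})\right\|\le\psi_k .$$ -/

import Mathlib

open MeasureTheory ProbabilityTheory Filter Topology
open scoped ENNReal NNReal

namespace HMMDetection

/-- The ambient space `ℝ^d` of the observations, with the Euclidean norm. -/
abbrev Obs (d : ℕ) : Type := EuclideanSpace ℝ (Fin d)

/-- The block `(y_a, y_{a+1}, …, y_{a+n-1})` of a bi-infinite sequence. -/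
def block {α : Type*} (y : ℤ → α) (a : ℤ) (n : ℕ) : Fin n → α := fun j => y (a + (j : ℤ))

/-- The shift `(y_k)_k ↦ (y_{k+1})_k` on bi-infinite sequences. -/
def shift {α : Type*} (y : ℤ → α) : ℤ → α := fun k => y (k + 1)

/-- The set `𝒴^n` of blocks of length `n` with entries in `𝒴`. -/
def blocks {α : Type*} (𝒴 : Set α) (n : ℕ) : Set (Fin n → α) := Set.univ.pi fun _ => 𝒴

/-- The conditional density `p(v | u) = p(u, v) / p(u)` obtained from a family `p n` of joint
densities, with the convention `p(v | u) = p(v)` when the block `u` is void. -/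
noncomputable def condDens {α : Type*} (p : ∀ n : ℕ, (Fin n → α) → ℝ) (m l : ℕ)
    (u : Fin m → α) (v : Fin l → α) : ℝ :=
  if m = 0 then p l v else p (m + l) (Fin.append u v) / p m u

/-- `log p(w_0 | w_{-m}, …, w_{-1})`. -/
noncomputable def logCond {α : Type*} (p : ∀ n : ℕ, (Fin n → α) → ℝ) (m : ℕ) (w : ℤ → α) : ℝ :=
  Real.log (condDens p m 1 (block w (-(m : ℤ)) m) (block w 0 1))

/-- The forgetting coefficient
`sup_{m' ≥ m} E₀ |log p(W_0 | W_{-m:-1}) - log p(W_0 | W_{-m':-1})|`. -/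
noncomputable def forgetting {Ω α : Type*} [MeasurableSpace Ω] (P₀ : Measure Ω)
    (p : ∀ n : ℕ, (Fin n → α) → ℝ) (W : ℤ → Ω → α) (m : ℕ) : ℝ≥0∞ :=
  ⨆ (m' : ℕ) (_ : m ≤ m'),
    ∫⁻ ω, ‖logCond p m (fun k => W k ω) - logCond p m' (fun k => W k ω)‖ₑ ∂P₀

/-- The gradient with respect to the coordinate `y_0`, which ranges over `𝒴`, of a function of
the bi-infinite sequence `y`. -/
noncomputable def gradZero {d : ℕ} (𝒴 : Set (Obs d)) (f : (ℤ → Obs d) → ℝ) (y : ℤ → Obs d) :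
    Obs d :=
  gradientWithin (fun z : Obs d => f (Function.update y 0 z)) 𝒴 (y 0)

/-- The `h`-th vector of the standard basis of `ℝ^d`. -/
noncomputable def stdVec {d : ℕ} (h : Fin d) : Obs d := EuclideanSpace.single h (1 : ℝ)

/-- The third partial derivative of `f : 𝒴 → ℝ` with respect to the coordinates `h`, `i`, `j`. -/
noncomputable def partial3 {d : ℕ} (𝒴 : Set (Obs d)) (f : Obs d → ℝ) (h i j : Fin d)
    (y : Obs d) : ℝ :=
  iteratedFDerivWithin ℝ 3 f 𝒴 y ![stdVec h, stdVec i, stdVec j]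

/-- The third partial derivative of `f : 𝒴^n → ℝ` with respect to the `h`-th coordinate of `y_k`,
the `i`-th coordinate of `y_l` and the `j`-th coordinate of `y_r`. -/
noncomputable def blockPartial3 {d n : ℕ} (𝒴 : Set (Obs d)) (f : (Fin n → Obs d) → ℝ)
    (k l r : Fin n) (h i j : Fin d) (y : Fin n → Obs d) : ℝ :=
  iteratedFDerivWithin ℝ 3 f (blocks 𝒴 n) y
    ![Pi.single k (stdVec h), Pi.single l (stdVec i), Pi.single r (stdVec j)]

/-! ### Hidden Markov models -/

/-- Under the probability `P`, the bi-infinite process `(X_k, Y_k)` is a stationary hidden Markov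
model with transition kernel `Q` and observation kernel `G`: given the past
`(X_j, Y_j)_{j ≤ k}`, the state `X_{k+1}` has distribution `Q(X_k, ·)` and, given in addition
`X_{k+1} = x'`, the observation `Y_{k+1}` has distribution `G(x', ·)`. As the transition kernel
does not depend on the time, stationarity amounts to all the `X_k` having the same law. -/
structure IsStationaryHMM {Ω 𝒳 : Type*} [MeasurableSpace Ω] [MeasurableSpace 𝒳] {d : ℕ}
    (P : Measure Ω) (Q : Kernel 𝒳 𝒳) (G : Kernel 𝒳 (Obs d))
    (X : ℤ → Ω → 𝒳) (Y : ℤ → Ω → Obs d) : Prop where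
  measurable_state : ∀ k, Measurable (X k)
  measurable_obs : ∀ k, Measurable (Y k)
  stationary : ∀ k, P.map (X k) = P.map (X 0)
  markov : ∀ (k : ℤ) (A : Set 𝒳) (B : Set (Obs d)), MeasurableSet A → MeasurableSet B →
    P⟦X (k + 1) ⁻¹' A ∩ Y (k + 1) ⁻¹' B |
        ⨆ (j : ℤ) (_ : j ≤ k), (MeasurableSpace.comap (X j) inferInstance ⊔
          MeasurableSpace.comap (Y j) inferInstance)⟧
      =ᵐ[P] fun ω => (∫⁻ x' in A, G x' B ∂(Q (X k ω))).toReal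

/-! ### Quantizers -/

/-- An `N`-point quantizer of `𝒴`: a partition of `𝒴` into `N` Borel cells of non-zero volume,
`N` distinct quantization points in an arbitrary alphabet `Ξ`, and the quantization function,
which maps each element of a cell to the point of that cell. -/
structure Quantizer {d : ℕ} (𝒴 : Set (Obs d)) (Ξ : Type*) (N : ℕ) where
  cell : Fin N → Set (Obs d)
  measurableSet_cell : ∀ j, MeasurableSet (cell j)
  volume_cell_ne_zero : ∀ j, volume (cell j) ≠ 0
  disjoint_cell : ∀ j j', j ≠ j' → Disjoint (cell j) (cell j')
  iUnion_cell : ⋃ j, cell j = 𝒴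
  point : Fin N → Ξ
  point_injective : Function.Injective point
  quant : Obs d → Ξ
  quant_eq : ∀ j, ∀ y ∈ cell j, quant y = point j

/-- The joint probabilities `p_N(z_{1:n}) = P(Z_{N,1} = z_1, …, Z_{N,n} = z_n)` of the quantized
process `Z_{N,k} = ξ_N(Y_k)`, that is, the probability that `Y_1, …, Y_n` fall into the cells
of the quantization points `z_1, …, z_n`. -/
noncomputable def quantProb {Ω : Type*} [MeasurableSpace Ω] {d N : ℕ} {𝒴 : Set (Obs d)} {Ξ : Type*}
    (P : Measure Ω) (Y : ℤ → Ω → Obs d) (q : Quantizer 𝒴 Ξ N) (n : ℕ) (z : Fin n → Ξ) : ℝ :=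
  P.real {ω | ∀ k : Fin n, q.quant (Y (1 + (k : ℤ)) ω) = z k}

/-! ### The assumptions on the observed process

Here `P 0` and `P 1` are the two hypotheses, and `p i n` is the joint density of `n` successive
observations under `P i`. -/

/-- The finite-dimensional laws have positive densities with respect to Lebesgue measure
restricted to `𝒴`, and `log p_i(Y_0)` is integrable under `P 0`. -/
structure DensityAssumption {Ω : Type*} [MeasurableSpace Ω] {d : ℕ} (𝒴 : Set (Obs d))
    (P : Fin 2 → Measure Ω) (Y : ℤ → Ω → Obs d)
    (p : Fin 2 → ∀ n : ℕ, (Fin n → Obs d) → ℝ) : Prop where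
  measurable : ∀ i n, 1 ≤ n → Measurable (p i n)
  density : ∀ i n, 1 ≤ n → (P i).map (fun ω => block (fun k => Y k ω) 1 n) =
    (Measure.pi fun _ : Fin n => (volume : Measure (Obs d)).restrict 𝒴).withDensity
      fun y => ENNReal.ofReal (p i n y)
  pos : ∀ i n, 1 ≤ n → ∀ y ∈ blocks 𝒴 n, 0 < p i n y
  integrable_log : ∀ i, Integrable (fun ω => Real.log (p i 1 (block (fun k => Y k ω) 0 1))) (P 0)

/-- For each `i`, the sequence `(log p_i(Y_0 | Y_{-m:-1}))_{m ≥ 0}` is a convergent sequence in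
`L¹(P 0)`. -/
def LogCondConverges {Ω : Type*} [MeasurableSpace Ω] {d : ℕ}
    (P : Fin 2 → Measure Ω) (Y : ℤ → Ω → Obs d)
    (p : Fin 2 → ∀ n : ℕ, (Fin n → Obs d) → ℝ) : Prop :=
  ∀ i, (∀ m, Integrable (fun ω => logCond (p i) m (fun k => Y k ω)) (P 0)) ∧
    ∃ L : Ω → ℝ, Integrable L (P 0) ∧
      Tendsto (fun m : ℕ => ∫⁻ ω, ‖logCond (p i) m (fun k => Y k ω) - L ω‖ₑ ∂(P 0)) atTop (𝓝 0)

/-- Smoothness of the densities and forgetting properties of the process and of its quantized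
versions, for a family of quantizers `q N`, `N ≥ 2`. -/
structure LossAssumption {Ω : Type*} [MeasurableSpace Ω] {d : ℕ} (𝒴 : Set (Obs d))
    (P : Fin 2 → Measure Ω) (Y : ℤ → Ω → Obs d)
    (p : Fin 2 → ∀ n : ℕ, (Fin n → Obs d) → ℝ)
    {Ξ : Type*} (q : ∀ N : ℕ, 2 ≤ N → Quantizer 𝒴 Ξ N) : Prop where
  contDiff : ∀ i n, 1 ≤ n → ContDiffOn ℝ 3 (p i n) (blocks 𝒴 n)
  log_partial3_bounded : ∃ C : ℝ, ∀ i n, 1 ≤ n → ∀ y ∈ blocks 𝒴 n,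
    ∀ (k l r : Fin n) (a b c : Fin d),
      |blockPartial3 𝒴 (fun y' => Real.log (p i n y')) k l r a b c y| ≤ C
  forgetting_le : ∃ Ce ε : ℝ, 0 < Ce ∧ 0 < ε ∧ ∀ (i : Fin 2) (N : ℕ) (hN : 2 ≤ N) (m : ℕ),
    max (forgetting (P 0) (p i) Y m)
        (forgetting (P 0) (quantProb (P i) Y (q N hN)) (fun k ω => (q N hN).quant (Y k ω)) m)
      ≤ ENNReal.ofReal (Ce / (1 + (m : ℝ)) ^ (6 + ε))
  gradient : ∃ φ ψ : ℕ → ℝ≥0, Summable φ ∧ Summable ψ ∧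
    ∀ (i : Fin 2) (m m' k : ℕ), m ≤ m' →
      ∫⁻ ω, ‖gradZero 𝒴 (fun y => Real.log
              (condDens (p i) m (k + 1) (block y (-(m : ℤ)) m) (block y 0 (k + 1))))
              (fun t => Y t ω) -
            gradZero 𝒴 (fun y => Real.log
              (condDens (p i) m' (k + 1) (block y (-(m' : ℤ)) m') (block y 0 (k + 1))))
              (fun t => Y t ω)‖ₑ ∂(P 0) ≤ φ m ∧
      ∫⁻ ω, ‖gradZero 𝒴 (fun y => Real.log
              (condDens (p i) (m + k) 1 (block y (-(m : ℤ)) (m + k)) (block y k 1)))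
              (fun t => Y t ω)‖ₑ ∂(P 0) ≤ ψ k

end HMMDetection

set_option linter.unusedSectionVars false
set_option linter.unusedVariables false

namespace HMMDetection

/-! The density used is `p_i(y_{1:n}) = E_i ∏ g(X_k, y_k)` (`pathExp`). By the Markov property such
an expectation is the integral, against the stationary law of the chain, of a product of positive
operators `h ↦ ∫ f_t(x') h(x') Q(x, dx')` applied to `1` (`pathMass`, `integral_prod_eq_pathMass`).
For the observations `f_t(x) = g(x, y_t)`; for the quantized process `f_t(x) = G(x, cell_t)`.
Conditional densities, their quantized versions and the gradients of their logarithms are ratios of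
these masses, or differences of such ratios.

The engine is a projective contraction (`exists_contract_block`, `exists_contract`). Suppose `α k ≤
h ≤ β k` with `k` bounded below by a positive constant, and `c_t gm ≤ f_t ≤ c_t gp`. The bounds on
the `m`-step transition density make the images of `h` and `k` under `m` operators satisfy the same
inequalities with an interval shorter by the factor `1 - (gm/gp)^m σm/σp`. The scales `c_t` cancel.
For a cell one takes `c_t` to be its volume (`comparable_cell`), so the rate does not depend on the
quantizer or on `N`.

Forgetting in the logarithm follows because the conditional densities for two lengths of the past
both lie in the contracted range of one ratio of functions (`abs_log_ratio_sub_le`). The partial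
derivative at `y_0` of a log-density is the ratio of masses in which the weight at time `0` has been
replaced by `∂g`. Since `|∂g| ≤ K g`, the same contraction shows that this ratio forgets the remote
past (`abs_modif_ratio_sub_past_le`); contracting the functions that represent the future shows that
it is almost unaffected by one further remote observation (`abs_modif_ratio_sub_future_le`). All
these bounds are geometric and hold for every trajectory in `𝒴`, so it does not matter that the
expectation is taken under `P 0` while the densities belong to `P i`, and any polynomial rate is
available.

For ergodicity the contraction is applied with weights `1` across a long gap: the conditional
probability of a remote future cylinder is almost constant, hence the shift is mixing on cylinders
(`abs_real_inter_sub_le`), which suffices (`ergodic_of_mixing`).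

For smoothness, bounds on `g` and on its third derivatives control the intermediate ones
(`tame_three`), which permits differentiation under the expectation. A third derivative of `log p`
is a polynomial in quotients `D p / p`, where `D` has order at most three. Differentiation alters at
most three factors of the product, each at the cost of a constant factor relative to `g`, whatever
the length of the block (`IsModif.abs_pathExp_le`). -/

/-! ### Directional derivatives within a set -/

/-- The derivative of `f` within `S` in the direction `v`. -/
noncomputable def dirDeriv {E : Type*} [NormedAddCommGroup E] [NormedSpace ℝ E] (S : Set E) (v : E)
    (f : E → ℝ) (y : E) : ℝ :=
  fderivWithin ℝ f S y v

section DirDeriv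

variable {E : Type*} [NormedAddCommGroup E] [NormedSpace ℝ E] {S : Set E}

lemma dirDeriv_congr {f f' : E → ℝ} (h : ∀ y ∈ S, f y = f' y) (v : E) {y : E} (hy : y ∈ S) :
    dirDeriv S v f y = dirDeriv S v f' y := by
  rw [dirDeriv, dirDeriv, fderivWithin_congr h (h y hy)]

lemma contDiffOn_dirDeriv {f : E → ℝ} {m n : ℕ} (hS : UniqueDiffOn ℝ S) (hf : ContDiffOn ℝ n f S)
    (hmn : m + 1 ≤ n) (v : E) : ContDiffOn ℝ m (dirDeriv S v f) S :=
  (hf.fderivWithin hS (by exact_mod_cast hmn)).clm_apply contDiffOn_const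

/-- Evaluation at a fixed tuple is continuous and linear on multilinear maps, so it commutes with
the derivative. This reduces iterated derivatives to iterated scalar directional derivatives. -/
lemma iteratedFDerivWithin_succ_cons {f : E → ℝ} {n N : ℕ} (hS : UniqueDiffOn ℝ S)
    (hf : ContDiffOn ℝ N f S) (hn : n + 1 ≤ N) {y : E} (hy : y ∈ S) (u : E) (w : Fin n → E) :
    iteratedFDerivWithin ℝ (n + 1) f S y (Fin.cons u w : Fin (n + 1) → E) =
      dirDeriv S u (fun z => iteratedFDerivWithin ℝ n f S z w) y := by
  rw [iteratedFDerivWithin_succ_apply_left, dirDeriv]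
  have hd : DifferentiableWithinAt ℝ (iteratedFDerivWithin ℝ n f S) S y :=
    hf.differentiableOn_iteratedFDerivWithin (by exact_mod_cast hn) hS y hy
  simp only [Fin.cons_zero, Fin.tail_cons]
  have h := hd.hasFDerivWithinAt
  have := ((ContinuousMultilinearMap.apply ℝ (fun _ : Fin n => E) ℝ w).hasFDerivAt
    (x := iteratedFDerivWithin ℝ n f S y)).comp_hasFDerivWithinAt y h
  have h2 := this.fderivWithin (hS y hy)
  simp only [Function.comp_def, ContinuousMultilinearMap.apply_apply] at h2
  rw [h2]
  simp

lemma iteratedFDerivWithin_three_apply {f : E → ℝ} (hS : UniqueDiffOn ℝ S)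
    (hf : ContDiffOn ℝ 3 f S) {y : E} (hy : y ∈ S) (u v w : E) :
    iteratedFDerivWithin ℝ 3 f S y ![u, v, w] =
      dirDeriv S u (dirDeriv S v (dirDeriv S w f)) y := by
  have hf' : ContDiffOn ℝ (3 : ℕ) f S := by exact_mod_cast hf
  refine (iteratedFDerivWithin_succ_cons hS hf' (n := 2) le_rfl hy u ![v, w]).trans ?_
  refine dirDeriv_congr (fun z hz => ?_) u hy
  refine (iteratedFDerivWithin_succ_cons hS hf' (n := 1) (by norm_num) hz v ![w]).trans ?_
  refine dirDeriv_congr (fun z hz => ?_) v hz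
  refine (iteratedFDerivWithin_succ_cons hS hf' (n := 0) (by norm_num) hz w ![]).trans ?_
  refine dirDeriv_congr (fun z hz => ?_) w hz
  simp

lemma _root_.HasFDerivWithinAt.dirDeriv {f : E → ℝ} {f' : E →L[ℝ] ℝ} {y : E}
    (h : HasFDerivWithinAt f f' S y) (hS : UniqueDiffWithinAt ℝ S y) (v : E) :
    dirDeriv S v f y = f' v := by
  rw [HMMDetection.dirDeriv, h.fderivWithin hS]

end DirDeriv

/-! ### Coordinates -/

section Coord

variable {d : ℕ}

lemma sum_smul_stdVec (v : Obs d) : v = ∑ e, v e • stdVec e := by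
  ext j
  simp [stdVec, Pi.single_apply]

lemma norm_stdVec (e : Fin d) : ‖stdVec e‖ = 1 := by simp [stdVec]

lemma abs_apply_le (L : Obs d →L[ℝ] ℝ) {C : ℝ} (hL : ∀ e, |L (stdVec e)| ≤ C) :
    ‖L‖ ≤ d * C := by
  by_cases hd : Nonempty (Fin d)
  · obtain ⟨e₀⟩ := hd
    have hC : 0 ≤ C := (abs_nonneg _).trans (hL e₀)
    refine L.opNorm_le_bound (by positivity) fun v => ?_
    conv_lhs => rw [sum_smul_stdVec v]
    rw [map_sum]
    refine (norm_sum_le _ _).trans ?_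
    have : ∀ e ∈ Finset.univ, ‖L (v e • stdVec e)‖ ≤ C * ‖v‖ := fun e _ => by
      rw [map_smul, norm_smul, mul_comm]
      exact mul_le_mul (hL e) (EuclideanSpace.norm_eq v ▸ PiLp.norm_apply_le v e)
        (norm_nonneg _) hC
    refine (Finset.sum_le_sum this).trans ?_
    simp [mul_assoc]
  -- In dimension `0` the hypothesis is vacuous and `C` may be negative, but both sides vanish.
  · have hd0 : d = 0 := by
      rcases Nat.eq_zero_or_pos d with h | h
      · exact h
      · exact absurd ⟨⟨0, h⟩⟩ hd
    subst hd0
    refine (L.opNorm_le_bound le_rfl fun v => ?_).trans (by simp)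
    rw [Subsingleton.elim v 0]; simp

/-- A function with bounded partial derivatives is Lipschitz on a convex set. -/
lemma abs_sub_le_of_partial {𝒴 : Set (Obs d)} (hconv : Convex ℝ 𝒴) {f : Obs d → ℝ} {C : ℝ}
    (hf : DifferentiableOn ℝ f 𝒴) (hC : ∀ y ∈ 𝒴, ∀ e, |dirDeriv 𝒴 (stdVec e) f y| ≤ C)
    {y z : Obs d} (hy : y ∈ 𝒴) (hz : z ∈ 𝒴) : |f z - f y| ≤ d * C * ‖z - y‖ :=
  hconv.norm_image_sub_le_of_norm_hasFDerivWithin_le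
    (fun x hx => (hf x hx).hasFDerivWithinAt) (fun x hx => abs_apply_le _ (hC x hx)) hy hz

lemma exists_dirDeriv_eq {𝒴 : Set (Obs d)} (hconv : Convex ℝ 𝒴) {f : Obs d → ℝ}
    (hf : DifferentiableOn ℝ f 𝒴) {y v : Obs d} (hy : y ∈ 𝒴) (hv : y + v ∈ 𝒴) :
    ∃ t ∈ Set.Icc (0 : ℝ) 1, f (y + v) - f y = dirDeriv 𝒴 v f (y + t • v) := by
  obtain ⟨z, hz, h⟩ := domain_mvt (fun x hx => (hf x hx).hasFDerivWithinAt) hconv hy hv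
  rw [segment_eq_image'] at hz
  obtain ⟨t, ht, rfl⟩ := hz
  refine ⟨t, ht, ?_⟩
  simpa [dirDeriv] using h

end Coord

/-! ### Bounds on the partial derivatives of lower order -/

section Landau

variable {d : ℕ} {𝒴 : Set (Obs d)} {𝒳 : Type*}

lemma dirDeriv_smul {E : Type*} [NormedAddCommGroup E] [NormedSpace ℝ E] (S : Set E) (r : ℝ)
    (v : E) (f : E → ℝ) (y : E) : dirDeriv S (r • v) f y = r * dirDeriv S v f y := by
  simp [dirDeriv]

lemma exists_norm_sub_le (hb : Bornology.IsBounded 𝒴) :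
    ∃ D, 0 ≤ D ∧ ∀ y ∈ 𝒴, ∀ z ∈ 𝒴, ‖z - y‖ ≤ D := by
  refine ⟨Metric.diam 𝒴, Metric.diam_nonneg, fun y hy z hz => ?_⟩
  rw [← dist_eq_norm]
  exact Metric.dist_le_diam_of_mem hb hz hy

/-- If `f` is bounded at some point and has bounded partial derivatives, it is bounded. -/
lemma exists_bound_of_partial (hb : Bornology.IsBounded 𝒴) (hconv : Convex ℝ 𝒴)
    {f : 𝒳 → Obs d → ℝ} (hf : ∀ x, DifferentiableOn ℝ (f x) 𝒴) {A C : ℝ}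
    (hA : ∀ x, ∃ y ∈ 𝒴, |f x y| ≤ A)
    (hC : ∀ x, ∀ y ∈ 𝒴, ∀ e, |dirDeriv 𝒴 (stdVec e) (f x) y| ≤ C) :
    ∃ B, ∀ x, ∀ y ∈ 𝒴, |f x y| ≤ B := by
  obtain ⟨D, hD, hDle⟩ := exists_norm_sub_le hb
  refine ⟨A + d * |C| * D, fun x y hy => ?_⟩
  obtain ⟨z, hz, hzA⟩ := hA x
  have h := abs_sub_le_of_partial hconv (hf x) (C := |C|)
    (fun y hy e => (hC x y hy e).trans (le_abs_self C)) hz hy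
  have h2 : d * |C| * ‖y - z‖ ≤ d * |C| * D := by
    have := hDle z hz y hy
    gcongr
  have := abs_sub_abs_le_abs_sub (f x y) (f x z)
  linarith

lemma abs_le_div_of_abs_mul_le {q x A : ℝ} (hq : 0 < q) (h : |q * x| ≤ A) : |x| ≤ A / q := by
  rwa [le_div_iff₀ hq, mul_comm, ← abs_of_pos hq, ← abs_mul]

/-- The mean value theorem on a segment of length `r / 2` inside `𝒴`: some value of the derivative
is a difference quotient of a bounded function. The segment is the same for all `x`. -/
lemma exists_partial_bounded_at (hconv : Convex ℝ 𝒴) (hint : (interior 𝒴).Nonempty)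
    {f : 𝒳 → Obs d → ℝ} (hf : ∀ x, DifferentiableOn ℝ (f x) 𝒴) {A : ℝ}
    (hA : ∀ x, ∀ y ∈ 𝒴, |f x y| ≤ A) :
    ∃ B, ∀ x e, ∃ y ∈ 𝒴, |dirDeriv 𝒴 (stdVec e) (f x) y| ≤ B := by
  obtain ⟨c, hc⟩ := hint
  obtain ⟨r, hr, hball⟩ := Metric.isOpen_iff.1 isOpen_interior c hc
  have hmem : ∀ e t, t ∈ Set.Icc (0 : ℝ) 1 → c + t • ((r / 2) • stdVec e) ∈ 𝒴 := by
    intro e t ht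
    refine interior_subset (hball ?_)
    rw [Metric.mem_ball, dist_eq_norm, add_sub_cancel_left, norm_smul, norm_smul, norm_stdVec,
      Real.norm_of_nonneg ht.1, Real.norm_of_nonneg (by positivity)]
    nlinarith [ht.1, ht.2]
  refine ⟨2 * A / (r / 2), fun x e => ?_⟩
  obtain ⟨t, ht, h⟩ := exists_dirDeriv_eq hconv (hf x) (interior_subset hc)
    (v := (r / 2) • stdVec e) (by simpa using hmem e 1 (by simp))
  refine ⟨_, hmem e t ht, ?_⟩
  rw [dirDeriv_smul] at h
  refine abs_le_div_of_abs_mul_le (by positivity) ?_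
  rw [← h]
  have h1 := hA x (c + (r / 2) • stdVec e) (by simpa using hmem e 1 (by simp))
  have h2 := hA x c (interior_subset hc)
  exact (abs_sub _ _).trans (by linarith)

/-- A mixed second difference with steps `s / 2` equals a second partial derivative at an
intermediate point, by two applications of the mean value theorem. It involves four values of `f`,
hence the constant `4 * A`. -/
lemma exists_partial2_bounded_at (hconv : Convex ℝ 𝒴) (hint : (interior 𝒴).Nonempty)
    {f : 𝒳 → Obs d → ℝ} (hf : ∀ x, DifferentiableOn ℝ (f x) 𝒴)
    (hf2 : ∀ x e, DifferentiableOn ℝ (dirDeriv 𝒴 (stdVec e) (f x)) 𝒴) {A : ℝ}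
    (hA : ∀ x, ∀ y ∈ 𝒴, |f x y| ≤ A) :
    ∃ B, ∀ x a b, ∃ y ∈ 𝒴,
      |dirDeriv 𝒴 (stdVec a) (dirDeriv 𝒴 (stdVec b) (f x)) y| ≤ B := by
  obtain ⟨c, hc⟩ := hint
  obtain ⟨r, hr, hball⟩ := Metric.isOpen_iff.1 isOpen_interior c hc
  set s : ℝ := r / 2 with hs
  have hs0 : 0 < s := by positivity
  refine ⟨4 * A / (s / 2 * (s / 2)), fun x a b => ?_⟩
  have hmem : ∀ z ∈ Metric.ball c s, ∀ t ∈ Set.Icc (0 : ℝ) 1,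
      z + t • ((s / 2) • stdVec a) ∈ interior 𝒴 := by
    intro z hz t ht
    refine hball ?_
    rw [Metric.mem_ball, dist_eq_norm] at hz ⊢
    have h1 : ‖t • ((s / 2) • stdVec a)‖ ≤ s / 2 := by
      rw [norm_smul, norm_smul, norm_stdVec,
        Real.norm_of_nonneg ht.1, Real.norm_of_nonneg (by positivity)]
      nlinarith [ht.1, ht.2]
    calc ‖z + t • ((s / 2) • stdVec a) - c‖ = ‖(z - c) + t • ((s / 2) • stdVec a)‖ := by
          congr 1; abel
      _ ≤ _ := norm_add_le _ _
      _ < r := by linarith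
  have hmem1 : ∀ z ∈ Metric.ball c s, z + (s / 2) • stdVec a ∈ interior 𝒴 := fun z hz => by
    simpa using hmem z hz 1 (by simp)
  have hmem0 : ∀ z ∈ Metric.ball c s, z ∈ interior 𝒴 := fun z hz => by
    simpa using hmem z hz 0 (by simp)
  have hder : ∀ z ∈ interior 𝒴, HasFDerivAt (f x) (fderivWithin ℝ (f x) 𝒴 z) z := fun z hz =>
    (hf x z (interior_subset hz)).hasFDerivWithinAt.hasFDerivAt (mem_interior_iff_mem_nhds.1 hz)
  -- First difference in direction `a`; it is differentiated in direction `b` below. Points stay in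
  -- the interior, so that both the function and its translate have genuine derivatives.
  have hψ : ∀ z ∈ Metric.ball c s,
      HasFDerivWithinAt (fun z => f x (z + (s / 2) • stdVec a) - f x z)
        (fderivWithin ℝ (f x) 𝒴 (z + (s / 2) • stdVec a) - fderivWithin ℝ (f x) 𝒴 z)
        (Metric.ball c s) z := fun z hz => by
    have h1 := (hder _ (hmem1 z hz)).comp z ((hasFDerivAt_id z).add_const ((s / 2) • stdVec a))
    exact (h1.sub (hder z (hmem0 z hz))).hasFDerivWithinAt
  have hcs : c ∈ Metric.ball c s := Metric.mem_ball_self hs0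
  have hbs : c + (s / 2) • stdVec b ∈ Metric.ball c s := by
    rw [Metric.mem_ball, dist_eq_norm, add_sub_cancel_left, norm_smul, norm_stdVec,
      Real.norm_of_nonneg (by positivity)]
    linarith
  obtain ⟨z, hz, h⟩ := domain_mvt hψ (convex_ball c s) hcs hbs
  have hz : z ∈ Metric.ball c s := (convex_ball c s).segment_subset hcs hbs hz
  obtain ⟨t, ht, h2⟩ := exists_dirDeriv_eq hconv (hf2 x b) (interior_subset (hmem0 z hz))
    (interior_subset (hmem1 z hz))
  refine ⟨_, interior_subset (hmem z hz t ht), ?_⟩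
  rw [dirDeriv_smul] at h2
  simp only [add_sub_cancel_left, map_smul, sub_apply, smul_eq_mul] at h
  change _ = s / 2 * (dirDeriv 𝒴 (stdVec b) (f x) _ - dirDeriv 𝒴 (stdVec b) (f x) z) at h
  rw [h2] at h
  have e1 := abs_le.1 (hA x _ (interior_subset (hmem1 _ hbs)))
  have e2 := abs_le.1 (hA x _ (interior_subset (hmem0 _ hbs)))
  have e3 := abs_le.1 (hA x _ (interior_subset (hmem1 _ hcs)))
  have e4 := abs_le.1 (hA x _ (interior_subset (hmem0 _ hcs)))
  refine abs_le_div_of_abs_mul_le (by positivity) ?_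
  rw [mul_assoc, ← h, abs_le]
  constructor <;> linarith

end Landau

/-! ### Families of smooth functions with bounded derivatives -/

section Tame

variable {d : ℕ} {𝒳 : Type*} [MeasurableSpace 𝒳]

/-- `Tame 𝒴 r h`: the functions `h x` are `C^r` on `𝒴`, with partial derivatives up to order `r`
that are measurable in the parameter `x` and uniformly bounded. -/
def Tame (𝒴 : Set (Obs d)) : ℕ → (𝒳 → Obs d → ℝ) → Prop
  | 0, h => (∀ x, ContinuousOn (h x) 𝒴) ∧ (∀ y ∈ 𝒴, Measurable fun x => h x y) ∧
      ∃ C, ∀ x, ∀ y ∈ 𝒴, |h x y| ≤ C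
  | r + 1, h => (∀ x, DifferentiableOn ℝ (h x) 𝒴) ∧ (∀ y ∈ 𝒴, Measurable fun x => h x y) ∧
      (∃ C, ∀ x, ∀ y ∈ 𝒴, |h x y| ≤ C) ∧
      ∀ e, Tame 𝒴 r fun x => dirDeriv 𝒴 (stdVec e) (h x)

variable {𝒴 : Set (Obs d)}

lemma Tame.zero {r : ℕ} {h : 𝒳 → Obs d → ℝ} (hh : Tame 𝒴 r h) : Tame 𝒴 0 h := by
  cases r with
  | zero => exact hh
  | succ r => exact ⟨fun x => (hh.1 x).continuousOn, hh.2.1, hh.2.2.1⟩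

lemma Tame.of_succ {r : ℕ} {h : 𝒳 → Obs d → ℝ} (hh : Tame 𝒴 (r + 1) h) : Tame 𝒴 r h := by
  induction r generalizing h with
  | zero => exact hh.zero
  | succ r ih => exact ⟨hh.1, hh.2.1, hh.2.2.1, fun e => ih (hh.2.2.2 e)⟩

/-- Directional derivatives are measurable in the parameter, also at boundary points. -/
lemma measurable_dirDeriv (hconv : Convex ℝ 𝒴) (hint : (interior 𝒴).Nonempty)
    {f : 𝒳 → Obs d → ℝ} (hf : ∀ x, DifferentiableOn ℝ (f x) 𝒴)
    (hm : ∀ y ∈ 𝒴, Measurable fun x => f x y) (e : Fin d) {y : Obs d} (hy : y ∈ 𝒴) :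
    Measurable fun x => dirDeriv 𝒴 (stdVec e) (f x) y := by
  have key : ∀ z ∈ 𝒴, Measurable fun x => dirDeriv 𝒴 (z - y) (f x) y := by
    intro z hz
    have hmem : ∀ n : ℕ, y + (1 / ((n : ℝ) + 1)) • (z - y) ∈ 𝒴 := fun n =>
      hconv.add_smul_sub_mem hy hz ⟨by positivity, by
        rw [div_le_one (by positivity)]; linarith [(Nat.cast_nonneg n : (0 : ℝ) ≤ n)]⟩
    refine measurable_of_tendsto_metrizable (f := fun (n : ℕ) x =>
      ((n : ℝ) + 1) • (f x (y + (1 / ((n : ℝ) + 1)) • (z - y)) - f x y))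
      (fun n => ((hm _ (hmem n)).sub (hm y hy)).const_mul ((n : ℝ) + 1)) ?_
    rw [tendsto_pi_nhds]
    intro x
    refine (hf x y hy).hasFDerivWithinAt.lim (l := atTop) (v := z - y)
      (d := fun n : ℕ => (1 / ((n : ℝ) + 1)) • (z - y)) ?_ (Eventually.of_forall hmem) ?_
    · simpa using (tendsto_one_div_add_atTop_nhds_zero_nat (𝕜 := ℝ)).smul_const (z - y)
    · refine tendsto_const_nhds.congr fun n => ?_
      rw [smul_smul, mul_one_div_cancel (by positivity), one_smul]
  obtain ⟨c, hc⟩ := hint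
  obtain ⟨r, hr, hball⟩ := Metric.isOpen_iff.1 isOpen_interior c hc
  have hmem : c + (r / 2) • stdVec e ∈ 𝒴 := by
    refine interior_subset (hball ?_)
    rw [Metric.mem_ball, dist_eq_norm, add_sub_cancel_left, norm_smul, norm_stdVec,
      Real.norm_of_nonneg (by positivity)]
    linarith
  -- At a boundary point the direction `stdVec e` may leave `𝒴`; it is a multiple of the difference
  -- of two directions pointing from `y` to points of `𝒴`, for which difference quotients are
  -- available.
  have h := ((key _ hmem).sub (key _ (interior_subset hc))).const_mul (r / 2)⁻¹
  convert h using 2 with x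
  simp only [dirDeriv, ← map_sub, Pi.sub_apply]
  rw [show c + (r / 2) • stdVec e - y - (c - y) = (r / 2) • stdVec e by abel, map_smul,
    smul_eq_mul, inv_mul_cancel_left₀ (by positivity)]

/-- Interpolation from the two extreme orders. Second derivatives are bounded somewhere because `g`
is bounded, hence everywhere because third derivatives are bounded and `𝒴` has finite diameter; the
first derivatives are then treated in the same way. -/
lemma tame_three (hb : Bornology.IsBounded 𝒴) (hconv : Convex ℝ 𝒴)
    (hint : (interior 𝒴).Nonempty) (hS : UniqueDiffOn ℝ 𝒴) {g : 𝒳 → Obs d → ℝ}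
    (hg : ∀ x, ContDiffOn ℝ 3 (g x) 𝒴) (hm : ∀ y ∈ 𝒴, Measurable fun x => g x y)
    {A C : ℝ} (hA : ∀ x, ∀ y ∈ 𝒴, |g x y| ≤ A)
    (hC : ∀ x, ∀ y ∈ 𝒴, ∀ a b c, |partial3 𝒴 (g x) a b c y| ≤ C) : Tame 𝒴 3 g := by
  have hg' : ∀ x, ContDiffOn ℝ (3 : ℕ) (g x) 𝒴 := fun x => by exact_mod_cast hg x
  have c1 : ∀ x e, ContDiffOn ℝ (2 : ℕ) (dirDeriv 𝒴 (stdVec e) (g x)) 𝒴 := fun x e =>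
    contDiffOn_dirDeriv hS (hg' x) (by norm_num) _
  have c2 : ∀ x e e', ContDiffOn ℝ (1 : ℕ)
      (dirDeriv 𝒴 (stdVec e') (dirDeriv 𝒴 (stdVec e) (g x))) 𝒴 := fun x e e' =>
    contDiffOn_dirDeriv hS (c1 x e) (by norm_num) _
  have c3 : ∀ x e e' e'', ContDiffOn ℝ (0 : ℕ)
      (dirDeriv 𝒴 (stdVec e'') (dirDeriv 𝒴 (stdVec e') (dirDeriv 𝒴 (stdVec e) (g x)))) 𝒴 :=
    fun x e e' e'' => contDiffOn_dirDeriv hS (c2 x e e') (by norm_num) _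
  have d0 : ∀ x, DifferentiableOn ℝ (g x) 𝒴 := fun x => (hg' x).differentiableOn (by norm_num)
  have d1 : ∀ x e, DifferentiableOn ℝ (dirDeriv 𝒴 (stdVec e) (g x)) 𝒴 := fun x e =>
    (c1 x e).differentiableOn (by norm_num)
  have d2 : ∀ x e e', DifferentiableOn ℝ
      (dirDeriv 𝒴 (stdVec e') (dirDeriv 𝒴 (stdVec e) (g x))) 𝒴 := fun x e e' =>
    (c2 x e e').differentiableOn (by norm_num)
  have m1 : ∀ e, ∀ y ∈ 𝒴, Measurable fun x => dirDeriv 𝒴 (stdVec e) (g x) y := fun e y hy =>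
    measurable_dirDeriv hconv hint d0 hm e hy
  have m2 : ∀ e e', ∀ y ∈ 𝒴, Measurable fun x =>
      dirDeriv 𝒴 (stdVec e') (dirDeriv 𝒴 (stdVec e) (g x)) y := fun e e' y hy =>
    measurable_dirDeriv hconv hint (fun x => d1 x e) (m1 e) e' hy
  have m3 : ∀ e e' e'', ∀ y ∈ 𝒴, Measurable fun x =>
      dirDeriv 𝒴 (stdVec e'') (dirDeriv 𝒴 (stdVec e') (dirDeriv 𝒴 (stdVec e) (g x))) y :=
    fun e e' e'' y hy => measurable_dirDeriv hconv hint (fun x => d2 x e e') (m2 e e') e'' hy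
  have b3 : ∀ x, ∀ y ∈ 𝒴, ∀ e'' e' e,
      |dirDeriv 𝒴 (stdVec e'') (dirDeriv 𝒴 (stdVec e') (dirDeriv 𝒴 (stdVec e) (g x))) y| ≤ C :=
    fun x y hy e'' e' e => by
      rw [← iteratedFDerivWithin_three_apply hS (hg x) hy]
      exact hC x y hy e'' e' e
  obtain ⟨B2, hB2⟩ := exists_partial2_bounded_at hconv hint d0 d1 hA
  obtain ⟨B2', hB2'⟩ := exists_bound_of_partial (𝒳 := 𝒳 × Fin d × Fin d)
    (f := fun p => dirDeriv 𝒴 (stdVec p.2.1) (dirDeriv 𝒴 (stdVec p.2.2) (g p.1))) hb hconv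
    (fun p => d2 _ _ _) (fun p => hB2 p.1 p.2.1 p.2.2) (fun p y hy e => b3 _ y hy _ _ _)
  obtain ⟨B1, hB1⟩ := exists_partial_bounded_at hconv hint d0 hA
  obtain ⟨B1', hB1'⟩ := exists_bound_of_partial (𝒳 := 𝒳 × Fin d)
    (f := fun p => dirDeriv 𝒴 (stdVec p.2) (g p.1)) hb hconv
    (fun p => d1 _ _) (fun p => hB1 p.1 p.2) (fun p y hy e => hB2' (p.1, e, p.2) y hy)
  exact ⟨d0, hm, ⟨A, hA⟩, fun e => ⟨fun x => d1 x e, m1 e, ⟨B1', fun x => hB1' (x, e)⟩,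
    fun e' => ⟨fun x => d2 x e e', m2 e e', ⟨B2', fun x => hB2' (x, e', e)⟩,
    fun e'' => ⟨fun x => (c3 x e e' e'').continuousOn, m3 e e' e'',
      ⟨C, fun x y hy => b3 x y hy _ _ _⟩⟩⟩⟩⟩

end Tame

/-! ### Differentiation under the integral sign on convex sets -/

/-- Dominated convergence for the normalized remainder of the first-order expansion. On a convex set
the mean value inequality bounds it by `2 * L`, also when the base point is on the boundary. -/
lemma hasFDerivWithinAt_integral {Ω E : Type*} [MeasurableSpace Ω] {P : Measure Ω}
    [IsFiniteMeasure P] [NormedAddCommGroup E] [NormedSpace ℝ E] {S : Set E} (hS : Convex ℝ S)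
    {F : Ω → E → ℝ} {F' : Ω → E → E →L[ℝ] ℝ}
    (hF : ∀ ω, ∀ y ∈ S, HasFDerivWithinAt (F ω) (F' ω y) S y)
    (hint : ∀ y ∈ S, Integrable (fun ω => F ω y) P) {L : ℝ}
    (hL : ∀ ω, ∀ y ∈ S, ‖F' ω y‖ ≤ L) {y : E} (hy : y ∈ S) {G : E →L[ℝ] ℝ}
    (hG : ∀ v, Integrable (fun ω => F' ω y v) P ∧ G v = ∫ ω, F' ω y v ∂P) :
    HasFDerivWithinAt (fun z => ∫ ω, F ω z ∂P) G S y := by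
  rw [hasFDerivWithinAt_iff_tendsto]
  have hlim : Tendsto (fun z => ∫ ω, ‖z - y‖⁻¹ * ‖F ω z - F ω y - F' ω y (z - y)‖ ∂P)
      (𝓝[S] y) (𝓝 (∫ _ω, (0 : ℝ) ∂P)) := by
    refine tendsto_integral_filter_of_dominated_convergence (fun _ => 2 * L) ?_ ?_
      (integrable_const _) ?_
    · filter_upwards [self_mem_nhdsWithin] with z hz
      exact ((((hint z hz).sub (hint y hy)).sub (hG _).1).norm.const_mul _).aestronglyMeasurable
    · filter_upwards [self_mem_nhdsWithin] with z hz
      refine Eventually.of_forall fun ω => ?_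
      have h1 : ‖F ω z - F ω y‖ ≤ L * ‖z - y‖ :=
        hS.norm_image_sub_le_of_norm_hasFDerivWithin_le (hF ω) (hL ω) hy hz
      have h2 : ‖F' ω y (z - y)‖ ≤ L * ‖z - y‖ := (F' ω y).le_of_opNorm_le (hL ω y hy) _
      have h3 : ‖F ω z - F ω y - F' ω y (z - y)‖ ≤ 2 * L * ‖z - y‖ :=
        (norm_sub_le _ _).trans (by linarith)
      rw [norm_mul, norm_norm, norm_inv, norm_norm]
      rcases eq_or_ne ‖z - y‖ 0 with h0 | h0
      · rw [h0]
        have := (norm_nonneg _).trans (hL ω y hy)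
        simp only [inv_zero, zero_mul]
        positivity
      · rw [inv_mul_le_iff₀ (lt_of_le_of_ne (norm_nonneg _) (Ne.symm h0))]
        linarith
    · exact Eventually.of_forall fun ω => hasFDerivWithinAt_iff_tendsto.1 (hF ω y hy)
  rw [integral_zero] at hlim
  refine squeeze_zero' (Eventually.of_forall fun z => by positivity) ?_ hlim
  filter_upwards [self_mem_nhdsWithin] with z hz
  have hzy : Integrable (fun ω => F ω z - F ω y) P := (hint z hz).sub (hint y hy)
  rw [(hG _).2, ← integral_sub (hint z hz) (hint y hy),
    ← integral_sub hzy (hG _).1, integral_const_mul]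
  gcongr
  exact norm_integral_le_integral_norm _

/-! ### Expectations of products along the hidden chain -/

section PathExp

variable {Ω 𝒳 : Type*} [MeasurableSpace Ω] [MeasurableSpace 𝒳] {d n : ℕ}

/-- The expectation of `∏ k, h k X_{k+1} y_k`. -/
noncomputable def pathExp (P : Measure Ω) (X : ℤ → Ω → 𝒳) (h : Fin n → 𝒳 → Obs d → ℝ)
    (y : Fin n → Obs d) : ℝ :=
  ∫ ω, ∏ k : Fin n, h k (X (1 + (k : ℤ)) ω) (y k) ∂P

/-- Replace the `k`-th member of a family by its partial derivative. -/
noncomputable def diffAt (𝒴 : Set (Obs d)) (k : Fin n) (e : Fin d)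
    (h : Fin n → 𝒳 → Obs d → ℝ) : Fin n → 𝒳 → Obs d → ℝ :=
  Function.update h k fun x => dirDeriv 𝒴 (stdVec e) (h k x)

variable {𝒴 : Set (Obs d)} {P : Measure Ω} [IsProbabilityMeasure P] {X : ℤ → Ω → 𝒳}

lemma convex_blocks (hconv : Convex ℝ 𝒴) (n : ℕ) : Convex ℝ (blocks 𝒴 n) :=
  convex_pi fun _ _ => hconv

lemma uniqueDiffOn_blocks (hS : UniqueDiffOn ℝ 𝒴) (n : ℕ) : UniqueDiffOn ℝ (blocks 𝒴 n) :=
  UniqueDiffOn.pi fun _ _ => hS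

lemma exists_prod_bound {h : Fin n → 𝒳 → Obs d → ℝ} (hh : ∀ k, Tame 𝒴 0 (h k)) :
    ∃ C, 0 ≤ C ∧ ∀ (x : Fin n → 𝒳), ∀ y ∈ blocks 𝒴 n, |∏ k, h k (x k) (y k)| ≤ C := by
  choose C hC using fun k => (hh k).2.2
  refine ⟨∏ k, |C k|, Finset.prod_nonneg fun _ _ => abs_nonneg _, fun x y hy => ?_⟩
  rw [Finset.abs_prod]
  exact Finset.prod_le_prod (fun _ _ => abs_nonneg _) fun k _ =>
    (hC k _ _ (hy k trivial)).trans (le_abs_self _)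

lemma measurable_prod_path {h : Fin n → 𝒳 → Obs d → ℝ} (hX : ∀ k, Measurable (X k))
    (hh : ∀ k, Tame 𝒴 0 (h k)) {y : Fin n → Obs d} (hy : y ∈ blocks 𝒴 n) :
    Measurable fun ω => ∏ k : Fin n, h k (X (1 + (k : ℤ)) ω) (y k) :=
  Finset.measurable_prod _ fun k _ => ((hh k).2.1 _ (hy k trivial)).comp (hX _)

lemma integrable_prod_path {h : Fin n → 𝒳 → Obs d → ℝ} (hX : ∀ k, Measurable (X k))
    (hh : ∀ k, Tame 𝒴 0 (h k)) {y : Fin n → Obs d} (hy : y ∈ blocks 𝒴 n) :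
    Integrable (fun ω => ∏ k : Fin n, h k (X (1 + (k : ℤ)) ω) (y k)) P := by
  obtain ⟨C, -, hC⟩ := exists_prod_bound hh
  exact Integrable.of_bound (measurable_prod_path hX hh hy).aestronglyMeasurable C
    (Eventually.of_forall fun ω => hC _ y hy)

lemma continuousOn_pathExp {h : Fin n → 𝒳 → Obs d → ℝ} (hX : ∀ k, Measurable (X k))
    (hh : ∀ k, Tame 𝒴 0 (h k)) : ContinuousOn (pathExp P X h) (blocks 𝒴 n) := by
  intro y hy
  obtain ⟨C, -, hC⟩ := exists_prod_bound hh
  refine tendsto_integral_filter_of_dominated_convergence (fun _ => C) ?_ ?_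
    (integrable_const _) ?_
  · filter_upwards [self_mem_nhdsWithin] with z hz
    exact (measurable_prod_path hX hh hz).aestronglyMeasurable
  · filter_upwards [self_mem_nhdsWithin] with z hz
    exact Eventually.of_forall fun ω => hC _ z hz
  · refine Eventually.of_forall fun ω => ?_
    have : ContinuousOn (fun z : Fin n → Obs d => ∏ k : Fin n, h k (X (1 + (k : ℤ)) ω) (z k))
        (blocks 𝒴 n) := continuousOn_finsetProd _ fun k _ =>
      ((hh k).1 _).comp (continuous_apply k).continuousOn fun z hz => hz k trivial
    exact this y hy

/-- The derivative of `pathExp`. -/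
noncomputable def pathDeriv (P : Measure Ω) (X : ℤ → Ω → 𝒳) (𝒴 : Set (Obs d))
    (h : Fin n → 𝒳 → Obs d → ℝ) (y : Fin n → Obs d) : (Fin n → Obs d) →L[ℝ] ℝ :=
  ∑ k, ∑ e, pathExp P X (diffAt 𝒴 k e h) y •
    ((EuclideanSpace.proj e : Obs d →L[ℝ] ℝ).comp (ContinuousLinearMap.proj k))

lemma pathDeriv_single (h : Fin n → 𝒳 → Obs d → ℝ) (y : Fin n → Obs d) (k : Fin n) (e : Fin d) :
    pathDeriv P X 𝒴 h y (Pi.single k (stdVec e)) = pathExp P X (diffAt 𝒴 k e h) y := by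
  simp only [pathDeriv, FunLike.coe_sum, Finset.sum_apply, smul_apply,
    ContinuousLinearMap.comp_apply, ContinuousLinearMap.proj_apply, smul_eq_mul]
  rw [Finset.sum_eq_single k, Finset.sum_eq_single e]
  · simp [stdVec]
  · intro e' _ he
    simp [stdVec, he]
  · simp
  · intro k' _ hk
    simp [Pi.single_eq_of_ne hk]
  · simp

lemma diffAt_tame {r : ℕ} {h : Fin n → 𝒳 → Obs d → ℝ} (hh : ∀ k, Tame 𝒴 (r + 1) (h k))
    (k : Fin n) (e : Fin d) (j : Fin n) : Tame 𝒴 r (diffAt 𝒴 k e h j) := by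
  rcases eq_or_ne j k with rfl | hj
  · rw [diffAt, Function.update_self]
    exact (hh j).2.2.2 e
  · rw [diffAt, Function.update_of_ne hj]
    exact (hh j).of_succ

/-- The product rule inside the expectation: each term has one factor replaced by a partial
derivative and is bounded, so differentiation under the integral applies. -/
lemma hasFDerivWithinAt_pathExp {h : Fin n → 𝒳 → Obs d → ℝ} (hX : ∀ k, Measurable (X k))
    (hconv : Convex ℝ 𝒴) (hh : ∀ k, Tame 𝒴 1 (h k)) {y : Fin n → Obs d} (hy : y ∈ blocks 𝒴 n) :
    HasFDerivWithinAt (pathExp P X h) (pathDeriv P X 𝒴 h y) (blocks 𝒴 n) y := by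
  choose C hC0 hC using fun p : Fin n × Fin d =>
    exists_prod_bound (h := diffAt 𝒴 p.1 p.2 h) fun j => diffAt_tame hh p.1 p.2 j
  let pr : Fin n → Fin d → (Fin n → Obs d) →L[ℝ] ℝ := fun k e =>
    (EuclideanSpace.proj e : Obs d →L[ℝ] ℝ).comp (ContinuousLinearMap.proj k)
  refine hasFDerivWithinAt_integral (convex_blocks hconv n)
    (F' := fun ω z => ∑ k, ∑ e,
      (∏ j : Fin n, diffAt 𝒴 k e h j (X (1 + (j : ℤ)) ω) (z j)) • pr k e)
    (L := ∑ k, ∑ e, C (k, e) * ‖pr k e‖) (fun ω z hz => ?_)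
    (fun z hz => integrable_prod_path hX (fun k => (hh k).zero) hz) (fun ω z hz => ?_) hy
    (fun v => ?_)
  · have hk : ∀ k, HasFDerivWithinAt (fun z : Fin n → Obs d => h k (X (1 + (k : ℤ)) ω) (z k))
        ((fderivWithin ℝ (h k (X (1 + (k : ℤ)) ω)) 𝒴 (z k)).comp (ContinuousLinearMap.proj k))
        (blocks 𝒴 n) z := fun k =>
      ((hh k).1 _ _ (hz k trivial)).hasFDerivWithinAt.comp z
        (ContinuousLinearMap.proj (R := ℝ) (φ := fun _ : Fin n => Obs d) k).hasFDerivWithinAt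
        fun w hw => hw k trivial
    refine (HasFDerivWithinAt.finsetProd fun k _ => hk k).congr_fderiv ?_
    refine Finset.sum_congr rfl fun k _ => ?_
    have : (fderivWithin ℝ (h k (X (1 + (k : ℤ)) ω)) 𝒴 (z k)).comp
        (ContinuousLinearMap.proj k) = ∑ e, dirDeriv 𝒴 (stdVec e) (h k (X (1 + (k : ℤ)) ω)) (z k) •
          pr k e := by
      ext v
      simp only [FunLike.coe_sum, Finset.sum_apply, smul_apply, pr,
        ContinuousLinearMap.comp_apply, ContinuousLinearMap.proj_apply, smul_eq_mul]
      conv_lhs => rw [sum_smul_stdVec (v k), map_sum]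
      refine Finset.sum_congr rfl fun e _ => ?_
      rw [map_smul, smul_eq_mul, mul_comm]
      rfl
    rw [this, Finset.smul_sum]
    refine Finset.sum_congr rfl fun e _ => ?_
    rw [smul_smul, ← Finset.mul_prod_erase _ _ (Finset.mem_univ k), diffAt, Function.update_self,
      mul_comm]
    congr 2
    refine Finset.prod_congr rfl fun j hj => ?_
    rw [Function.update_of_ne (Finset.ne_of_mem_erase hj)]
  · refine (norm_sum_le _ _).trans (Finset.sum_le_sum fun k _ => ?_)
    refine (norm_sum_le _ _).trans (Finset.sum_le_sum fun e _ => ?_)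
    rw [norm_smul]
    gcongr
    exact hC (k, e) _ z hz
  · have hi : ∀ k e, Integrable (fun ω =>
        (∏ j : Fin n, diffAt 𝒴 k e h j (X (1 + (j : ℤ)) ω) (y j)) * pr k e v) P := fun k e =>
      (integrable_prod_path hX (fun j => diffAt_tame hh k e j) hy).mul_const _
    simp only [FunLike.coe_sum, Finset.sum_apply, smul_apply, smul_eq_mul]
    refine ⟨integrable_finsetSum _ fun k _ => integrable_finsetSum _ fun e _ => hi k e, ?_⟩
    rw [integral_finsetSum _ fun k _ => integrable_finsetSum _ fun e _ => hi k e]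
    simp only [pathDeriv, FunLike.coe_sum, Finset.sum_apply, smul_apply, smul_eq_mul]
    refine Finset.sum_congr rfl fun k _ => ?_
    rw [integral_finsetSum _ fun e _ => hi k e]
    refine Finset.sum_congr rfl fun e _ => ?_
    rw [integral_mul_const]
    rfl

/-- The coefficients of the derivative are again path expectations, for families with one member
differentiated. The induction therefore runs over families whose members may differ, even if only
the constant family `g` is of final interest. -/
lemma contDiffOn_pathExp (hX : ∀ k, Measurable (X k)) (hconv : Convex ℝ 𝒴)
    (hS : UniqueDiffOn ℝ 𝒴) (r : ℕ) {h : Fin n → 𝒳 → Obs d → ℝ} (hh : ∀ k, Tame 𝒴 r (h k)) :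
    ContDiffOn ℝ r (pathExp P X h) (blocks 𝒴 n) := by
  induction r generalizing h with
  | zero => exact contDiffOn_zero.2 (continuousOn_pathExp hX hh)
  | succ r ih =>
    have h1 : ∀ k, Tame 𝒴 1 (h k) := fun k =>
      ⟨(hh k).1, (hh k).2.1, (hh k).2.2.1, fun e => ((hh k).2.2.2 e).zero⟩
    push_cast
    rw [contDiffOn_succ_iff_hasFDerivWithinAt_of_uniqueDiffOn (uniqueDiffOn_blocks hS n)]
    refine ⟨by simp, pathDeriv P X 𝒴 h, ?_, fun y hy =>
      hasFDerivWithinAt_pathExp hX hconv h1 hy⟩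
    exact ContDiffOn.sum fun k _ => ContDiffOn.sum fun e _ =>
      (ih fun j => diffAt_tame hh k e j).smul contDiffOn_const

end PathExp

/-! ### Third derivatives of logarithms -/

section LogDeriv

variable {E : Type*} [NormedAddCommGroup E] [NormedSpace ℝ E] {S : Set E}

lemma dirDeriv_log {f : E → ℝ} (hS : UniqueDiffOn ℝ S) {y : E} (hy : y ∈ S)
    (hf : DifferentiableWithinAt ℝ f S y) (hpos : 0 < f y) (v : E) :
    dirDeriv S v (fun z => Real.log (f z)) y = dirDeriv S v f y / f y := by
  rw [(hf.hasFDerivWithinAt.log hpos.ne').dirDeriv (hS y hy), dirDeriv, smul_apply, smul_eq_mul,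
    div_eq_inv_mul]

lemma hasFDerivWithinAt_div {f a : E → ℝ} {y : E}
    (ha : DifferentiableWithinAt ℝ a S y) (hf : DifferentiableWithinAt ℝ f S y) (hpos : 0 < f y) :
    HasFDerivWithinAt (fun z => a z / f z) (a y • (-(f y ^ 2)⁻¹) • fderivWithin ℝ f S y +
      (f y)⁻¹ • fderivWithin ℝ a S y) S y := by
  simp only [div_eq_mul_inv]
  exact ha.hasFDerivWithinAt.fun_mul
    ((hasDerivAt_inv hpos.ne').comp_hasFDerivWithinAt y hf.hasFDerivWithinAt)

lemma dirDeriv_div {f a : E → ℝ} (hS : UniqueDiffOn ℝ S) {y : E} (hy : y ∈ S)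
    (ha : DifferentiableWithinAt ℝ a S y) (hf : DifferentiableWithinAt ℝ f S y) (hpos : 0 < f y)
    (v : E) : dirDeriv S v (fun z => a z / f z) y =
      dirDeriv S v a y / f y - a y / f y * (dirDeriv S v f y / f y) := by
  rw [(hasFDerivWithinAt_div ha hf hpos).dirDeriv (hS y hy) v]
  simp only [dirDeriv, smul_apply, add_apply, smul_eq_mul]
  field_simp
  ring

lemma dirDeriv_mul {a b : E → ℝ} (hS : UniqueDiffOn ℝ S) {y : E} (hy : y ∈ S)
    (ha : DifferentiableWithinAt ℝ a S y) (hb : DifferentiableWithinAt ℝ b S y) (v : E) :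
    dirDeriv S v (fun z => a z * b z) y = a y * dirDeriv S v b y + b y * dirDeriv S v a y := by
  rw [(ha.hasFDerivWithinAt.fun_mul hb.hasFDerivWithinAt).dirDeriv (hS y hy) v]
  simp [dirDeriv]

lemma dirDeriv_sub {a b : E → ℝ} (hS : UniqueDiffOn ℝ S) {y : E} (hy : y ∈ S)
    (ha : DifferentiableWithinAt ℝ a S y) (hb : DifferentiableWithinAt ℝ b S y) (v : E) :
    dirDeriv S v (fun z => a z - b z) y = dirDeriv S v a y - dirDeriv S v b y := by
  rw [(ha.hasFDerivWithinAt.fun_sub hb.hasFDerivWithinAt).dirDeriv (hS y hy) v]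
  simp [dirDeriv]

/-- With subscripts for derivatives divided by `f`, the left side is `f_uvw - f_vw f_u - f_w f_uv -
f_v f_uw + 2 f_u f_v f_w`, and each subscripted quantity is at most `K` in absolute value. -/
lemma abs_dirDeriv_three_log_le {f : E → ℝ} (hS : UniqueDiffOn ℝ S)
    (hf : ContDiffOn ℝ (3 : ℕ) f S) (hpos : ∀ y ∈ S, 0 < f y) {K : ℝ} {u v w y : E} (hy : y ∈ S)
    (hu : |dirDeriv S u f y| ≤ K * f y) (hv : |dirDeriv S v f y| ≤ K * f y)
    (hw : |dirDeriv S w f y| ≤ K * f y)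
    (huv : |dirDeriv S u (dirDeriv S v f) y| ≤ K * f y)
    (huw : |dirDeriv S u (dirDeriv S w f) y| ≤ K * f y)
    (hvw : |dirDeriv S v (dirDeriv S w f) y| ≤ K * f y)
    (huvw : |dirDeriv S u (dirDeriv S v (dirDeriv S w f)) y| ≤ K * f y) :
    |dirDeriv S u (dirDeriv S v (dirDeriv S w fun z => Real.log (f z))) y| ≤
      K + 3 * K ^ 2 + 2 * K ^ 3 := by
  have d0 : ∀ z ∈ S, DifferentiableWithinAt ℝ f S z := hf.differentiableOn (by norm_num)
  have c1 : ∀ a, ContDiffOn ℝ (2 : ℕ) (dirDeriv S a f) S := fun a =>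
    contDiffOn_dirDeriv hS hf (by norm_num) a
  have d1 : ∀ a, ∀ z ∈ S, DifferentiableWithinAt ℝ (dirDeriv S a f) S z := fun a =>
    (c1 a).differentiableOn (by norm_num)
  have d2 : ∀ a b, ∀ z ∈ S, DifferentiableWithinAt ℝ (dirDeriv S a (dirDeriv S b f)) S z :=
    fun a b => (contDiffOn_dirDeriv hS (c1 b) (by norm_num) a :
      ContDiffOn ℝ (1 : ℕ) _ S).differentiableOn (by norm_num)
  have q : ∀ {a : E → ℝ} {z}, z ∈ S → DifferentiableWithinAt ℝ a S z →
      DifferentiableWithinAt ℝ (fun z => a z / f z) S z := fun hz ha =>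
    (hasFDerivWithinAt_div ha (d0 _ hz) (hpos _ hz)).differentiableWithinAt
  have e1 : ∀ z ∈ S, dirDeriv S w (fun z => Real.log (f z)) z = dirDeriv S w f z / f z :=
    fun z hz => dirDeriv_log hS hz (d0 z hz) (hpos z hz) w
  have e2 : ∀ z ∈ S, dirDeriv S v (dirDeriv S w fun z => Real.log (f z)) z =
      dirDeriv S v (dirDeriv S w f) z / f z -
        dirDeriv S w f z / f z * (dirDeriv S v f z / f z) := fun z hz => by
    rw [dirDeriv_congr e1 v hz, dirDeriv_div hS hz (d1 w z hz) (d0 z hz) (hpos z hz)]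
  rw [dirDeriv_congr e2 u hy,
    dirDeriv_sub hS hy (q hy (d2 v w y hy)) ((q hy (d1 w y hy)).fun_mul (q hy (d1 v y hy))),
    dirDeriv_mul hS hy (q hy (d1 w y hy)) (q hy (d1 v y hy)),
    dirDeriv_div hS hy (d2 v w y hy) (d0 y hy) (hpos y hy),
    dirDeriv_div hS hy (d1 v y hy) (d0 y hy) (hpos y hy),
    dirDeriv_div hS hy (d1 w y hy) (d0 y hy) (hpos y hy)]
  have r : ∀ {a : ℝ}, |a| ≤ K * f y → |a / f y| ≤ K := fun h => by
    rwa [abs_div, abs_of_pos (hpos y hy), div_le_iff₀ (hpos y hy)]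
  have hK : 0 ≤ K := (abs_nonneg _).trans (r hu)
  have p2 : ∀ {a b : ℝ}, |a| ≤ K → |b| ≤ K → |a * b| ≤ K ^ 2 := fun ha hb => by
    rw [abs_mul, pow_two]
    exact mul_le_mul ha hb (abs_nonneg _) hK
  have p3 : ∀ {a b c : ℝ}, |a| ≤ K → |b| ≤ K → |c| ≤ K → |a * b * c| ≤ K ^ 3 := fun ha hb hc => by
    rw [abs_mul, pow_succ]
    exact mul_le_mul (p2 ha hb) hc (abs_nonneg _) (by positivity)
  have t1 := abs_le.1 (r huvw)
  have t2 := abs_le.1 (p2 (r hvw) (r hu))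
  have t3 := abs_le.1 (p2 (r hw) (r huv))
  have t4 := abs_le.1 (p3 (r hw) (r hv) (r hu))
  have t5 := abs_le.1 (p2 (r hv) (r huw))
  rw [abs_le]
  constructor <;> linarith

end LogDeriv

/-! ### Uniform bounds on the derivatives of the log-densities -/

section LogDensity

variable {Ω 𝒳 : Type*} [MeasurableSpace Ω] [MeasurableSpace 𝒳] {d n : ℕ}

/-- `h` and its partial derivatives up to order `r` are bounded by `C`. -/
def DerivLe (𝒴 : Set (Obs d)) (C : ℝ) : ℕ → (𝒳 → Obs d → ℝ) → Prop
  | 0, h => ∀ x, ∀ y ∈ 𝒴, |h x y| ≤ C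
  | r + 1, h => (∀ x, ∀ y ∈ 𝒴, |h x y| ≤ C) ∧
      ∀ e, DerivLe 𝒴 C r fun x => dirDeriv 𝒴 (stdVec e) (h x)

variable {𝒴 : Set (Obs d)} {P : Measure Ω} [IsProbabilityMeasure P] {X : ℤ → Ω → 𝒳}

lemma DerivLe.bound {C : ℝ} {r : ℕ} {h : 𝒳 → Obs d → ℝ} (hh : DerivLe 𝒴 C r h) :
    ∀ x, ∀ y ∈ 𝒴, |h x y| ≤ C := by
  cases r with
  | zero => exact hh
  | succ r => exact hh.1

lemma DerivLe.mono {C C' : ℝ} (hC : C ≤ C') {r : ℕ} {h : 𝒳 → Obs d → ℝ}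
    (hh : DerivLe 𝒴 C r h) : DerivLe 𝒴 C' r h := by
  induction r generalizing h with
  | zero => exact fun x y hy => (hh x y hy).trans hC
  | succ r ih => exact ⟨fun x y hy => (hh.1 x y hy).trans hC, fun e => ih (hh.2 e)⟩

lemma DerivLe.of_succ {C : ℝ} {r : ℕ} {h : 𝒳 → Obs d → ℝ} (hh : DerivLe 𝒴 C (r + 1) h) :
    DerivLe 𝒴 C r h := by
  induction r generalizing h with
  | zero => exact hh.1
  | succ r ih => exact ⟨hh.1, fun e => ih (hh.2 e)⟩

lemma Tame.exists_derivLe {r : ℕ} {h : 𝒳 → Obs d → ℝ} (hh : Tame 𝒴 r h) :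
    ∃ C, DerivLe 𝒴 C r h := by
  induction r generalizing h with
  | zero => exact hh.2.2
  | succ r ih =>
    obtain ⟨C, hC⟩ := hh.2.2.1
    choose C' hC' using fun e => ih (hh.2.2.2 e)
    refine ⟨|C| + ∑ e, |C' e|, fun x y hy => ?_, fun e => (hC' e).mono ?_⟩
    · have := Finset.sum_nonneg fun e (_ : e ∈ Finset.univ) => abs_nonneg (C' e)
      linarith [hC x y hy, le_abs_self C]
    · have := Finset.single_le_sum (fun e _ => abs_nonneg (C' e)) (Finset.mem_univ e)
      linarith [le_abs_self (C' e), abs_nonneg C]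

/-- The members of the family `h` are `g`, except those with an index in `s`, which are bounded
with their partial derivatives up to order `r`. -/
def IsModif (𝒴 : Set (Obs d)) (g : 𝒳 → Obs d → ℝ) (C : ℝ) (r : ℕ) (s : Finset (Fin n))
    (h : Fin n → 𝒳 → Obs d → ℝ) : Prop :=
  (∀ j, DerivLe 𝒴 C r (h j)) ∧ ∀ j, j ∉ s → h j = g

lemma IsModif.diffAt {g : 𝒳 → Obs d → ℝ} {C : ℝ} {r : ℕ} {s : Finset (Fin n)}
    {h : Fin n → 𝒳 → Obs d → ℝ} (hh : IsModif 𝒴 g C (r + 1) s h) (k : Fin n) (e : Fin d) :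
    IsModif 𝒴 g C r (insert k s) (diffAt 𝒴 k e h) := by
  refine ⟨fun j => ?_, fun j hj => ?_⟩
  · rcases eq_or_ne j k with rfl | hjk
    · rw [HMMDetection.diffAt, Function.update_self]
      exact (hh.1 j).2 e
    · rw [HMMDetection.diffAt, Function.update_of_ne hjk]
      exact (hh.1 j).of_succ
  · rw [Finset.mem_insert, not_or] at hj
    rw [HMMDetection.diffAt, Function.update_of_ne hj.1]
    exact hh.2 j hj.2

/-- Factor by factor: a modified factor is at most `C ≤ c * gm ≤ c * g`, an unmodified one equals
`g`. The constant depends on the number of modified factors only, not on `n`. -/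
lemma IsModif.abs_pathExp_le {g : 𝒳 → Obs d → ℝ} {C : ℝ} {r : ℕ} {s : Finset (Fin n)}
    {h : Fin n → 𝒳 → Obs d → ℝ} (hh : IsModif 𝒴 g C r s h) (hX : ∀ k, Measurable (X k))
    (hg : Tame 𝒴 0 g) {gm : ℝ} (hgm : 0 < gm) (hgm_le : ∀ x, ∀ y ∈ 𝒴, gm ≤ g x y)
    {c : ℝ} (hc : 1 ≤ c) (hCc : C / gm ≤ c) {N : ℕ} (hs : s.card ≤ N) {y : Fin n → Obs d}
    (hy : y ∈ blocks 𝒴 n) :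
    |pathExp P X h y| ≤ c ^ N * pathExp P X (fun _ => g) y := by
  rw [pathExp, pathExp, ← integral_const_mul, ← Real.norm_eq_abs]
  refine (norm_integral_le_of_norm_le
    ((integrable_prod_path (P := P) hX (fun _ => hg) hy).const_mul (c ^ N))
    (Eventually.of_forall fun ω => ?_))
  rw [Real.norm_eq_abs, Finset.abs_prod]
  calc ∏ k : Fin n, |h k (X (1 + (k : ℤ)) ω) (y k)|
      ≤ ∏ k : Fin n, ((if k ∈ s then c else 1) * g (X (1 + (k : ℤ)) ω) (y k)) := by
        refine Finset.prod_le_prod (fun _ _ => abs_nonneg _) fun k _ => ?_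
        have hgk := hgm_le (X (1 + (k : ℤ)) ω) (y k) (hy k trivial)
        split_ifs with hk
        · refine ((hh.1 k).bound _ _ (hy k trivial)).trans ?_
          rw [div_le_iff₀ hgm] at hCc
          nlinarith
        · rw [hh.2 k hk, one_mul, abs_of_pos (hgm.trans_le hgk)]
    _ = c ^ s.card * ∏ k : Fin n, g (X (1 + (k : ℤ)) ω) (y k) := by
        rw [Finset.prod_mul_distrib, Finset.prod_ite_mem, Finset.univ_inter, Finset.prod_const]
    _ ≤ _ := by
        have : 0 ≤ ∏ k : Fin n, g (X (1 + (k : ℤ)) ω) (y k) := Finset.prod_nonneg fun k _ =>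
          hgm.le.trans (hgm_le _ _ (hy k trivial))
        gcongr

lemma pathExp_pos {g : 𝒳 → Obs d → ℝ} (hX : ∀ k, Measurable (X k))
    (hg : Tame 𝒴 0 g) {gm : ℝ} (hgm : 0 < gm) (hgm_le : ∀ x, ∀ y ∈ 𝒴, gm ≤ g x y)
    {y : Fin n → Obs d} (hy : y ∈ blocks 𝒴 n) : 0 < pathExp P X (fun _ => g) y := by
  refine lt_of_lt_of_le (pow_pos hgm n) ?_
  have : gm ^ n = ∫ _ω, gm ^ n ∂P := by simp
  rw [this, pathExp]
  refine integral_mono (integrable_const _) (integrable_prod_path hX (fun _ => hg) hy) fun ω => ?_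
  have := Finset.prod_le_prod (s := Finset.univ) (f := fun _ : Fin n => gm)
    (g := fun k : Fin n => g (X (1 + (k : ℤ)) ω) (y k)) (fun _ _ => hgm.le)
    fun k _ => hgm_le _ _ (hy k trivial)
  simpa using this

lemma dirDeriv_pathExp {h : Fin n → 𝒳 → Obs d → ℝ} (hX : ∀ k, Measurable (X k))
    (hconv : Convex ℝ 𝒴) (hS : UniqueDiffOn ℝ 𝒴) {r : ℕ} (hh : ∀ k, Tame 𝒴 (r + 1) (h k))
    {y : Fin n → Obs d} (hy : y ∈ blocks 𝒴 n) (k : Fin n) (e : Fin d) :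
    dirDeriv (blocks 𝒴 n) (Pi.single k (stdVec e)) (pathExp P X h) y =
      pathExp P X (diffAt 𝒴 k e h) y := by
  have h1 : ∀ k, Tame 𝒴 1 (h k) := fun k =>
    ⟨(hh k).1, (hh k).2.1, (hh k).2.2.1, fun e => ((hh k).2.2.2 e).zero⟩
  rw [(hasFDerivWithinAt_pathExp hX hconv h1 hy).dirDeriv (uniqueDiffOn_blocks hS n y hy),
    pathDeriv_single]

/-- The third partial derivatives of the log-densities are bounded uniformly in the length of the
block. The bound does not depend on the law of the hidden chain. -/
lemma exists_blockPartial3_log_le (hconv : Convex ℝ 𝒴) (hS : UniqueDiffOn ℝ 𝒴)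
    {g : 𝒳 → Obs d → ℝ} (hg : Tame 𝒴 3 g) {gm : ℝ} (hgm : 0 < gm)
    (hgm_le : ∀ x, ∀ y ∈ 𝒴, gm ≤ g x y) :
    ∃ C : ℝ, ∀ (P : Measure Ω) [IsProbabilityMeasure P] (X : ℤ → Ω → 𝒳),
      (∀ k, Measurable (X k)) → ∀ n, ∀ y ∈ blocks 𝒴 n, ∀ (k l r : Fin n) (a b c : Fin d),
        |blockPartial3 𝒴 (fun y' => Real.log (pathExp P X (fun _ : Fin n => g) y'))
          k l r a b c y| ≤ C := by
  obtain ⟨C, hC⟩ := hg.exists_derivLe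
  set c := max 1 (C / gm) with hcdef
  have hc : 1 ≤ c := le_max_left _ _
  have hCc : C / gm ≤ c := le_max_right _ _
  -- The bound of `abs_dirDeriv_three_log_le` with `K = c ^ 3`, since a derivative of order at most
  -- three modifies at most three factors.
  refine ⟨c ^ 3 + 3 * (c ^ 3) ^ 2 + 2 * (c ^ 3) ^ 3, fun P _ X hX n y hy k l r a b e => ?_⟩
  have hUD := uniqueDiffOn_blocks hS n
  have hCD : ContDiffOn ℝ (3 : ℕ) (pathExp P X fun _ : Fin n => g) (blocks 𝒴 n) :=
    contDiffOn_pathExp hX hconv hS 3 fun _ => hg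
  have hpos : ∀ z ∈ blocks 𝒴 n, 0 < pathExp P X (fun _ => g) z := fun z hz =>
    pathExp_pos hX hg.zero hgm hgm_le hz
  have hlog : ContDiffOn ℝ 3 (fun z => Real.log (pathExp P X (fun _ : Fin n => g) z))
      (blocks 𝒴 n) := ContDiffOn.log (by exact_mod_cast hCD) fun z hz => (hpos z hz).ne'
  rw [blockPartial3, iteratedFDerivWithin_three_apply hUD hlog hy]
  have m0 : IsModif 𝒴 g C 3 (∅ : Finset (Fin n)) fun _ => g := ⟨fun _ => hC, fun _ _ => rfl⟩
  have t0 : ∀ _ : Fin n, Tame 𝒴 3 g := fun _ => hg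
  have t1 : ∀ k a j, Tame 𝒴 2 (diffAt 𝒴 k a (fun _ : Fin n => g) j) := fun k a =>
    diffAt_tame t0 k a
  have t2 : ∀ l b k a j, Tame 𝒴 1 (diffAt 𝒴 l b (diffAt 𝒴 k a (fun _ : Fin n => g)) j) :=
    fun l b k a => diffAt_tame (t1 k a) l b
  have b1 : ∀ (k : Fin n) a, |dirDeriv (blocks 𝒴 n) (Pi.single k (stdVec a))
      (pathExp P X fun _ => g) y| ≤ c ^ 3 * pathExp P X (fun _ => g) y := fun k a => by
    rw [dirDeriv_pathExp hX hconv hS t0 hy]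
    exact (m0.diffAt k a).abs_pathExp_le hX hg.zero hgm hgm_le hc hCc (by simp) hy
  have b2 : ∀ (k l : Fin n) a b, |dirDeriv (blocks 𝒴 n) (Pi.single k (stdVec a))
      (dirDeriv (blocks 𝒴 n) (Pi.single l (stdVec b)) (pathExp P X fun _ => g)) y| ≤
        c ^ 3 * pathExp P X (fun _ => g) y := fun k l a b => by
    rw [dirDeriv_congr (fun z hz => dirDeriv_pathExp hX hconv hS t0 hz l b) _ hy,
      dirDeriv_pathExp hX hconv hS (t1 l b) hy]
    exact ((m0.diffAt l b).diffAt k a).abs_pathExp_le hX hg.zero hgm hgm_le hc hCc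
      ((Finset.card_insert_le _ _).trans (by simp)) hy
  refine abs_dirDeriv_three_log_le hUD hCD hpos hy (b1 _ _) (b1 _ _) (b1 _ _) (b2 _ _ _ _)
    (b2 _ _ _ _) (b2 _ _ _ _) ?_
  rw [dirDeriv_congr (fun z hz => (dirDeriv_congr
      (fun z hz => dirDeriv_pathExp hX hconv hS t0 hz r e) _ hz).trans
      (dirDeriv_pathExp hX hconv hS (t1 r e) hz l b)) _ hy,
    dirDeriv_pathExp hX hconv hS (t2 l b r e) hy]
  exact (((m0.diffAt r e).diffAt l b).diffAt k a).abs_pathExp_le hX hg.zero hgm hgm_le hc hCc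
    ((Finset.card_insert_le _ _).trans (by
      have := Finset.card_insert_le l (insert r (∅ : Finset (Fin n)))
      simp only [insert_empty_eq, Finset.card_singleton] at this ⊢
      omega)) hy

end LogDensity

/-! ### Transfer operators -/

section Transfer

variable {𝒳 : Type*} [MeasurableSpace 𝒳]

/-- Bounded measurable functions. -/
def BddMeas (h : 𝒳 → ℝ) : Prop := Measurable h ∧ ∃ C, ∀ x, |h x| ≤ C

lemma BddMeas.const (c : ℝ) : BddMeas fun _ : 𝒳 => c := ⟨measurable_const, |c|, fun _ => le_rfl⟩

lemma BddMeas.mul {h k : 𝒳 → ℝ} (hh : BddMeas h) (hk : BddMeas k) :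
    BddMeas fun x => h x * k x := by
  obtain ⟨C, hC⟩ := hh.2
  obtain ⟨D, hD⟩ := hk.2
  refine ⟨hh.1.mul hk.1, C * D, fun x => ?_⟩
  rw [abs_mul]
  exact mul_le_mul (hC x) (hD x) (abs_nonneg _) ((abs_nonneg _).trans (hC x))

lemma BddMeas.sub {h k : 𝒳 → ℝ} (hh : BddMeas h) (hk : BddMeas k) :
    BddMeas fun x => h x - k x := by
  obtain ⟨C, hC⟩ := hh.2
  obtain ⟨D, hD⟩ := hk.2
  exact ⟨hh.1.sub hk.1, C + D, fun x => (abs_sub _ _).trans (add_le_add (hC x) (hD x))⟩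

lemma BddMeas.const_mul {h : 𝒳 → ℝ} (hh : BddMeas h) (c : ℝ) : BddMeas fun x => c * h x :=
  (BddMeas.const c).mul hh

lemma BddMeas.integrable {h : 𝒳 → ℝ} (hh : BddMeas h) (μ : Measure 𝒳) [IsFiniteMeasure μ] :
    Integrable h μ := by
  obtain ⟨C, hC⟩ := hh.2
  exact Integrable.of_bound hh.1.aestronglyMeasurable C (Eventually.of_forall hC)

/-- The transition operator of the kernel `Q` weighted by the function `f`. -/
noncomputable def transfer (Q : Kernel 𝒳 𝒳) (f h : 𝒳 → ℝ) (x : 𝒳) : ℝ :=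
  ∫ x', f x' * h x' ∂(Q x)

/-- The product of the transfer operators with weights `f a, …, f (a + n - 1)`. -/
noncomputable def iterTransfer (Q : Kernel 𝒳 𝒳) (f : ℤ → 𝒳 → ℝ) :
    ℤ → ℕ → (𝒳 → ℝ) → 𝒳 → ℝ
  | _, 0, h => h
  | a, n + 1, h => transfer Q (f a) (iterTransfer Q f (a + 1) n h)

variable {Q : Kernel 𝒳 𝒳} [IsMarkovKernel Q] {f : ℤ → 𝒳 → ℝ}

lemma BddMeas.transfer {f h : 𝒳 → ℝ} (hf : BddMeas f) (hh : BddMeas h) :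
    BddMeas (transfer Q f h) := by
  have hfh := hf.mul hh
  obtain ⟨C, hC⟩ := hfh.2
  refine ⟨(hfh.1.stronglyMeasurable.integral_kernel (κ := Q)).measurable, C, fun x => ?_⟩
  have := norm_integral_le_of_norm_le_const (μ := Q x) (f := fun x' => f x' * h x') (C := C)
    (Eventually.of_forall hC)
  simpa [HMMDetection.transfer] using this

lemma BddMeas.iterTransfer (hf : ∀ t, BddMeas (f t)) {h : 𝒳 → ℝ} (hh : BddMeas h) (a : ℤ)
    (n : ℕ) : BddMeas (iterTransfer Q f a n h) := by
  induction n generalizing a with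
  | zero => exact hh
  | succ n ih => exact (hf a).transfer (ih (a + 1))

lemma iterTransfer_add (a : ℤ) (m n : ℕ) (h : 𝒳 → ℝ) :
    iterTransfer Q f a (m + n) h = iterTransfer Q f a m (iterTransfer Q f (a + m) n h) := by
  induction m generalizing a with
  | zero => simp [iterTransfer]
  | succ m ih =>
    rw [Nat.add_right_comm, iterTransfer, iterTransfer, ih]
    push_cast
    rw [add_assoc, add_comm (1 : ℤ)]

lemma iterTransfer_one (a : ℤ) (h : 𝒳 → ℝ) : iterTransfer Q f a 1 h = transfer Q (f a) h := rfl

lemma iterTransfer_congr {f' : ℤ → 𝒳 → ℝ} {a : ℤ} {n : ℕ}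
    (hff' : ∀ t, a ≤ t → t < a + n → f t = f' t) (h : 𝒳 → ℝ) :
    iterTransfer Q f a n h = iterTransfer Q f' a n h := by
  induction n generalizing a with
  | zero => rfl
  | succ n ih =>
    rw [iterTransfer, iterTransfer, hff' a le_rfl (by push_cast; omega),
      ih fun t h1 h2 => hff' t (by omega) (by push_cast; omega)]

lemma transfer_sub_const_mul {f h k : 𝒳 → ℝ} (hf : BddMeas f) (hh : BddMeas h) (hk : BddMeas k)
    (c : ℝ) (x : 𝒳) :
    transfer Q f (fun x => h x - c * k x) x = transfer Q f h x - c * transfer Q f k x := by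
  rw [transfer, transfer, transfer, ← integral_const_mul,
    ← integral_sub ((hf.mul hh).integrable _) (((hf.mul hk).integrable _).const_mul c)]
  congr with x'
  ring

lemma iterTransfer_sub_const_mul (hf : ∀ t, BddMeas (f t)) {h k : 𝒳 → ℝ} (hh : BddMeas h)
    (hk : BddMeas k) (c : ℝ) (a : ℤ) (n : ℕ) (x : 𝒳) :
    iterTransfer Q f a n (fun x => h x - c * k x) x =
      iterTransfer Q f a n h x - c * iterTransfer Q f a n k x := by
  induction n generalizing a x with
  | zero => rfl
  | succ n ih =>
    simp only [iterTransfer]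
    rw [show iterTransfer Q f (a + 1) n (fun x => h x - c * k x) = fun x =>
      iterTransfer Q f (a + 1) n h x - c * iterTransfer Q f (a + 1) n k x from
        funext fun x => ih (a + 1) x]
    exact transfer_sub_const_mul (hf a) (hh.iterTransfer hf _ _) (hk.iterTransfer hf _ _) c x

lemma transfer_mono {f h k : 𝒳 → ℝ} (hf : BddMeas f) (hf0 : ∀ x, 0 ≤ f x) (hh : BddMeas h)
    (hk : BddMeas k) (hhk : ∀ x, h x ≤ k x) (x : 𝒳) : transfer Q f h x ≤ transfer Q f k x :=
  integral_mono ((hf.mul hh).integrable _) ((hf.mul hk).integrable _)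
    fun x' => mul_le_mul_of_nonneg_left (hhk x') (hf0 x')

lemma iterTransfer_mono (hf : ∀ t, BddMeas (f t)) (hf0 : ∀ t x, 0 ≤ f t x) {h k : 𝒳 → ℝ}
    (hh : BddMeas h) (hk : BddMeas k) (hhk : ∀ x, h x ≤ k x) (a : ℤ) (n : ℕ) (x : 𝒳) :
    iterTransfer Q f a n h x ≤ iterTransfer Q f a n k x := by
  induction n generalizing a x with
  | zero => exact hhk x
  | succ n ih =>
    exact transfer_mono (hf a) (hf0 a) (hh.iterTransfer hf _ _) (hk.iterTransfer hf _ _)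
      (fun x => ih (a + 1) x) x

lemma iterTransfer_const_mul (hf : ∀ t, BddMeas (f t)) {k : 𝒳 → ℝ} (hk : BddMeas k) (c : ℝ)
    (a : ℤ) (n : ℕ) (x : 𝒳) :
    iterTransfer Q f a n (fun x => c * k x) x = c * iterTransfer Q f a n k x := by
  have h0 : BddMeas fun _ : 𝒳 => (0 : ℝ) := BddMeas.const 0
  -- The case `h = k`, `c = 1` says that the operator maps `0` to `0`; homogeneity then follows from
  -- the case `h = 0`.
  have h1 := iterTransfer_sub_const_mul (Q := Q) hf hk hk 1 a n x
  have h2 := iterTransfer_sub_const_mul (Q := Q) hf h0 hk (-c) a n x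
  have h3 : iterTransfer Q f a n (fun _ => 0) x = 0 := by
    simpa using h1
  rw [h3] at h2
  simpa using h2

/-- The weights `f t` are comparable to constants, with ratio at most `gp / gm`. -/
def Comparable (gm gp : ℝ) (f : ℤ → 𝒳 → ℝ) : Prop :=
  ∀ t, Measurable (f t) ∧ ∃ c > 0, ∀ x, c * gm ≤ f t x ∧ f t x ≤ c * gp

/-- The `m`-step transition probabilities are comparable to the measure `ref`. -/
def Minorized (Q : Kernel 𝒳 𝒳) (ref : Measure 𝒳) (m : ℕ) (σm σp : ℝ) : Prop :=
  ∀ h : 𝒳 → ℝ, BddMeas h → (∀ x, 0 ≤ h x) → ∀ x,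
    σm * ∫ x', h x' ∂ref ≤ ∫ x', h x' ∂((Q ^ m) x) ∧
      ∫ x', h x' ∂((Q ^ m) x) ≤ σp * ∫ x', h x' ∂ref

/-- Functions bounded below by a positive constant. -/
def PosBelow (h : 𝒳 → ℝ) : Prop := ∃ ε > 0, ∀ x, ε ≤ h x

variable {gm gp : ℝ}

lemma Comparable.nonneg (hgm : 0 < gm) (hf : Comparable gm gp f) (t : ℤ) (x : 𝒳) : 0 ≤ f t x := by
  obtain ⟨c, hc, h⟩ := (hf t).2
  exact (mul_pos hc hgm).le.trans (h x).1

lemma Comparable.bddMeas (hgm : 0 < gm) (hf : Comparable gm gp f) (t : ℤ) : BddMeas (f t) := by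
  obtain ⟨c, hc, h⟩ := (hf t).2
  exact ⟨(hf t).1, c * gp, fun x => by rw [abs_of_nonneg (hf.nonneg hgm t x)]; exact (h x).2⟩

lemma PosBelow.transfer {f h : 𝒳 → ℝ} (hf : BddMeas f) (hf0 : PosBelow f) (hh : BddMeas h)
    (hh0 : PosBelow h) : PosBelow (transfer Q f h) := by
  obtain ⟨ε, hε, h1⟩ := hf0
  obtain ⟨ε', hε', h2⟩ := hh0
  refine ⟨ε * ε', by positivity, fun x => ?_⟩
  have : ∫ _x', ε * ε' ∂(Q x) ≤ HMMDetection.transfer Q f h x :=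
    integral_mono (integrable_const _) ((hf.mul hh).integrable _) fun x' =>
      mul_le_mul (h1 x') (h2 x') hε'.le (hε.le.trans (h1 x'))
  simpa using this

lemma Comparable.posBelow (hgm : 0 < gm) (hf : Comparable gm gp f) (t : ℤ) : PosBelow (f t) := by
  obtain ⟨c, hc, h⟩ := (hf t).2
  exact ⟨c * gm, by positivity, fun x => (h x).1⟩

lemma PosBelow.iterTransfer (hgm : 0 < gm) (hf : Comparable gm gp f) {h : 𝒳 → ℝ} (hh : BddMeas h)
    (hh0 : PosBelow h) (a : ℤ) (n : ℕ) : PosBelow (iterTransfer Q f a n h) := by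
  induction n generalizing a with
  | zero => exact hh0
  | succ n ih =>
    exact PosBelow.transfer (hf.bddMeas hgm a) (hf.posBelow hgm a)
      (hh.iterTransfer (hf.bddMeas hgm) _ _) (ih (a + 1))

instance isMarkovKernel_pow (n : ℕ) : IsMarkovKernel (Q ^ n) := by
  induction n with
  | zero => exact inferInstanceAs (IsMarkovKernel (Kernel.id : Kernel 𝒳 𝒳))
  | succ n ih => exact inferInstanceAs (IsMarkovKernel ((Q ^ n) ∘ₖ Q))

lemma integral_pow_succ {h : 𝒳 → ℝ} (hh : BddMeas h) (n : ℕ) (x : 𝒳) :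
    ∫ x', h x' ∂((Q ^ (n + 1)) x) = ∫ x', ∫ x'', h x'' ∂((Q ^ n) x') ∂(Q x) := by
  exact Kernel.integral_comp (κ := Q) (η := Q ^ n) (hh.integrable ((Q ^ (n + 1)) x))

lemma bddMeas_integral_kernel {h : 𝒳 → ℝ} (hh : BddMeas h) (κ : Kernel 𝒳 𝒳) [IsMarkovKernel κ] :
    BddMeas fun x => ∫ x', h x' ∂(κ x) := by
  have e : (fun x => ∫ x', h x' ∂(κ x)) = transfer κ (fun _ => 1) h := by
    ext x
    simp [HMMDetection.transfer]
  rw [e]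
  exact (BddMeas.const 1).transfer hh

/-- The scales of the individual weights multiply to one constant `c`, common to both bounds and
independent of `h`. It therefore disappears when the images of two functions are compared. -/
lemma iterTransfer_bounds (hgm : 0 < gm) (hgp : 0 < gp) (hf : Comparable gm gp f) (a : ℤ)
    (n : ℕ) : ∃ c > 0, ∀ h : 𝒳 → ℝ, BddMeas h → (∀ x, 0 ≤ h x) → ∀ x,
      c * gm ^ n * ∫ x', h x' ∂((Q ^ n) x) ≤ iterTransfer Q f a n h x ∧
        iterTransfer Q f a n h x ≤ c * gp ^ n * ∫ x', h x' ∂((Q ^ n) x) := by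
  induction n generalizing a with
  | zero =>
    refine ⟨1, one_pos, fun h hh _ x => ?_⟩
    have : ∫ x', h x' ∂((Q ^ 0) x) = h x := by
      change ∫ x', h x' ∂((Kernel.id : Kernel 𝒳 𝒳) x) = h x
      rw [Kernel.id_apply]
      exact integral_dirac' _ _ hh.1.stronglyMeasurable
    rw [this]
    simp [iterTransfer]
  | succ n ih =>
    obtain ⟨c, hc, hle⟩ := ih (a + 1)
    obtain ⟨c₀, hc₀, hle₀⟩ := (hf a).2
    refine ⟨c₀ * c, by positivity, fun h hh h0 x => ?_⟩
    have hI : BddMeas fun x => ∫ x', h x' ∂((Q ^ n) x) := bddMeas_integral_kernel hh _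
    have hI0 : ∀ x, 0 ≤ ∫ x', h x' ∂((Q ^ n) x) := fun x => integral_nonneg h0
    have hU := hh.iterTransfer (Q := Q) (hf.bddMeas hgm) (a + 1) n
    rw [integral_pow_succ hh, ← integral_const_mul, ← integral_const_mul]
    constructor
    · refine integral_mono ((hI.const_mul _).integrable _)
        (((hf.bddMeas hgm a).mul hU).integrable _) fun x' => ?_
      have h1 := mul_le_mul (hle₀ x').1 (hle h hh h0 x').1 (by have := hI0 x'; positivity)
        (hf.nonneg hgm a x')
      refine le_trans (le_of_eq ?_) h1
      ring
    · refine integral_mono (((hf.bddMeas hgm a).mul hU).integrable _)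
        ((hI.const_mul _).integrable _) fun x' => ?_
      have h1 := mul_le_mul (hle₀ x').2 (hle h hh h0 x').2
        (le_trans (by have := hI0 x'; positivity) (hle h hh h0 x').1) (by positivity)
      refine h1.trans (le_of_eq ?_)
      ring

variable {ref : Measure 𝒳} [IsProbabilityMeasure ref] {m : ℕ} {σm σp : ℝ}

/-- The contraction of the range of a ratio of two functions under `m` steps of the dynamics. -/
lemma exists_contract_block (hgm : 0 < gm) (hgp : 0 < gp) (hf : Comparable gm gp f)
    (hσm : 0 < σm) (hσp : 0 < σp) (hQ : Minorized Q ref m σm σp) {h k : 𝒳 → ℝ} (hh : BddMeas h)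
    (hk : BddMeas k) (hk0 : PosBelow k) {α β : ℝ} (h1 : ∀ x, α * k x ≤ h x)
    (h2 : ∀ x, h x ≤ β * k x) (a : ℤ) :
    ∃ α' β' : ℝ, α ≤ α' ∧ β' ≤ β ∧
      β' - α' = (1 - gm ^ m * σm / (gp ^ m * σp)) * (β - α) ∧
      ∀ x, α' * iterTransfer Q f a m k x ≤ iterTransfer Q f a m h x ∧
        iterTransfer Q f a m h x ≤ β' * iterTransfer Q f a m k x := by
  obtain ⟨c, hc, hU⟩ := iterTransfer_bounds (Q := Q) hgm hgp hf a m
  obtain ⟨ε, hε, hεk⟩ := hk0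
  have hk_nonneg : ∀ x, 0 ≤ k x := fun x => hε.le.trans (hεk x)
  set δ := gm ^ m * σm / (gp ^ m * σp) with hδ
  have hδ0 : 0 < δ := by positivity
  have hI : 0 < ∫ x, k x ∂ref := by
    have : ∫ _x, ε ∂ref ≤ ∫ x, k x ∂ref := integral_mono (integrable_const _) (hk.integrable _) hεk
    simp only [integral_const, probReal_univ, smul_eq_mul, one_mul] at this
    linarith
  have hfB := hf.bddMeas hgm
  -- Up to the factor `δ`, the image of a non-negative `e` dominates the image of `k` multiplied by
  -- the ratio of their `ref`-integrals: both images are comparable to these integrals, uniformly in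
  -- the initial state.
  have main : ∀ e : 𝒳 → ℝ, BddMeas e → (∀ x, 0 ≤ e x) → ∀ x,
      δ * ((∫ x, e x ∂ref) / ∫ x, k x ∂ref) * iterTransfer Q f a m k x ≤
        iterTransfer Q f a m e x := fun e he he0 x => by
    have he1 : 0 ≤ ∫ x, e x ∂ref := integral_nonneg he0
    have hkU : iterTransfer Q f a m k x ≤ c * gp ^ m * (σp * ∫ x, k x ∂ref) :=
      (hU k hk hk_nonneg x).2.trans (by
        have := (hQ k hk hk_nonneg x).2
        gcongr)
    have heU : c * gm ^ m * (σm * ∫ x, e x ∂ref) ≤ iterTransfer Q f a m e x :=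
      le_trans (by have := (hQ e he he0 x).1; gcongr) (hU e he he0 x).1
    refine le_trans ?_ heU
    calc δ * ((∫ x, e x ∂ref) / ∫ x, k x ∂ref) * iterTransfer Q f a m k x
        ≤ δ * ((∫ x, e x ∂ref) / ∫ x, k x ∂ref) * (c * gp ^ m * (σp * ∫ x, k x ∂ref)) := by
          gcongr
      _ = c * gm ^ m * (σm * ∫ x, e x ∂ref) := by
          rw [hδ]
          field_simp
  have hle : BddMeas fun x => h x - α * k x := hh.sub (hk.const_mul α)
  have hue : BddMeas fun x => -h x - (-β) * k x := by
    simpa using (hh.const_mul (-1)).sub (hk.const_mul (-β))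
  have hle0 : ∀ x, 0 ≤ h x - α * k x := fun x => sub_nonneg.2 (h1 x)
  have hue0 : ∀ x, 0 ≤ -h x - (-β) * k x := fun x => by linarith [h2 x]
  have hnh : BddMeas fun x => -h x := by simpa using hh.const_mul (-1)
  have hIl : ∫ x, (h x - α * k x) ∂ref = (∫ x, h x ∂ref) - α * ∫ x, k x ∂ref := by
    rw [integral_sub (hh.integrable _) ((hk.const_mul α).integrable _), integral_const_mul]
  have hIu : ∫ x, (-h x - (-β) * k x) ∂ref = -(∫ x, h x ∂ref) + β * ∫ x, k x ∂ref := by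
    rw [integral_sub (hnh.integrable _) ((hk.const_mul (-β)).integrable _), integral_const_mul,
      integral_neg]
    ring
  -- `main` is applied to the gaps `h - α k` and `β k - h`. Their integrals add up to `(β - α) ∫ k`,
  -- so the total gain at both ends is `δ * (β - α)`.
  refine ⟨α + δ * ((∫ x, (h x - α * k x) ∂ref) / ∫ x, k x ∂ref),
    β - δ * ((∫ x, (-h x - (-β) * k x) ∂ref) / ∫ x, k x ∂ref), ?_, ?_, ?_, fun x => ⟨?_, ?_⟩⟩
  · have : 0 ≤ ∫ x, (h x - α * k x) ∂ref := integral_nonneg hle0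
    have : 0 ≤ δ * ((∫ x, (h x - α * k x) ∂ref) / ∫ x, k x ∂ref) := by positivity
    linarith
  · have : 0 ≤ ∫ x, (-h x - (-β) * k x) ∂ref := integral_nonneg hue0
    have : 0 ≤ δ * ((∫ x, (-h x - (-β) * k x) ∂ref) / ∫ x, k x ∂ref) := by positivity
    linarith
  · rw [hIl, hIu]
    field_simp
    ring
  · have := main _ hle hle0 x
    rw [iterTransfer_sub_const_mul hfB hh hk] at this
    linarith
  · have := main _ hue hue0 x
    rw [iterTransfer_sub_const_mul hfB hnh hk] at this
    have hneg := iterTransfer_const_mul (Q := Q) hfB hh (-1) a m x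
    simp only [neg_mul, one_mul] at hneg
    rw [hneg] at this
    linarith

lemma exists_range_step (hgm : 0 < gm) (hf : Comparable gm gp f) {h k : 𝒳 → ℝ} (hh : BddMeas h)
    (hk : BddMeas k) {α β : ℝ} (h1 : ∀ x, α * k x ≤ h x) (h2 : ∀ x, h x ≤ β * k x) (a : ℤ)
    (n : ℕ) (x : 𝒳) :
    α * iterTransfer Q f a n k x ≤ iterTransfer Q f a n h x ∧
      iterTransfer Q f a n h x ≤ β * iterTransfer Q f a n k x := by
  have hfB := hf.bddMeas hgm
  rw [← iterTransfer_const_mul hfB hk, ← iterTransfer_const_mul hfB hk]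
  exact ⟨iterTransfer_mono hfB (hf.nonneg hgm) (hk.const_mul α) hh h1 a n x,
    iterTransfer_mono hfB (hf.nonneg hgm) hh (hk.const_mul β) h2 a n x⟩

/-- The range of a ratio of two functions contracts at a geometric rate. -/
lemma exists_contract (hgm : 0 < gm) (hgp : 0 < gp) (hf : Comparable gm gp f)
    (hσm : 0 < σm) (hσp : 0 < σp) (hQ : Minorized Q ref m σm σp) {h k : 𝒳 → ℝ} (hh : BddMeas h)
    (hk : BddMeas k) (hk0 : PosBelow k) {α β : ℝ} (h1 : ∀ x, α * k x ≤ h x)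
    (h2 : ∀ x, h x ≤ β * k x) (a : ℤ) (n : ℕ) :
    ∃ α' β' : ℝ, α ≤ α' ∧ β' ≤ β ∧
      β' - α' = (1 - gm ^ m * σm / (gp ^ m * σp)) ^ (n / m) * (β - α) ∧
      ∀ x, α' * iterTransfer Q f a n k x ≤ iterTransfer Q f a n h x ∧
        iterTransfer Q f a n h x ≤ β' * iterTransfer Q f a n k x := by
  have hfB := hf.bddMeas hgm
  have blocks : ∀ (j : ℕ) (h k : 𝒳 → ℝ), BddMeas h → BddMeas k → PosBelow k → ∀ α β : ℝ,
      (∀ x, α * k x ≤ h x) → (∀ x, h x ≤ β * k x) →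
      ∃ α' β' : ℝ, α ≤ α' ∧ β' ≤ β ∧
        β' - α' = (1 - gm ^ m * σm / (gp ^ m * σp)) ^ j * (β - α) ∧
        ∀ x, α' * iterTransfer Q f a (m * j) k x ≤ iterTransfer Q f a (m * j) h x ∧
          iterTransfer Q f a (m * j) h x ≤ β' * iterTransfer Q f a (m * j) k x := by
    intro j
    induction j with
    | zero =>
      intro h k _ _ _ α β h1 h2
      exact ⟨α, β, le_rfl, le_rfl, by simp, fun x => ⟨h1 x, h2 x⟩⟩
    | succ j ih =>
      intro h k hh hk hk0 α β h1 h2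
      obtain ⟨α₁, β₁, hα₁, hβ₁, hd₁, hr₁⟩ :=
        exists_contract_block hgm hgp hf hσm hσp hQ hh hk hk0 h1 h2 (a + (m * j : ℕ))
      obtain ⟨α₂, β₂, hα₂, hβ₂, hd₂, hr₂⟩ := ih _ _ (hh.iterTransfer hfB _ _)
        (hk.iterTransfer hfB _ _) (hk0.iterTransfer hgm hf hk _ _) α₁ β₁ (fun x => (hr₁ x).1)
        (fun x => (hr₁ x).2)
      refine ⟨α₂, β₂, hα₁.trans hα₂, hβ₂.trans hβ₁, ?_, fun x => ?_⟩
      · rw [hd₂, hd₁]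
        ring
      · rw [Nat.mul_succ, iterTransfer_add, iterTransfer_add]
        exact hr₂ x
  -- The remaining `n % m` steps are placed innermost; they keep the inequalities without improving
  -- them.
  have hr := exists_range_step (Q := Q) hgm hf hh hk h1 h2 (a + (m * (n / m) : ℕ)) (n % m)
  obtain ⟨α', β', hα, hβ, hd, hle⟩ := blocks (n / m) _ _ (hh.iterTransfer hfB _ _)
    (hk.iterTransfer hfB _ _) (hk0.iterTransfer hgm hf hk _ _) α β (fun x => (hr x).1)
    (fun x => (hr x).2)
  refine ⟨α', β', hα, hβ, hd, fun x => ?_⟩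
  have := hle x
  rwa [← iterTransfer_add, ← iterTransfer_add, Nat.div_add_mod] at this

end Transfer

/-! ### Exponential forgetting -/

section Forgetting

variable {𝒳 : Type*} [MeasurableSpace 𝒳]

/-- The integral of a product of transfer operators applied to `h`, for the initial law `π₀`. -/
noncomputable def pathInt (Q : Kernel 𝒳 𝒳) (π₀ : Measure 𝒳) (f : ℤ → 𝒳 → ℝ) (a : ℤ) (n : ℕ)
    (h : 𝒳 → ℝ) : ℝ :=
  ∫ x, iterTransfer Q f a n h x ∂π₀

/-- The total mass of the path measure with weights `f a, …, f (a + n - 1)`. -/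
noncomputable def pathMass (Q : Kernel 𝒳 𝒳) (π₀ : Measure 𝒳) (f : ℤ → 𝒳 → ℝ) (a : ℤ) (n : ℕ) :
    ℝ :=
  pathInt Q π₀ f a n fun _ => 1

/-- The standing bounds on the chain and on the weights. -/
structure MixingBounds (Q : Kernel 𝒳 𝒳) (ref : Measure 𝒳) (m : ℕ) (σm σp gm gp : ℝ) : Prop where
  σm_pos : 0 < σm
  σp_pos : 0 < σp
  gm_pos : 0 < gm
  gm_le : gm ≤ gp
  minorized : Minorized Q ref m σm σp

/-- The rate of forgetting per `m` steps. -/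
noncomputable def rate (m : ℕ) (σm σp gm gp : ℝ) : ℝ := 1 - gm ^ m * σm / (gp ^ m * σp)

variable {Q : Kernel 𝒳 𝒳} [IsMarkovKernel Q] {π₀ : Measure 𝒳} [IsProbabilityMeasure π₀]
  {f : ℤ → 𝒳 → ℝ} {ref : Measure 𝒳} [IsProbabilityMeasure ref] {m : ℕ} {σm σp gm gp : ℝ}

lemma MixingBounds.gp_pos (hM : MixingBounds Q ref m σm σp gm gp) : 0 < gp :=
  hM.gm_pos.trans_le hM.gm_le

lemma pathInt_add (a : ℤ) (l n : ℕ) (h : 𝒳 → ℝ) :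
    pathInt Q π₀ f a (l + n) h = pathInt Q π₀ f a l (iterTransfer Q f (a + l) n h) := by
  rw [pathInt, pathInt, iterTransfer_add]

lemma pathInt_mono (hf : ∀ t, BddMeas (f t)) (hf0 : ∀ t x, 0 ≤ f t x) {h k : 𝒳 → ℝ}
    (hh : BddMeas h) (hk : BddMeas k) (hhk : ∀ x, h x ≤ k x) (a : ℤ) (n : ℕ) :
    pathInt Q π₀ f a n h ≤ pathInt Q π₀ f a n k :=
  integral_mono ((hh.iterTransfer hf a n).integrable _) ((hk.iterTransfer hf a n).integrable _)
    fun x => iterTransfer_mono hf hf0 hh hk hhk a n x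

lemma pathInt_const_mul (hf : ∀ t, BddMeas (f t)) {k : 𝒳 → ℝ} (hk : BddMeas k) (c : ℝ)
    (a : ℤ) (n : ℕ) :
    pathInt Q π₀ f a n (fun x => c * k x) = c * pathInt Q π₀ f a n k := by
  rw [pathInt, pathInt, ← integral_const_mul]
  exact integral_congr_ae (Eventually.of_forall fun x => iterTransfer_const_mul hf hk c a n x)

lemma pathInt_sub_const_mul (hf : ∀ t, BddMeas (f t)) {h k : 𝒳 → ℝ} (hh : BddMeas h)
    (hk : BddMeas k) (c : ℝ) (a : ℤ) (n : ℕ) :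
    pathInt Q π₀ f a n (fun x => h x - c * k x) =
      pathInt Q π₀ f a n h - c * pathInt Q π₀ f a n k := by
  rw [pathInt, pathInt, pathInt, ← integral_const_mul,
    ← integral_sub ((hh.iterTransfer hf a n).integrable _)
      (((hk.iterTransfer hf a n).integrable _).const_mul c)]
  exact integral_congr_ae (Eventually.of_forall fun x =>
    iterTransfer_sub_const_mul hf hh hk c a n x)

lemma PosBelow.integral_pos {h : 𝒳 → ℝ} (hh : BddMeas h) (hh0 : PosBelow h) :
    0 < ∫ x, h x ∂π₀ := by
  obtain ⟨ε, hε, hle⟩ := hh0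
  have : ∫ _x, ε ∂π₀ ≤ ∫ x, h x ∂π₀ := integral_mono (integrable_const _) (hh.integrable _) hle
  simp only [integral_const, probReal_univ, smul_eq_mul, one_mul] at this
  linarith

lemma pathInt_pos (hgm : 0 < gm) (hf : Comparable gm gp f) {h : 𝒳 → ℝ} (hh : BddMeas h)
    (hh0 : PosBelow h) (a : ℤ) (n : ℕ) : 0 < pathInt Q π₀ f a n h :=
  (hh0.iterTransfer hgm hf hh a n).integral_pos (hh.iterTransfer (hf.bddMeas hgm) a n)

lemma posBelow_one : PosBelow fun _ : 𝒳 => (1 : ℝ) := ⟨1, one_pos, fun _ => le_rfl⟩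

lemma pathInt_ratio_mem (hgm : 0 < gm) (hf : Comparable gm gp f) {h k : 𝒳 → ℝ} (hh : BddMeas h)
    (hk : BddMeas k) (hk0 : PosBelow k) {α β : ℝ} (h1 : ∀ x, α * k x ≤ h x)
    (h2 : ∀ x, h x ≤ β * k x) (a : ℤ) (n : ℕ) :
    pathInt Q π₀ f a n h / pathInt Q π₀ f a n k ∈ Set.Icc α β := by
  have hpos : 0 < pathInt Q π₀ f a n k := pathInt_pos hgm hf hk hk0 a n
  have hfB := hf.bddMeas hgm
  rw [Set.mem_Icc, le_div_iff₀ hpos, div_le_iff₀ hpos, ← pathInt_const_mul hfB hk,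
    ← pathInt_const_mul hfB hk]
  exact ⟨pathInt_mono hfB (hf.nonneg hgm) (hk.const_mul α) hh h1 a n,
    pathInt_mono hfB (hf.nonneg hgm) hh (hk.const_mul β) h2 a n⟩

lemma abs_sub_le_of_mem_Icc {α β r s : ℝ} (hr : r ∈ Set.Icc α β) (hs : s ∈ Set.Icc α β) :
    |r - s| ≤ β - α := by
  rw [abs_le]
  constructor <;> linarith [hr.1, hr.2, hs.1, hs.2]

/-- From `log t ≤ t - 1` applied to `t = r / s`, together with `s ≥ α`. -/
lemma abs_log_sub_log_le {α β r s : ℝ} (hα : 0 < α) (hr : r ∈ Set.Icc α β)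
    (hs : s ∈ Set.Icc α β) : |Real.log r - Real.log s| ≤ (β - α) / α := by
  have key : ∀ {r s : ℝ}, r ∈ Set.Icc α β → s ∈ Set.Icc α β →
      Real.log r - Real.log s ≤ (β - α) / α := fun {r s} hr hs => by
    have hs0 : 0 < s := hα.trans_le hs.1
    have hr0 : 0 < r := hα.trans_le hr.1
    rw [← Real.log_div hr0.ne' hs0.ne']
    refine (Real.log_le_sub_one_of_pos (by positivity)).trans ?_
    rw [div_sub_one hs0.ne', div_le_div_iff₀ hs0 hα]
    nlinarith [hr.1, hr.2, hs.1, hs.2, mul_nonneg (sub_nonneg.2 (hr.1.trans hr.2))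
      (sub_nonneg.2 hs.1), mul_nonneg (sub_nonneg.2 hr.2) hα.le]
  rw [abs_le]
  constructor
  · linarith [key hs hr]
  · exact key hr hs

lemma transfer_one_bounds {f : 𝒳 → ℝ} (hf : BddMeas f) {α β : ℝ} (h : ∀ x, α ≤ f x ∧ f x ≤ β)
    (x : 𝒳) : α ≤ transfer Q f (fun _ => 1) x ∧ transfer Q f (fun _ => 1) x ≤ β := by
  have e : transfer Q f (fun _ => 1) x = ∫ x', f x' ∂(Q x) := by simp [transfer]
  rw [e]
  have h1 : ∫ _x', α ∂(Q x) ≤ ∫ x', f x' ∂(Q x) :=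
    integral_mono (integrable_const _) (hf.integrable _) fun x' => (h x').1
  have h2 : ∫ x', f x' ∂(Q x) ≤ ∫ _x', β ∂(Q x) :=
    integral_mono (hf.integrable _) (integrable_const _) fun x' => (h x').2
  simp only [integral_const, probReal_univ, smul_eq_mul, one_mul] at h1 h2
  exact ⟨h1, h2⟩

lemma pathMass_succ (a : ℤ) (n : ℕ) :
    pathMass Q π₀ f a (n + 1) = pathInt Q π₀ f a n (transfer Q (f (a + n)) fun _ => 1) :=
  pathInt_add a n 1 _

lemma pathMass_ratio_mem (hgm : 0 < gm) (hf : Comparable gm gp f) {α β : ℝ} (a : ℤ) (n : ℕ)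
    (h : ∀ x, α ≤ f (a + n) x ∧ f (a + n) x ≤ β) :
    pathMass Q π₀ f a (n + 1) / pathMass Q π₀ f a n ∈ Set.Icc α β := by
  have hfB := hf.bddMeas hgm
  rw [pathMass_succ]
  exact pathInt_ratio_mem hgm hf ((hfB _).transfer (BddMeas.const 1)) (BddMeas.const 1)
    posBelow_one (fun x => by simpa using (transfer_one_bounds (Q := Q) (hfB _) h x).1)
    (fun x => by simpa using (transfer_one_bounds (Q := Q) (hfB _) h x).2) a n

/-- Forgetting of the remote past by the logarithm of the conditional density. -/
lemma abs_log_ratio_sub_le (hM : MixingBounds Q ref m σm σp gm gp) (hf : Comparable gm gp f)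
    (a : ℤ) (l n : ℕ) :
    |Real.log (pathMass Q π₀ f (a + l) (n + 1) / pathMass Q π₀ f (a + l) n) -
        Real.log (pathMass Q π₀ f a (l + n + 1) / pathMass Q π₀ f a (l + n))| ≤
      (gp - gm) / gm * rate m σm σp gm gp ^ (n / m) := by
  have hgm := hM.gm_pos
  have hfB := hf.bddMeas hgm
  obtain ⟨c, hc, hle⟩ := (hf (a + l + n)).2
  have hT : BddMeas (transfer Q (f (a + l + n)) fun _ => 1) := (hfB _).transfer (BddMeas.const 1)
  have hTle := transfer_one_bounds (Q := Q) (hfB (a + l + n)) hle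
  -- The conditional density at the last time is a ratio of functionals of `T 1` and `1`. After `n`
  -- common steps the ratio of these functions has range in `[α, β]`, and the two pasts only amount
  -- to different positive functionals.
  obtain ⟨α, β, hα, hβ, hd, hr⟩ := exists_contract (Q := Q) hgm hM.gp_pos hf hM.σm_pos hM.σp_pos
    hM.minorized hT (BddMeas.const 1) posBelow_one (fun x => by simpa using (hTle x).1)
    (fun x => by simpa using (hTle x).2) (a + l) n
  have hone : PosBelow (iterTransfer Q f (a + l) n fun _ => 1) :=
    posBelow_one.iterTransfer hgm hf (BddMeas.const 1) _ _
  have hα0 : 0 < α := (mul_pos hc hgm).trans_le hα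
  have m1 : pathMass Q π₀ f (a + l) (n + 1) / pathMass Q π₀ f (a + l) n ∈ Set.Icc α β := by
    rw [pathMass_succ]
    exact pathInt_ratio_mem (Q := Q) (π₀ := π₀) (a := a) (n := 0) hgm hf (hT.iterTransfer hfB _ _)
      ((BddMeas.const 1).iterTransfer hfB _ _) hone (fun x => (hr x).1) (fun x => (hr x).2)
  have m2 : pathMass Q π₀ f a (l + n + 1) / pathMass Q π₀ f a (l + n) ∈ Set.Icc α β := by
    have := pathInt_ratio_mem (Q := Q) (π₀ := π₀) hgm hf (hT.iterTransfer hfB (a + l) n)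
      ((BddMeas.const 1).iterTransfer hfB (a + l) n) hone (fun x => (hr x).1)
      (fun x => (hr x).2) a l
    rw [← pathInt_add, ← pathInt_add] at this
    rw [pathMass_succ]
    push_cast
    rw [← add_assoc]
    exact this
  refine (abs_log_sub_log_le hα0 m1 m2).trans ?_
  have hcg : 0 < c * gm := mul_pos hc hgm
  have h0 : 0 ≤ β - α := by linarith [m1.1.trans m1.2]
  -- Initially the interval is `[c * gm, c * gp]`, so the scale `c` of the last weight cancels in
  -- the relative length.
  calc (β - α) / α ≤ (β - α) / (c * gm) := div_le_div_of_nonneg_left h0 hcg hα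
    _ = (gp - gm) / gm * rate m σm σp gm gp ^ (n / m) := by
        rw [hd, rate]
        field_simp

/-- The functional `h ↦ ∫ U (f' · h)` obtained by changing the weight at one time is dominated
by the original one. -/
lemma iterTransfer_modif {f' : ℤ → 𝒳 → ℝ} {s : ℤ} (hff' : ∀ t, t ≠ s → f' t = f t) (l j : ℕ)
    (h : 𝒳 → ℝ) :
    iterTransfer Q f' (s - l) (l + (1 + j)) h =
      iterTransfer Q f (s - l) l (transfer Q (f' s) (iterTransfer Q f (s + 1) j h)) := by
  rw [iterTransfer_add, iterTransfer_add, iterTransfer_one, sub_add_cancel, Nat.cast_one,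
    iterTransfer_congr (f' := f) (a := s + 1) fun t h1 _ => hff' t (by omega)]
  exact iterTransfer_congr (fun t _ h2 => hff' t (by omega)) _

lemma transfer_modif_bounds {f f' h : 𝒳 → ℝ} (hf : BddMeas f) (hf' : BddMeas f') {K : ℝ}
    (hK : ∀ x, |f' x| ≤ K * f x) (hh : BddMeas h) (hh0 : ∀ x, 0 ≤ h x) (x : 𝒳) :
    -K * transfer Q f h x ≤ transfer Q f' h x ∧
      transfer Q f' h x ≤ K * transfer Q f h x := by
  rw [transfer, transfer, ← integral_const_mul, ← integral_const_mul]
  have h1 : ∀ c : ℝ, Integrable (fun x' => c * (f x' * h x')) (Q x) := fun c =>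
    ((hf.mul hh).integrable _).const_mul c
  refine ⟨integral_mono (h1 _) ((hf'.mul hh).integrable _) fun x' => ?_,
    integral_mono ((hf'.mul hh).integrable _) (h1 _) fun x' => ?_⟩
  · have := mul_le_mul_of_nonneg_right (abs_le.1 (hK x')).1 (hh0 x')
    refine le_trans (le_of_eq ?_) this
    ring
  · have := mul_le_mul_of_nonneg_right (abs_le.1 (hK x')).2 (hh0 x')
    refine this.trans (le_of_eq ?_)
    ring

/-- Forgetting of the remote past by the conditional expectation of a function of the state at
time `s`. -/
lemma abs_modif_ratio_sub_past_le (hM : MixingBounds Q ref m σm σp gm gp)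
    (hf : Comparable gm gp f) {f' : ℤ → 𝒳 → ℝ} {s : ℤ} (hff' : ∀ t, t ≠ s → f' t = f t)
    (hf's : BddMeas (f' s)) {K : ℝ} (hK : ∀ x, |f' s x| ≤ K * f s x) (l n j : ℕ) :
    |pathMass Q π₀ f' (s - n) (n + (1 + j)) / pathMass Q π₀ f (s - n) (n + (1 + j)) -
        pathMass Q π₀ f' (s - (l + n : ℕ)) (l + n + (1 + j)) /
          pathMass Q π₀ f (s - (l + n : ℕ)) (l + n + (1 + j))| ≤
      2 * K * rate m σm σp gm gp ^ (n / m) := by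
  have hgm := hM.gm_pos
  have hfB := hf.bddMeas hgm
  set v := iterTransfer Q f (s + 1) j fun _ => 1 with hv
  have hvB : BddMeas v := (BddMeas.const 1).iterTransfer hfB _ _
  have hvP : PosBelow v := posBelow_one.iterTransfer hgm hf (BddMeas.const 1) _ _
  have hv0 : ∀ x, 0 ≤ v x := by
    obtain ⟨ε, hε, hle⟩ := hvP
    exact fun x => hε.le.trans (hle x)
  have hh : BddMeas (transfer Q (f' s) v) := hf's.transfer hvB
  have hk : BddMeas (transfer Q (f s) v) := (hfB s).transfer hvB
  have hkP : PosBelow (transfer Q (f s) v) := PosBelow.transfer (hfB s) (hf.posBelow hgm s) hvB hvP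
  have hb := transfer_modif_bounds (Q := Q) (hfB s) hf's hK hvB hv0
  obtain ⟨α, β, -, -, hd, hr⟩ := exists_contract (Q := Q) hgm hM.gp_pos hf hM.σm_pos hM.σp_pos
    hM.minorized hh hk hkP (fun x => (hb x).1) (fun x => (hb x).2) (s - n) n
  have hone := PosBelow.iterTransfer (Q := Q) (f := f) hgm hf hk hkP (s - n) n
  -- The interval does not depend on the length `l` of the additional past; `l = 0` gives the
  -- shorter past.
  have mem : ∀ l : ℕ, pathMass Q π₀ f' (s - (l + n : ℕ)) (l + n + (1 + j)) /
      pathMass Q π₀ f (s - (l + n : ℕ)) (l + n + (1 + j)) ∈ Set.Icc α β := fun l => by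
    have := pathInt_ratio_mem (Q := Q) (π₀ := π₀) hgm hf (hh.iterTransfer hfB (s - n) n)
      (hk.iterTransfer hfB (s - n) n) hone (fun x => (hr x).1) (fun x => (hr x).2)
      (s - (l + n : ℕ)) l
    rw [pathMass, pathMass, pathInt, pathInt, iterTransfer_modif hff',
      iterTransfer_modif (f' := f) fun _ _ => rfl, iterTransfer_add, iterTransfer_add,
      show s - ((l + n : ℕ) : ℤ) + l = s - n by push_cast; ring]
    exact this
  have m0 := mem 0
  simp only [Nat.zero_add] at m0
  refine (abs_sub_le_of_mem_Icc m0 (mem l)).trans (le_of_eq ?_)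
  rw [hd, rate]
  ring

/-- Forgetting of the remote future by the conditional expectation of a function of the state at
time `s`. -/
lemma abs_modif_ratio_sub_future_le (hM : MixingBounds Q ref m σm σp gm gp)
    (hf : Comparable gm gp f) {f' : ℤ → 𝒳 → ℝ} {s : ℤ} (hff' : ∀ t, t ≠ s → f' t = f t)
    (hf's : BddMeas (f' s)) {K : ℝ} (hK : ∀ x, |f' s x| ≤ K * f s x) (n j : ℕ) :
    |pathMass Q π₀ f' (s - n) (n + (1 + (j + 1))) / pathMass Q π₀ f (s - n) (n + (1 + (j + 1))) -
        pathMass Q π₀ f' (s - n) (n + (1 + j)) / pathMass Q π₀ f (s - n) (n + (1 + j))| ≤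
      2 * K * ((gp - gm) / gm) * rate m σm σp gm gp ^ (j / m) := by
  have hgm := hM.gm_pos
  have hfB := hf.bddMeas hgm
  have hf'B : ∀ t, BddMeas (f' t) := fun t => by
    rcases eq_or_ne t s with rfl | ht
    · exact hf's
    · rw [hff' t ht]
      exact hfB t
  obtain ⟨c, hc, hle⟩ := (hf (s + 1 + j)).2
  have hT : BddMeas (transfer Q (f (s + 1 + j)) fun _ => 1) := (hfB _).transfer (BddMeas.const 1)
  have hTle := transfer_one_bounds (Q := Q) (hfB (s + 1 + j)) hle
  obtain ⟨α, β, hα, hβ, hd, hr⟩ := exists_contract (Q := Q) hgm hM.gp_pos hf hM.σm_pos hM.σp_pos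
    hM.minorized hT (BddMeas.const 1) posBelow_one (fun x => by simpa using (hTle x).1)
    (fun x => by simpa using (hTle x).2) (s + 1) j
  set w := iterTransfer Q f (s + 1) j (transfer Q (f (s + 1 + j)) fun _ => 1) with hw
  set v := iterTransfer Q f (s + 1) j fun _ => 1 with hv
  have hwB : BddMeas w := hT.iterTransfer hfB _ _
  have hvB : BddMeas v := (BddMeas.const 1).iterTransfer hfB _ _
  have hvP : PosBelow v := posBelow_one.iterTransfer hgm hf (BddMeas.const 1) _ _
  have hv0 : ∀ x, 0 ≤ v x := by
    obtain ⟨ε, hε, hle⟩ := hvP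
    exact fun x => hε.le.trans (hle x)
  have hα0 : 0 < α := (mul_pos hc hgm).trans_le hα
  -- `A` and `B` collect the times up to `s`, with and without the modified weight. The further
  -- observation only changes the function representing the future from `v` to `w`, and after `j`
  -- steps these are nearly proportional.
  let A : (𝒳 → ℝ) → ℝ := fun h => pathInt Q π₀ f' (s - n) (n + 1) h
  let B : (𝒳 → ℝ) → ℝ := fun h => pathInt Q π₀ f (s - n) (n + 1) h
  have hs : s - (n : ℤ) + ((n + 1 : ℕ) : ℤ) = s + 1 := by push_cast; ring
  have eA : ∀ h, pathInt Q π₀ f' (s - n) (n + (1 + j)) h = A (iterTransfer Q f (s + 1) j h) :=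
    fun h => by
      rw [← add_assoc, pathInt_add, hs,
        iterTransfer_congr (f' := f) (a := s + 1) fun t h1 _ => hff' t (by omega)]
  have eB : ∀ h, pathInt Q π₀ f (s - n) (n + (1 + j)) h = B (iterTransfer Q f (s + 1) j h) :=
    fun h => by
      rw [← add_assoc, pathInt_add, hs]
  have hend : s - (n : ℤ) + ((n + (1 + j) : ℕ) : ℤ) = s + 1 + j := by push_cast; ring
  have eA1 : pathMass Q π₀ f' (s - n) (n + (1 + (j + 1))) = A w := by
    rw [show n + (1 + (j + 1)) = n + (1 + j) + 1 by ring, pathMass_succ, hend,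
      hff' (s + 1 + j) (by omega), eA]
  have eB1 : pathMass Q π₀ f (s - n) (n + (1 + (j + 1))) = B w := by
    rw [show n + (1 + (j + 1)) = n + (1 + j) + 1 by ring, pathMass_succ, hend, eB]
  have eA0 : pathMass Q π₀ f' (s - n) (n + (1 + j)) = A v := eA _
  have eB0 : pathMass Q π₀ f (s - n) (n + (1 + j)) = B v := eB _
  have hAB : ∀ h, BddMeas h → (∀ x, 0 ≤ h x) → |A h| ≤ K * B h := fun h hh hh0 => by
    have hb := transfer_modif_bounds (Q := Q) (hfB s) hf's hK hh hh0
    have hfh : BddMeas (transfer Q (f s) h) := (hfB s).transfer hh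
    have hf'h : BddMeas (transfer Q (f' s) h) := hf's.transfer hh
    have e1 : A h = pathInt Q π₀ f (s - n) n (transfer Q (f' s) h) := by
      simp only [A, pathInt]
      rw [show n + 1 = n + (1 + 0) from rfl, iterTransfer_modif hff']
      rfl
    have e2 : B h = pathInt Q π₀ f (s - n) n (transfer Q (f s) h) := by
      simp only [B, pathInt]
      rw [show n + 1 = n + (1 + 0) from rfl, iterTransfer_modif (f' := f) fun _ _ => rfl]
      rfl
    rw [e1, e2, abs_le, ← neg_mul, ← pathInt_const_mul hfB hfh, ← pathInt_const_mul hfB hfh]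
    exact ⟨pathInt_mono hfB (hf.nonneg hgm) (hfh.const_mul _) hf'h (fun x => (hb x).1) _ _,
      pathInt_mono hfB (hf.nonneg hgm) hf'h (hfh.const_mul _) (fun x => (hb x).2) _ _⟩
  have hBv : 0 < B v := pathInt_pos hgm hf hvB hvP _ _
  -- In `A w / B w - A v / B v` the part of `w` proportional to `v` cancels, leaving the
  -- non-negative remainder `e ≤ (β - α) v`.
  set e : 𝒳 → ℝ := fun x => w x - α * v x with he
  have heB : BddMeas e := hwB.sub (hvB.const_mul α)
  have he0 : ∀ x, 0 ≤ e x := fun x => sub_nonneg.2 (hr x).1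
  have hAe : A e = A w - α * A v := pathInt_sub_const_mul hf'B hwB hvB α _ _
  have hBe : B e = B w - α * B v := pathInt_sub_const_mul hfB hwB hvB α _ _
  have hBele : B e ≤ (β - α) * B v := by
    rw [show (β - α) * B v = B fun x => (β - α) * v x from
      (pathInt_const_mul hfB hvB _ _ _).symm]
    refine pathInt_mono hfB (hf.nonneg hgm) heB (hvB.const_mul _) (fun x => ?_) _ _
    simp only [he]
    linarith [(hr x).2]
  have hBe0 : 0 ≤ B e := by
    have := (abs_nonneg _).trans (hAB e heB he0)
    have h0 : B (fun x => (0 : ℝ) * v x) ≤ B e :=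
      pathInt_mono hfB (hf.nonneg hgm) (hvB.const_mul 0) heB (fun x => by simpa using he0 x) _ _
    have h1 : B (fun x => (0 : ℝ) * v x) = 0 * B v := pathInt_const_mul hfB hvB 0 _ _
    linarith
  have hBw : α * B v ≤ B w := by linarith
  have hK0 : 0 ≤ K := nonneg_of_mul_nonneg_left ((abs_nonneg _).trans (hAB v hvB hv0)) hBv
  have hBw0 : 0 < B w := (mul_pos hα0 hBv).trans_le hBw
  have hβα : 0 ≤ β - α := nonneg_of_mul_nonneg_left (hBe0.trans hBele) hBv
  rw [eA1, eB1, eA0, eB0, div_sub_div _ _ hBw0.ne' hBv.ne',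
    show A w * B v - B w * A v = A e * B v - B e * A v by rw [hAe, hBe]; ring, abs_div,
    abs_of_pos (mul_pos hBw0 hBv)]
  have hnum : |A e * B v - B e * A v| ≤ 2 * K * (β - α) * (B v * B v) := by
    refine (abs_sub _ _).trans ?_
    rw [abs_mul, abs_mul, abs_of_pos hBv, abs_of_nonneg hBe0]
    have t1 : |A e| * B v ≤ K * ((β - α) * B v) * B v := by
      refine mul_le_mul_of_nonneg_right ((hAB e heB he0).trans ?_) hBv.le
      gcongr
    have t2 : B e * |A v| ≤ (β - α) * B v * (K * B v) :=
      mul_le_mul hBele (hAB v hvB hv0) (abs_nonneg _) (by positivity)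
    linarith
  have hcg : 0 < c * gm := mul_pos hc hgm
  calc |A e * B v - B e * A v| / (B w * B v)
      ≤ 2 * K * (β - α) * (B v * B v) / (α * B v * B v) := by gcongr
    _ = 2 * K * (β - α) / α := by field_simp
    _ ≤ 2 * K * (β - α) / (c * gm) := by gcongr
    _ = _ := by
        rw [hd, rate]
        field_simp

/-- The conditional expectation of a function dominated by `f s` is bounded. -/
lemma abs_modif_ratio_le (hgm : 0 < gm) (hf : Comparable gm gp f) {f' : ℤ → 𝒳 → ℝ} {s : ℤ}
    (hff' : ∀ t, t ≠ s → f' t = f t) (hf's : BddMeas (f' s)) {K : ℝ}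
    (hK : ∀ x, |f' s x| ≤ K * f s x) (n j : ℕ) :
    |pathMass Q π₀ f' (s - n) (n + (1 + j)) / pathMass Q π₀ f (s - n) (n + (1 + j))| ≤ K := by
  have hfB := hf.bddMeas hgm
  set v := iterTransfer Q f (s + 1) j fun _ => 1 with hv
  have hvB : BddMeas v := (BddMeas.const 1).iterTransfer hfB _ _
  have hvP : PosBelow v := posBelow_one.iterTransfer hgm hf (BddMeas.const 1) _ _
  have hv0 : ∀ x, 0 ≤ v x := by
    obtain ⟨ε, hε, hle⟩ := hvP
    exact fun x => hε.le.trans (hle x)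
  have hb := transfer_modif_bounds (Q := Q) (hfB s) hf's hK hvB hv0
  have := pathInt_ratio_mem (Q := Q) (π₀ := π₀) hgm hf (hf's.transfer hvB) ((hfB s).transfer hvB)
    (PosBelow.transfer (Q := Q) (hfB s) (hf.posBelow hgm s) hvB hvP) (fun x => (hb x).1)
    (fun x => (hb x).2) (s - n) n
  rw [pathMass, pathMass, pathInt, pathInt, iterTransfer_modif hff',
    iterTransfer_modif (f' := f) fun _ _ => rfl, abs_le]
  exact this

end Forgetting

/-! ### The Markov property of hidden Markov models -/

section Markov

variable {Ω 𝒳 : Type*} [mΩ : MeasurableSpace Ω] [MeasurableSpace 𝒳] {d : ℕ}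

/-- The σ-algebra of the past up to time `k`. -/
@[reducible]
def past (X : ℤ → Ω → 𝒳) (Y : ℤ → Ω → Obs d) (k : ℤ) : MeasurableSpace Ω :=
  ⨆ (j : ℤ) (_ : j ≤ k), (MeasurableSpace.comap (X j) inferInstance ⊔
    MeasurableSpace.comap (Y j) inferInstance)

/-- The joint transition kernel from a state to the next state and observation. -/
noncomputable def joint (Q : Kernel 𝒳 𝒳) (G : Kernel 𝒳 (Obs d)) : Kernel 𝒳 (𝒳 × Obs d) :=
  Q ⊗ₖ Kernel.prodMkLeft 𝒳 G

variable {P : Measure Ω} [IsProbabilityMeasure P] {Q : Kernel 𝒳 𝒳} [IsMarkovKernel Q]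
  {G : Kernel 𝒳 (Obs d)} [IsMarkovKernel G] {X : ℤ → Ω → 𝒳} {Y : ℤ → Ω → Obs d}

instance : IsMarkovKernel (joint Q G) := by
  unfold joint
  infer_instance

lemma past_le (h : IsStationaryHMM P Q G X Y) (k : ℤ) : past X Y k ≤ mΩ :=
  iSup₂_le fun j _ => sup_le (h.measurable_state j).comap_le (h.measurable_obs j).comap_le

lemma past_mono (X : ℤ → Ω → 𝒳) (Y : ℤ → Ω → Obs d) : Monotone (past X Y) := fun _ _ hkl =>
  iSup₂_le fun j hj => le_iSup₂ (f := fun (j : ℤ) (_ : j ≤ _) =>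
    MeasurableSpace.comap (X j) inferInstance ⊔ MeasurableSpace.comap (Y j) inferInstance)
    j (hj.trans hkl)

lemma comap_le_past (X : ℤ → Ω → 𝒳) (Y : ℤ → Ω → Obs d) (k : ℤ) :
    MeasurableSpace.comap (X k) inferInstance ⊔ MeasurableSpace.comap (Y k) inferInstance ≤
      past X Y k :=
  le_iSup₂ (f := fun (j : ℤ) (_ : j ≤ k) =>
    MeasurableSpace.comap (X j) inferInstance ⊔ MeasurableSpace.comap (Y j) inferInstance)
    k le_rfl

lemma measurable_state_past (X : ℤ → Ω → 𝒳) (Y : ℤ → Ω → Obs d) (k : ℤ) :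
    Measurable[past X Y k] (X k) :=
  measurable_iff_comap_le.2 (le_sup_left.trans (comap_le_past X Y k))

lemma measurable_obs_past (X : ℤ → Ω → 𝒳) (Y : ℤ → Ω → Obs d) (k : ℤ) :
    Measurable[past X Y k] (Y k) :=
  measurable_iff_comap_le.2 (le_sup_right.trans (comap_le_past X Y k))

/-- The Markov hypothesis concerns rectangles only. Integrated over an event `S` of the past, it
identifies two finite measures on rectangles, hence on the whole product space; this gives access to
arbitrary bounded functions of the next pair. -/
lemma map_restrict_eq (h : IsStationaryHMM P Q G X Y) (k : ℤ) {S : Set Ω}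
    (hS : MeasurableSet[past X Y k] S) :
    (P.restrict S).map (fun ω => (X (k + 1) ω, Y (k + 1) ω)) =
      joint Q G ∘ₘ ((P.restrict S).map (X k)) := by
  have hSm := past_le h k S hS
  have hXY : Measurable fun ω => (X (k + 1) ω, Y (k + 1) ω) :=
    (h.measurable_state _).prodMk (h.measurable_obs _)
  have : IsFiniteMeasure ((P.restrict S).map fun ω => (X (k + 1) ω, Y (k + 1) ω)) :=
    inferInstance
  refine Measure.ext_prod fun {A B} hA hB => ?_
  rw [Measure.map_apply hXY (hA.prod hB), Measure.bind_apply (hA.prod hB) (by fun_prop),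
    lintegral_map ((joint Q G).measurable_coe (hA.prod hB)) (h.measurable_state k)]
  set E := X (k + 1) ⁻¹' A ∩ Y (k + 1) ⁻¹' B with hE
  have hEm : MeasurableSet E := (h.measurable_state _ hA).inter (h.measurable_obs _ hB)
  have hpre : (fun ω => (X (k + 1) ω, Y (k + 1) ω)) ⁻¹' (A ×ˢ B) = E := rfl
  have hj : ∀ ω, joint Q G (X k ω) (A ×ˢ B) = ∫⁻ x' in A, G x' B ∂(Q (X k ω)) := fun ω => by
    rw [joint, Kernel.compProd_apply_prod hA hB]
    rfl
  have h1 : ∫ ω in S, (P⟦E | past X Y k⟧) ω ∂P = P.real (E ∩ S) := by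
    rw [setIntegral_condExp (past_le h k) ((integrable_const (1 : ℝ)).indicator hEm) hS,
      integral_indicator hEm, setIntegral_const, smul_eq_mul, mul_one, measureReal_def,
      Measure.restrict_apply hEm, measureReal_def]
  have h2 : ∫ ω in S, (P⟦E | past X Y k⟧) ω ∂P =
      (∫⁻ ω in S, joint Q G (X k ω) (A ×ˢ B) ∂P).toReal := by
    rw [← integral_toReal]
    · refine setIntegral_congr_ae hSm ?_
      filter_upwards [h.markov k A B hA hB] with ω hω _
      rw [hj]
      exact hω
    · exact (((joint Q G).measurable_coe (hA.prod hB)).comp (h.measurable_state k)).aemeasurable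
    · exact Eventually.of_forall fun ω => measure_lt_top _ _
  rw [hpre, Measure.restrict_apply hEm]
  refine (ENNReal.toReal_eq_toReal_iff' (measure_ne_top _ _) ?_).1 ?_
  · refine (lt_of_le_of_lt (lintegral_mono fun ω => prob_le_one) ?_).ne
    simp
  · rw [← h2, h1, measureReal_def]

lemma integral_bind_kernel {α β : Type*} [MeasurableSpace α] [MeasurableSpace β] {μ : Measure α}
    [IsFiniteMeasure μ] {κ : Kernel α β} [IsMarkovKernel κ] {F : β → ℝ} (hF : BddMeas F) :
    ∫ z, F z ∂(κ ∘ₘ μ) = ∫ x, ∫ z, F z ∂(κ x) ∂μ := by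
  rw [← Measure.snd_compProd, Measure.snd, integral_map measurable_snd.aemeasurable
    hF.1.aestronglyMeasurable]
  have hF2 : BddMeas fun p : α × β => F p.2 :=
    ⟨hF.1.comp measurable_snd, hF.2.choose, fun p => hF.2.choose_spec p.2⟩
  rw [Measure.integral_compProd (hF2.integrable _)]

lemma BddMeas.integral_kernel {α β : Type*} [MeasurableSpace α] [MeasurableSpace β]
    {F : β → ℝ} (hF : BddMeas F) (κ : Kernel α β) [IsMarkovKernel κ] :
    BddMeas fun x => ∫ z, F z ∂(κ x) := by
  obtain ⟨C, hC⟩ := hF.2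
  refine ⟨(hF.1.stronglyMeasurable.integral_kernel (κ := κ)).measurable, C, fun x => ?_⟩
  have := norm_integral_le_of_norm_le_const (μ := κ x) (f := F) (C := C) (Eventually.of_forall hC)
  simpa using this

lemma BddMeas.comp {α β : Type*} [MeasurableSpace α] [MeasurableSpace β] {F : β → ℝ}
    (hF : BddMeas F) {φ : α → β} (hφ : Measurable φ) : BddMeas fun x => F (φ x) :=
  ⟨hF.1.comp hφ, hF.2.choose, fun x => hF.2.choose_spec (φ x)⟩

/-- The one-step Markov property. -/
lemma condExp_next (h : IsStationaryHMM P Q G X Y) (k : ℤ) {F : 𝒳 × Obs d → ℝ}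
    (hF : BddMeas F) :
    P[fun ω => F (X (k + 1) ω, Y (k + 1) ω) | past X Y k] =ᵐ[P]
      fun ω => ∫ z, F z ∂(joint Q G (X k ω)) := by
  have hXY : Measurable fun ω => (X (k + 1) ω, Y (k + 1) ω) :=
    (h.measurable_state _).prodMk (h.measurable_obs _)
  have hκ := hF.integral_kernel (joint Q G)
  refine (ae_eq_condExp_of_forall_setIntegral_eq (past_le h k) ((hF.comp hXY).integrable P)
    (fun S hS _ => ((hκ.comp (h.measurable_state k)).integrable P).integrableOn)
    (fun S hS _ => ?_) ?_).symm
  · have e1 := integral_map (μ := P.restrict S) hXY.aemeasurable hF.1.aestronglyMeasurable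
    have e2 := integral_map (μ := P.restrict S) (h.measurable_state k).aemeasurable
      hκ.1.aestronglyMeasurable
    rw [← e1, ← e2, map_restrict_eq h k hS, integral_bind_kernel hF]
  · exact (hκ.1.comp (measurable_state_past X Y k)).aestronglyMeasurable

lemma integral_mul_next (h : IsStationaryHMM P Q G X Y) (k : ℤ) {F : 𝒳 × Obs d → ℝ}
    (hF : BddMeas F) {Z : Ω → ℝ} (hZ : Measurable[past X Y k] Z) {C : ℝ} (hC : ∀ ω, |Z ω| ≤ C) :
    ∫ ω, Z ω * F (X (k + 1) ω, Y (k + 1) ω) ∂P =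
      ∫ ω, Z ω * ∫ z, F z ∂(joint Q G (X k ω)) ∂P := by
  have hXY : Measurable fun ω => (X (k + 1) ω, Y (k + 1) ω) :=
    (h.measurable_state _).prodMk (h.measurable_obs _)
  have hZB : BddMeas Z := ⟨hZ.mono (past_le h k) le_rfl, C, hC⟩
  have hFB := hF.comp hXY
  have h1 := condExp_mul_of_stronglyMeasurable_left (μ := P) (m := past X Y k)
    (g := fun ω => F (X (k + 1) ω, Y (k + 1) ω)) hZ.stronglyMeasurable
    ((hZB.mul hFB).integrable P) (hFB.integrable P)
  have h2 := integral_condExp (μ := P) (past_le h k)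
    (f := Z * fun ω => F (X (k + 1) ω, Y (k + 1) ω))
  rw [integral_congr_ae h1] at h2
  refine h2.symm.trans (integral_congr_ae ?_)
  filter_upwards [condExp_next h k hF] with ω hω
  simp [hω]

/-- The weight of a state obtained by averaging over the observation. -/
noncomputable def avgObs (G : Kernel 𝒳 (Obs d)) (F : ℤ → 𝒳 × Obs d → ℝ) (t : ℤ) (x : 𝒳) : ℝ :=
  ∫ y, F t (x, y) ∂(G x)

lemma integral_joint_mul {F : 𝒳 × Obs d → ℝ} (hF : BddMeas F) {h : 𝒳 → ℝ} (hh : BddMeas h)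
    (x : 𝒳) :
    ∫ z, F z * h z.1 ∂(joint Q G x) = transfer Q (fun x' => ∫ y, F (x', y) ∂(G x')) h x := by
  rw [joint, ProbabilityTheory.integral_compProd
    ((hF.mul (hh.comp measurable_fst)).integrable _), transfer]
  refine integral_congr_ae (Eventually.of_forall fun x' => ?_)
  exact integral_mul_const (h x') fun y => F (x', y)

/-- The first factor is absorbed into `Z`, which becomes measurable for the past at time `k + 1`.
The induction hypothesis handles the later factors, and the one-step Markov property then integrates
out the first one. -/
lemma integral_mul_prod_next (h : IsStationaryHMM P Q G X Y) {F : ℤ → 𝒳 × Obs d → ℝ}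
    (hF : ∀ t, BddMeas (F t)) (hA : ∀ t, BddMeas (avgObs G F t)) {u : 𝒳 → ℝ} (hu : BddMeas u)
    (n : ℕ) (a k : ℤ) {Z : Ω → ℝ} (hZ : Measurable[past X Y k] Z) {C : ℝ}
    (hC : ∀ ω, |Z ω| ≤ C) :
    ∫ ω, Z ω * ((∏ j ∈ Finset.range n, F (a + j) (X (k + 1 + j) ω, Y (k + 1 + j) ω)) *
        u (X (k + n) ω)) ∂P =
      ∫ ω, Z ω * iterTransfer Q (avgObs G F) a n u (X k ω) ∂P := by
  induction n generalizing a k Z C with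
  | zero => simp [iterTransfer]
  | succ n ih =>
    obtain ⟨D, hD⟩ := (hF a).2
    have hZ' : Measurable[past X Y (k + 1)] fun ω => Z ω * F a (X (k + 1) ω, Y (k + 1) ω) :=
      (hZ.mono (past_mono X Y (by omega)) le_rfl).mul
        ((hF a).1.comp ((measurable_state_past X Y _).prodMk (measurable_obs_past X Y _)))
    have hZC : ∀ ω, |Z ω * F a (X (k + 1) ω, Y (k + 1) ω)| ≤ C * D := fun ω => by
      rw [abs_mul]
      exact mul_le_mul (hC ω) (hD _) (abs_nonneg _) ((abs_nonneg _).trans (hC ω))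
    have hU : BddMeas (iterTransfer Q (avgObs G F) (a + 1) n u) := hu.iterTransfer hA _ _
    have h1 := ih (a + 1) (k + 1) hZ' hZC
    have h2 := integral_mul_next h k ((hF a).mul (hU.comp measurable_fst)) hZ hC
    simp only [integral_joint_mul (hF a) hU] at h2
    refine Eq.trans ?_ ((h1.trans ?_).trans h2)
    · refine integral_congr_ae (Eventually.of_forall fun ω => ?_)
      simp only [Finset.prod_range_succ']
      push_cast
      simp only [add_zero, add_assoc, add_comm (1 : ℤ)]
      ring
    · refine integral_congr_ae (Eventually.of_forall fun ω => ?_)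
      simp only [mul_assoc]

/-- Expectations of products along the process are given by transfer operators. -/
lemma integral_prod_eq_pathMass (h : IsStationaryHMM P Q G X Y) {F : ℤ → 𝒳 × Obs d → ℝ}
    (hF : ∀ t, BddMeas (F t)) (hA : ∀ t, BddMeas (avgObs G F t)) (n : ℕ) (a b : ℤ) :
    ∫ ω, ∏ j ∈ Finset.range n, F (a + j) (X (b + j) ω, Y (b + j) ω) ∂P =
      pathMass Q (P.map (X 0)) (avgObs G F) a n := by
  -- Starting from the state at time `b - 1`, whose law is that of `X 0` by stationarity; this is
  -- why `b` does not occur in the result.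
  have h1 := integral_mul_prod_next h hF hA (BddMeas.const 1) n a (b - 1) (Z := fun _ => 1)
    measurable_const (C := 1) (by simp)
  simp only [sub_add_cancel, one_mul, mul_one] at h1
  rw [h1, pathMass, pathInt, ← h.stationary (b - 1), integral_map
    (h.measurable_state _).aemeasurable
    (((BddMeas.const 1).iterTransfer hA a n).1.aestronglyMeasurable)]

lemma isProbabilityMeasure_state (h : IsStationaryHMM P Q G X Y) :
    IsProbabilityMeasure (P.map (X 0)) :=
  Measure.isProbabilityMeasure_map (h.measurable_state 0).aemeasurable

/-- Expectations of products along the hidden chain. -/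
lemma integral_prod_state (h : IsStationaryHMM P Q G X Y) {f : ℤ → 𝒳 → ℝ}
    (hf : ∀ t, BddMeas (f t)) (n : ℕ) (a b : ℤ) :
    ∫ ω, ∏ j ∈ Finset.range n, f (a + j) (X (b + j) ω) ∂P =
      pathMass Q (P.map (X 0)) f a n := by
  have e : avgObs G (fun t (z : 𝒳 × Obs d) => f t z.1) = f := by
    ext t x
    simp [avgObs]
  have := integral_prod_eq_pathMass h (F := fun t z => f t z.1)
    (fun t => (hf t).comp measurable_fst) (by rw [e]; exact hf) n a b
  rwa [e] at this

/-- Probabilities of cylinders of the observed process. -/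
lemma real_obs_cylinder (h : IsStationaryHMM P Q G X Y) {B : ℤ → Set (Obs d)}
    (hB : ∀ t, MeasurableSet (B t)) (n : ℕ) (a b : ℤ) :
    P.real {ω | ∀ j : ℕ, j < n → Y (b + j) ω ∈ B (a + j)} =
      pathMass Q (P.map (X 0)) (fun t x => (G x).real (B t)) a n := by
  have e : avgObs G (fun t (z : 𝒳 × Obs d) => (B t).indicator (fun _ => (1 : ℝ)) z.2) =
      fun t x => (G x).real (B t) := by
    ext t x
    simp only [avgObs]
    rw [integral_indicator (hB t)]
    simp
  have hF : ∀ t, BddMeas fun z : 𝒳 × Obs d => (B t).indicator (fun _ => (1 : ℝ)) z.2 := fun t =>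
    ⟨(measurable_const.indicator (hB t)).comp measurable_snd, 1, fun z => by
      by_cases hz : z.2 ∈ B t <;> simp [hz]⟩
  have hA : ∀ t, BddMeas fun x => (G x).real (B t) := fun t =>
    ⟨(G.measurable_coe (hB t)).ennreal_toReal, 1, fun x => by
      rw [abs_of_nonneg measureReal_nonneg]
      exact measureReal_le_one⟩
  have := integral_prod_eq_pathMass h hF (by rw [e]; exact hA) n a b
  rw [e] at this
  rw [← this]
  have hS : MeasurableSet {ω | ∀ j : ℕ, j < n → Y (b + j) ω ∈ B (a + j)} := by
    simp only [Set.ofPred_forall]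
    exact MeasurableSet.iInter fun j => MeasurableSet.iInter fun _ => h.measurable_obs _ (hB _)
  rw [← integral_indicator_one hS]
  refine integral_congr_ae (Eventually.of_forall fun ω => ?_)
  by_cases hω : ∀ j : ℕ, j < n → Y (b + j) ω ∈ B (a + j)
  · rw [Set.indicator_of_mem (by exact hω)]
    exact (Finset.prod_eq_one fun j hj =>
      Set.indicator_of_mem (hω j (Finset.mem_range.1 hj)) _).symm
  · rw [Set.indicator_of_notMem (by exact hω)]
    push Not at hω
    obtain ⟨j, hj, hω⟩ := hω
    exact (Finset.prod_eq_zero (Finset.mem_range.2 hj) (Set.indicator_of_notMem hω _)).symm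

end Markov

/-! ### Mixing implies ergodicity -/

section Mixing

variable {α : Type*} [mα : MeasurableSpace α]

/-- Convergence of dominated measures on a generating π-system extends to all measurable sets. -/
lemma tendsto_real_of_generateFrom {ν : ℕ → Measure α} {ν₀ μ : Measure α} [IsFiniteMeasure μ]
    [IsFiniteMeasure ν₀] (hle : ∀ n, ν n ≤ μ) {C : Set (Set α)}
    (hgen : mα = MeasurableSpace.generateFrom C) (hpi : IsPiSystem C)
    (hC : ∀ s ∈ C, Tendsto (fun n => (ν n).real s) atTop (𝓝 (ν₀.real s)))
    (huniv : Tendsto (fun n => (ν n).real Set.univ) atTop (𝓝 (ν₀.real Set.univ)))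
    {s : Set α} (hs : MeasurableSet s) :
    Tendsto (fun n => (ν n).real s) atTop (𝓝 (ν₀.real s)) := by
  have : ∀ n, IsFiniteMeasure (ν n) := fun n => isFiniteMeasure_of_le μ (hle n)
  induction s, hs using MeasurableSpace.induction_on_inter hgen hpi with
  | empty => simp
  | basic s hs => exact hC s hs
  | compl s hs ih =>
    simp only [measureReal_compl hs]
    exact huniv.sub ih
  | iUnion f hd hm ih =>
    have hsum : ∀ (ρ : Measure α) [IsFiniteMeasure ρ],
        HasSum (fun i => ρ.real (f i)) (ρ.real (⋃ i, f i)) := fun ρ _ => by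
      have h1 : ∑' i, ρ (f i) = ρ (⋃ i, f i) := (measure_iUnion hd hm).symm
      simp only [measureReal_def]
      rw [← h1, ENNReal.tsum_toReal_eq fun i => measure_ne_top _ _]
      exact (ENNReal.summable_toReal (h1 ▸ measure_ne_top _ _)).hasSum
    rw [← (hsum ν₀).tsum_eq]
    simp_rw [← (hsum (ν _)).tsum_eq]
    -- Domination of all `ν n` by `μ` supplies the summable majorant `μ (f i)`.
    refine tendsto_tsum_of_dominated_convergence (hsum μ).summable ih
      (Eventually.of_forall fun n i => ?_)
    rw [Real.norm_of_nonneg measureReal_nonneg]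
    exact ENNReal.toReal_mono (measure_ne_top _ _) (hle n _)

/-- A measure-preserving transformation that is mixing on a generating π-system is ergodic. -/
lemma ergodic_of_mixing {μ : Measure α} [IsProbabilityMeasure μ] {T : α → α}
    (hT : MeasurePreserving T μ μ) {C : Set (Set α)}
    (hgen : mα = MeasurableSpace.generateFrom C) (hpi : IsPiSystem C)
    (hmix : ∀ A ∈ C, ∀ B ∈ C,
      Tendsto (fun n => μ.real (A ∩ T^[n] ⁻¹' B)) atTop (𝓝 (μ.real A * μ.real B))) :
    Ergodic T μ := by
  have hCm : ∀ s ∈ C, MeasurableSet s := fun s hs => hgen ▸ .basic s hs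
  have hTn : ∀ n, MeasurePreserving T^[n] μ μ := fun n => hT.iterate n
  have hmapreal : ∀ A n B, MeasurableSet B →
      ((μ.restrict A).map T^[n]).real B = μ.real (A ∩ T^[n] ⁻¹' B) := fun A n B hB => by
    rw [measureReal_def, Measure.map_apply (hTn n).measurable hB,
      Measure.restrict_apply ((hTn n).measurable hB), Set.inter_comm, measureReal_def]
  have hsmul : ∀ (c : Set α) B, (μ c • μ).real B = μ.real c * μ.real B := fun c B => by
    simp [measureReal_def]
  have : ∀ c : Set α, IsFiniteMeasure (μ c • μ) := fun c =>
    Measure.smul_finite μ (measure_ne_top _ _)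
  -- The extension is made one set at a time: here `B` varies, and the laws of `T^[n]` on `A` are
  -- dominated by `μ` because `T` preserves `μ`. Afterwards `A` varies, with restrictions of `μ` as
  -- the dominated measures.
  have step1 : ∀ A ∈ C, ∀ B, MeasurableSet B →
      Tendsto (fun n => μ.real (A ∩ T^[n] ⁻¹' B)) atTop (𝓝 (μ.real A * μ.real B)) := by
    intro A hA B hB
    have := tendsto_real_of_generateFrom (ν := fun n => (μ.restrict A).map T^[n])
      (ν₀ := μ A • μ) (μ := μ) (fun n => ?_) hgen hpi (fun s hs => ?_) ?_ hB
    · simpa only [hmapreal A _ B hB, hsmul] using this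
    · calc (μ.restrict A).map T^[n] ≤ μ.map T^[n] :=
            Measure.map_mono Measure.restrict_le_self (hTn n).measurable
        _ = μ := (hTn n).map_eq
    · simpa only [hmapreal A _ s (hCm s hs), hsmul] using hmix A hA s hs
    · simp only [hmapreal A _ _ MeasurableSet.univ, hsmul]
      simp
  have step2 : ∀ A, MeasurableSet A → ∀ B, MeasurableSet B →
      Tendsto (fun n => μ.real (A ∩ T^[n] ⁻¹' B)) atTop (𝓝 (μ.real A * μ.real B)) := by
    intro A hA B hB
    have hr : ∀ n s, MeasurableSet s →
        (μ.restrict (T^[n] ⁻¹' B)).real s = μ.real (s ∩ T^[n] ⁻¹' B) := fun n s hs => by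
      rw [measureReal_def, Measure.restrict_apply hs, measureReal_def]
    have := tendsto_real_of_generateFrom (ν := fun n => μ.restrict (T^[n] ⁻¹' B))
      (ν₀ := μ B • μ) (μ := μ) (fun n => Measure.restrict_le_self) hgen hpi (fun s hs => ?_) ?_ hA
    · simpa only [hr _ A hA, hsmul, mul_comm] using this
    · simpa only [hr _ s (hCm s hs), hsmul, mul_comm] using step1 s hs B hB
    · simp only [hr _ _ MeasurableSet.univ, hsmul, Set.univ_inter, probReal_univ, mul_one]
      refine tendsto_const_nhds.congr fun n => ?_
      rw [measureReal_def, measureReal_def, (hTn n).measure_preimage hB.nullMeasurableSet]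
  refine { toMeasurePreserving := hT, toPreErgodic := ⟨fun s hs hinv => ?_⟩ }
  have hn : ∀ n, T^[n] ⁻¹' s = s := fun n => by
    induction n with
    | zero => rfl
    | succ n ih => rw [Function.iterate_succ, Set.preimage_comp, ih, hinv]
  -- For an invariant set, mixing reads `μ s = (μ s) ^ 2`.
  have h1 := step2 s hs s hs
  simp only [hn, Set.inter_self] at h1
  have h2 := tendsto_nhds_unique h1 tendsto_const_nhds
  have h3 : μ.real s * (μ.real s - 1) = 0 := by linarith
  rw [Filter.eventuallyConst_set']
  rcases mul_eq_zero.1 h3 with h0 | h0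
  · left
    rw [measureReal_eq_zero_iff] at h0
    exact ae_eq_empty.2 h0
  · right
    rw [ae_eq_univ, ← measureReal_eq_zero_iff, measureReal_compl hs, probReal_univ]
    linarith

end Mixing

/-! ### Stationarity, mixing and ergodicity of the observed process -/

section Observations

variable {Ω 𝒳 : Type*} [mΩ : MeasurableSpace Ω] [MeasurableSpace 𝒳] {d : ℕ}
  {P : Measure Ω} [IsProbabilityMeasure P] {Q : Kernel 𝒳 𝒳} [IsMarkovKernel Q]
  {G : Kernel 𝒳 (Obs d)} [IsMarkovKernel G] {X : ℤ → Ω → 𝒳} {Y : ℤ → Ω → Obs d}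
  {ref : Measure 𝒳} [IsProbabilityMeasure ref] {m : ℕ} {σm σp gm gp : ℝ}

lemma measurable_shift {α : Type*} [MeasurableSpace α] :
    Measurable (shift : (ℤ → α) → ℤ → α) :=
  measurable_pi_lambda _ fun k => measurable_pi_apply (k + 1)

lemma shift_iterate {α : Type*} (n : ℕ) (y : ℤ → α) (k : ℤ) : shift^[n] y k = y (k + n) := by
  induction n generalizing y with
  | zero => simp
  | succ n ih =>
    rw [Function.iterate_succ_apply, ih, shift]
    push_cast
    rw [add_assoc]

/-- Extend the sides of a cylinder by the whole space. -/
lemma mem_pi_iff_window {α : Type*} {s : Finset ℤ} {t : ℤ → Set α} {N : ℕ}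
    (hN : ∀ i ∈ s, -(N : ℤ) ≤ i ∧ i < N) (l : ℕ) (y : ℤ → α) :
    y ∈ (s : Set ℤ).pi t ↔ ∀ j : ℕ, j < l + 2 * N →
      y (-(N : ℤ) - l + j) ∈ (if -(N : ℤ) - l + j ∈ s then t (-(N : ℤ) - l + j) else Set.univ) := by
  constructor
  · intro hy j _
    split_ifs with h
    · exact hy _ h
    · trivial
  · intro hy i hi
    obtain ⟨h1, h2⟩ := hN i hi
    have h3 := hy (i + N + l).toNat (by omega)
    have h4 : -(N : ℤ) - l + ((i + N + l).toNat : ℤ) = i := by omega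
    rw [h4, if_pos (Finset.mem_coe.1 hi)] at h3
    exact h3

lemma exists_window (s : Finset ℤ) : ∃ N : ℕ, ∀ i ∈ s, -(N : ℤ) ≤ i ∧ i < N := by
  refine ⟨s.sup Int.natAbs + 1, fun i hi => ?_⟩
  have : i.natAbs ≤ s.sup Int.natAbs := Finset.le_sup (f := Int.natAbs) hi
  omega

lemma measurable_process (h : IsStationaryHMM P Q G X Y) : Measurable fun ω k => Y k ω :=
  measurable_pi_lambda _ fun k => h.measurable_obs k

lemma measurableSet_side {s : Finset ℤ} {t : ℤ → Set (Obs d)} (ht : ∀ i, MeasurableSet (t i))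
    (i : ℤ) : MeasurableSet (if i ∈ s then t i else Set.univ) := by
  split_ifs
  · exact ht i
  · exact MeasurableSet.univ

/-- Since `b` is absent from the right-hand side, this is stationarity on cylinders. -/
lemma real_obs_pi (h : IsStationaryHMM P Q G X Y) {s : Finset ℤ} {t : ℤ → Set (Obs d)}
    (ht : ∀ i, MeasurableSet (t i)) {N : ℕ} (hN : ∀ i ∈ s, -(N : ℤ) ≤ i ∧ i < N) (b : ℤ) :
    P.real {ω | (fun k => Y (k + b) ω) ∈ (s : Set ℤ).pi t} =
      pathMass Q (P.map (X 0))
        (fun i x => (G x).real (if i ∈ s then t i else Set.univ)) (-N) (2 * N) := by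
  rw [← real_obs_cylinder h (measurableSet_side ht) (2 * N) (-N) (-N + b)]
  congr 1
  ext ω
  have := mem_pi_iff_window hN 0 (t := t) fun k => Y (k + b) ω
  simp only [Nat.cast_zero, sub_zero, zero_add] at this
  rw [Set.mem_ofPred_eq, this, Set.mem_ofPred_eq]
  simp only [add_right_comm]

lemma measurePreserving_shift (h : IsStationaryHMM P Q G X Y) :
    MeasurePreserving shift (P.map fun ω k => Y k ω) (P.map fun ω k => Y k ω) := by
  refine ⟨measurable_shift, ?_⟩
  have hY := measurable_process h
  have : IsProbabilityMeasure (P.map fun ω k => Y k ω) :=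
    Measure.isProbabilityMeasure_map hY.aemeasurable
  have : IsProbabilityMeasure ((P.map fun ω k => Y k ω).map shift) :=
    Measure.isProbabilityMeasure_map measurable_shift.aemeasurable
  refine ext_of_generate_finite _ generateFrom_squareCylinders.symm
    (isPiSystem_squareCylinders (fun _ => MeasurableSpace.isPiSystem_measurableSet)
      fun _ => by simp) ?_ (by simp)
  rintro S ⟨s, t, ht, rfl⟩
  have ht : ∀ i, MeasurableSet (t i) := fun i => ht i trivial
  have hS : MeasurableSet ((s : Set ℤ).pi t) :=
    MeasurableSet.pi s.countable_toSet fun i _ => ht i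
  obtain ⟨N, hN⟩ := exists_window s
  have key := real_obs_pi h ht hN
  rw [Measure.map_apply measurable_shift hS, Measure.map_apply hY (measurable_shift hS),
    Measure.map_apply hY hS]
  have h0 := key 0
  simp only [add_zero] at h0
  exact (measureReal_eq_measureReal_iff).1 ((key 1).trans h0.symm)

/-- Exponential mixing: the future of the observed process is nearly independent of its past. -/
lemma abs_real_inter_sub_le (h : IsStationaryHMM P Q G X Y)
    (hM : MixingBounds Q ref m σm σp 1 1) {s : Finset ℤ} {t : ℤ → Set (Obs d)}
    (ht : ∀ i, MeasurableSet (t i)) {N : ℕ} (hN : ∀ i ∈ s, -(N : ℤ) ≤ i ∧ i < N) {k : ℤ}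
    {A : Set Ω} (hA : MeasurableSet[past X Y k] A) (l : ℕ) :
    |P.real (A ∩ {ω | (fun i => Y (i + (k + 1 + N + l)) ω) ∈ (s : Set ℤ).pi t}) -
        P.real A * P.real {ω | (fun i => Y (i + (k + 1 + N + l)) ω) ∈ (s : Set ℤ).pi t}| ≤
      rate m σm σp 1 1 ^ (l / m) := by
  set B : ℤ → Set (Obs d) := fun i => if i ∈ s then t i else Set.univ with hB
  have hBm : ∀ i, MeasurableSet (B i) := measurableSet_side ht
  set F : ℤ → 𝒳 × Obs d → ℝ := fun i z => (B i).indicator (fun _ => (1 : ℝ)) z.2 with hF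
  have e : avgObs G F = fun i x => (G x).real (B i) := by
    ext i x
    simp only [avgObs, hF]
    rw [integral_indicator (hBm i)]
    simp
  have hFB : ∀ i, BddMeas (F i) := fun i =>
    ⟨(measurable_const.indicator (hBm i)).comp measurable_snd, 1, fun z => by
      by_cases hz : z.2 ∈ B i <;> simp [hF, hz]⟩
  have hg : ∀ i x, 0 ≤ avgObs G F i x ∧ avgObs G F i x ≤ 1 := fun i x => by
    rw [e]
    exact ⟨measureReal_nonneg, measureReal_le_one⟩
  have hAB : ∀ i, BddMeas (avgObs G F i) := fun i => by
    refine ⟨?_, 1, fun x => ?_⟩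
    · rw [e]
      exact (G.measurable_coe (hBm i)).ennreal_toReal
    · rw [abs_of_nonneg (hg i x).1]
      exact (hg i x).2
  set E : Set Ω := {ω | (fun i => Y (i + (k + 1 + N + l)) ω) ∈ (s : Set ℤ).pi t} with hE
  have hEm : MeasurableSet E := by
    have : Measurable fun ω (i : ℤ) => Y (i + (k + 1 + N + l)) ω :=
      measurable_pi_lambda _ fun i => h.measurable_obs _
    exact this (MeasurableSet.pi s.countable_toSet fun i _ => ht i)
  have hprod : ∀ ω, ∏ j ∈ Finset.range (l + 2 * N),
      F (-(N : ℤ) - l + j) (X (k + 1 + j) ω, Y (k + 1 + j) ω) = E.indicator (fun _ => 1) ω := by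
    intro ω
    have hwin := mem_pi_iff_window hN l (t := t) fun i => Y (i + (k + 1 + N + l)) ω
    have hidx : ∀ j : ℕ, -(N : ℤ) - l + j + (k + 1 + N + l) = k + 1 + j := fun j => by ring
    simp only [hidx] at hwin
    by_cases hω : ω ∈ E
    · rw [Set.indicator_of_mem hω]
      exact Finset.prod_eq_one fun j hj =>
        Set.indicator_of_mem (hwin.1 hω j (Finset.mem_range.1 hj)) _
    · rw [Set.indicator_of_notMem hω]
      have hω' := mt hwin.2 hω
      push Not at hω'
      obtain ⟨j, hj, hω'⟩ := hω'
      exact Finset.prod_eq_zero (Finset.mem_range.2 hj) (Set.indicator_of_notMem hω' _)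
  -- `u` is the conditional probability of the cylinder given the state just before its window, so
  -- its range is in `[0, 1]`. The `l` preceding times have trivial sides, hence weights `1`, and
  -- contract this range.
  set u := iterTransfer Q (avgObs G F) (-N) (2 * N) fun _ => 1 with hu
  have huB : BddMeas u := (BddMeas.const 1).iterTransfer hAB _ _
  have hu0 : ∀ x, 0 ≤ u x := fun x => by
    have := iterTransfer_mono (Q := Q) hAB (fun i x => (hg i x).1) (BddMeas.const 0)
      (BddMeas.const 1) (fun _ => zero_le_one) (-N) (2 * N) x
    have h0 := iterTransfer_const_mul (Q := Q) hAB (BddMeas.const 1) 0 (-N) (2 * N) x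
    simp only [zero_mul] at h0
    linarith
  have hu1 : ∀ x, u x ≤ 1 := by
    have : ∀ (n : ℕ) (a : ℤ) x, iterTransfer Q (avgObs G F) a n (fun _ => 1) x ≤ 1 := by
      intro n
      induction n with
      | zero => exact fun a x => le_rfl
      | succ n ih =>
        intro a x
        exact (transfer_mono (hAB a) (fun x => (hg a x).1)
          ((BddMeas.const 1).iterTransfer hAB _ _) (BddMeas.const 1) (ih (a + 1)) x).trans
          (transfer_one_bounds (hAB a) (hg a) x).2
    exact this _ _
  have hone : Comparable 1 1 fun (_ : ℤ) (_ : 𝒳) => (1 : ℝ) := fun _ =>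
    ⟨measurable_const, 1, one_pos, fun _ => by simp⟩
  obtain ⟨α, β, -, -, hd, hr⟩ := exists_contract (Q := Q) one_pos one_pos hone hM.σm_pos hM.σp_pos
    hM.minorized huB (BddMeas.const 1) posBelow_one (α := 0) (β := 1)
    (fun x => by simpa using hu0 x) (fun x => by simpa using hu1 x) (-(N : ℤ) - l) l
  have hone1 : ∀ (n : ℕ) (a : ℤ) (x : 𝒳),
      iterTransfer Q (fun (_ : ℤ) (_ : 𝒳) => (1 : ℝ)) a n (fun _ => 1) x = 1 := by
    intro n
    induction n with
    | zero => exact fun _ _ => rfl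
    | succ n ih =>
      intro a x
      simp only [iterTransfer, transfer]
      simp [ih]
  have hU : iterTransfer Q (avgObs G F) (-(N : ℤ) - l) (l + 2 * N) (fun _ => 1) =
      iterTransfer Q (fun (_ : ℤ) (_ : 𝒳) => (1 : ℝ)) (-(N : ℤ) - l) l u := by
    rw [iterTransfer_add, sub_add_cancel]
    refine iterTransfer_congr (fun i _ hi => ?_) _
    ext x
    rw [e]
    have : i ∉ s := fun his => by
      have := (hN i his).1
      omega
    simp [hB, this]
  have hφ : ∀ x, iterTransfer Q (avgObs G F) (-(N : ℤ) - l) (l + 2 * N) (fun _ => 1) x ∈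
      Set.Icc α β := fun x => by
    have := hr x
    rw [hone1, mul_one, mul_one] at this
    rw [hU]
    exact this
  have hφB : BddMeas (iterTransfer Q (avgObs G F) (-(N : ℤ) - l) (l + 2 * N) fun _ => 1) :=
    (BddMeas.const 1).iterTransfer hAB _ _
  -- Used for the given event and for the whole space: both `P(E | A)` and `P(E)` lie in `[α, β]`.
  have main : ∀ A : Set Ω, MeasurableSet[past X Y k] A →
      α * P.real A ≤ P.real (A ∩ E) ∧ P.real (A ∩ E) ≤ β * P.real A := by
    intro A hA
    have hAm : MeasurableSet A := past_le h k A hA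
    have h1 := integral_mul_prod_next h hFB hAB (BddMeas.const 1) (l + 2 * N) (-(N : ℤ) - l) k
      (Z := A.indicator fun _ => 1) ((measurable_indicator_const_iff 1).2 hA) (C := 1)
      (fun ω => by by_cases hω : ω ∈ A <;> simp [hω])
    simp only [hprod, mul_one] at h1
    have h2 : ∫ ω, A.indicator (fun _ => (1 : ℝ)) ω * E.indicator (fun _ => 1) ω ∂P =
        P.real (A ∩ E) := by
      rw [← integral_indicator_one (hAm.inter hEm)]
      refine integral_congr_ae (Eventually.of_forall fun ω => ?_)
      by_cases hωA : ω ∈ A <;> by_cases hωE : ω ∈ E <;> simp [hωA, hωE]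
    have hind : BddMeas (A.indicator fun _ => (1 : ℝ)) :=
      ⟨measurable_const.indicator hAm, 1, fun ω => by by_cases hω : ω ∈ A <;> simp [hω]⟩
    have hA1 : ∀ c : ℝ, c * P.real A = ∫ ω, A.indicator (fun _ => (1 : ℝ)) ω * c ∂P := fun c => by
      rw [integral_mul_const, mul_comm, ← integral_indicator_one hAm]
      rfl
    rw [← h2, h1, hA1, hA1]
    have hi := (hind.mul (hφB.comp (h.measurable_state k))).integrable P
    have hnn : ∀ ω, 0 ≤ A.indicator (fun _ => (1 : ℝ)) ω := fun ω =>
      Set.indicator_nonneg (fun _ _ => zero_le_one) ω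
    exact ⟨integral_mono ((hind.mul (BddMeas.const α)).integrable P) hi fun ω =>
        mul_le_mul_of_nonneg_left (hφ _).1 (hnn ω),
      integral_mono hi ((hind.mul (BddMeas.const β)).integrable P) fun ω =>
        mul_le_mul_of_nonneg_left (hφ _).2 (hnn ω)⟩
  have mA := main A hA
  have mU := main Set.univ MeasurableSet.univ
  rw [Set.univ_inter, probReal_univ, mul_one, mul_one] at mU
  have hd' : β - α = rate m σm σp 1 1 ^ (l / m) := by
    rw [hd, rate]
    simp
  have hA1 : P.real A ≤ 1 := measureReal_le_one
  have hA0 : 0 ≤ P.real A := measureReal_nonneg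
  rw [← hd', abs_le]
  constructor <;> nlinarith [mA.1, mA.2, mU.1, mU.2]

/-- The observed process is stationary and ergodic. -/
lemma ergodic_observations (h : IsStationaryHMM P Q G X Y)
    (hM : MixingBounds Q ref m σm σp 1 1) (hm : 1 ≤ m) (hr0 : 0 ≤ rate m σm σp 1 1)
    (hr1 : rate m σm σp 1 1 < 1) : Ergodic shift (P.map fun ω k => Y k ω) := by
  have hY := measurable_process h
  have : IsProbabilityMeasure (P.map fun ω k => Y k ω) :=
    Measure.isProbabilityMeasure_map hY.aemeasurable
  have hT := measurePreserving_shift h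
  refine ergodic_of_mixing hT generateFrom_squareCylinders.symm
    (isPiSystem_squareCylinders (fun _ => MeasurableSpace.isPiSystem_measurableSet)
      fun _ => by simp) ?_
  rintro A ⟨s', t', ht', rfl⟩ B ⟨s, t, ht, rfl⟩
  have ht : ∀ i, MeasurableSet (t i) := fun i => ht i trivial
  have ht' : ∀ i, MeasurableSet (t' i) := fun i => ht' i trivial
  have hA : MeasurableSet ((s' : Set ℤ).pi t') :=
    MeasurableSet.pi s'.countable_toSet fun i _ => ht' i
  have hB : MeasurableSet ((s : Set ℤ).pi t) :=
    MeasurableSet.pi s.countable_toSet fun i _ => ht i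
  obtain ⟨N, hN⟩ := exists_window s
  obtain ⟨N', hN'⟩ := exists_window s'
  have hpast : MeasurableSet[past X Y N'] ((fun ω k => Y k ω) ⁻¹' (s' : Set ℤ).pi t') := by
    rw [show ((fun ω k => Y k ω) ⁻¹' (s' : Set ℤ).pi t') = ⋂ i ∈ s', Y i ⁻¹' t' i by
      ext ω; simp [Set.mem_pi]]
    refine Finset.measurableSet_biInter _ fun i hi => ?_
    exact past_mono X Y (hN' i hi).2.le _ (measurable_obs_past X Y i (ht' i))
  -- The offset at which the window of the shifted cylinder starts right after time `N'`, the past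
  -- that contains the first cylinder; every further shift widens the gap.
  set L : ℕ := N' + 1 + N with hL
  rw [← tendsto_add_atTop_iff_nat L]
  have hlim : Tendsto (fun l : ℕ => rate m σm σp 1 1 ^ (l / m)) atTop (𝓝 0) :=
    (tendsto_pow_atTop_nhds_zero_of_lt_one hr0 hr1).comp
      (Nat.tendsto_div_const_atTop (by omega))
  rw [tendsto_iff_norm_sub_tendsto_zero]
  refine squeeze_zero (fun _ => norm_nonneg _) (fun l => ?_) hlim
  have := abs_real_inter_sub_le h hM ht hN hpast l
  have hTB := (hT.iterate (l + L)).measurable hB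
  have e1 : (fun ω k => Y k ω) ⁻¹' (shift^[l + L] ⁻¹' (s : Set ℤ).pi t) =
      {ω | (fun i => Y (i + (N' + 1 + N + l)) ω) ∈ (s : Set ℤ).pi t} := by
    ext ω
    simp only [Set.mem_preimage, Set.mem_ofPred_eq]
    rw [show shift^[l + L] (fun k => Y k ω) = fun i => Y (i + (N' + 1 + N + l)) ω from
      funext fun i => by
        rw [shift_iterate, hL]
        push_cast
        congr 1
        ring]
  rw [← e1] at this
  have r : ∀ S, MeasurableSet S → (P.map fun ω k => Y k ω).real S =
      P.real ((fun ω k => Y k ω) ⁻¹' S) := fun S hS => by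
    rw [measureReal_def, Measure.map_apply hY hS, measureReal_def]
  rw [← Set.preimage_inter, ← r _ (hA.inter hTB), ← r _ hA, ← r _ hTB] at this
  have e2 : (P.map fun ω k => Y k ω).real (shift^[l + L] ⁻¹' (s : Set ℤ).pi t) =
      (P.map fun ω k => Y k ω).real ((s : Set ℤ).pi t) := by
    rw [measureReal_def, (hT.iterate (l + L)).measure_preimage hB.nullMeasurableSet,
      measureReal_def]
  rw [e2] at this
  exact this

end Observations

/-! ### Blocks and conditional densities -/

section Blocks

variable {α : Type*}

lemma append_block (w : ℤ → α) (a b : ℤ) (m l : ℕ) (hb : b = a + m) :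
    Fin.append (block w a m) (block w b l) = block w a (m + l) := by
  subst hb
  ext j
  refine Fin.addCases (fun i => ?_) (fun i => ?_) j
  · simp [block]
  · simp [block, add_assoc]

/-- The convention for a void past agrees with the general quotient because an empty product has
mass `1`. -/
lemma condDens_block {p : ∀ n : ℕ, (Fin n → α) → ℝ} {w : ℤ → α} {M : ℤ → ℕ → ℝ}
    (hM : ∀ a n, p n (block w a n) = M a n) (hM0 : ∀ a, M a 0 = 1) (a b : ℤ) (m l : ℕ)
    (hb : b = a + m) :
    condDens p m l (block w a m) (block w b l) = M a (m + l) / M a m := by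
  rw [condDens]
  split_ifs with h
  · subst h
    simp only [Nat.cast_zero, add_zero] at hb
    rw [hb, hM, hM0, div_one, zero_add]
  · rw [append_block w a b m l hb, hM, hM]

end Blocks

/-! ### Forgetting for the conditional log-densities -/

section Forgetting

variable {𝒳 : Type*} [MeasurableSpace 𝒳] {Q : Kernel 𝒳 𝒳} [IsMarkovKernel Q] {π₀ : Measure 𝒳}
  [IsProbabilityMeasure π₀] {ref : Measure 𝒳} [IsProbabilityMeasure ref] {m : ℕ}
  {σm σp gm gp : ℝ} {α : Type*} {p : ∀ n : ℕ, (Fin n → α) → ℝ} {w : ℤ → α} {f : ℤ → 𝒳 → ℝ}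

lemma pathMass_zero (f : ℤ → 𝒳 → ℝ) (a : ℤ) : pathMass Q π₀ f a 0 = 1 := by
  simp [pathMass, pathInt, iterTransfer]

lemma logCond_eq (hp : ∀ a n, p n (block w a n) = pathMass Q π₀ f a n) (n : ℕ) :
    logCond p n w = Real.log (pathMass Q π₀ f (-n) (n + 1) / pathMass Q π₀ f (-n) n) := by
  rw [logCond, condDens_block hp (pathMass_zero f) (-n) 0 n 1 (by simp)]

lemma abs_logCond_sub_le (hM : MixingBounds Q ref m σm σp gm gp) (hf : Comparable gm gp f)
    (hp : ∀ a n, p n (block w a n) = pathMass Q π₀ f a n) {n n' : ℕ} (hn : n ≤ n') :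
    |logCond p n w - logCond p n' w| ≤ (gp - gm) / gm * rate m σm σp gm gp ^ (n / m) := by
  obtain ⟨l, rfl⟩ := Nat.exists_eq_add_of_le' hn
  rw [logCond_eq hp, logCond_eq hp]
  have := abs_log_ratio_sub_le (π₀ := π₀) hM hf (-((l + n : ℕ) : ℤ)) l n
  rwa [show -((l + n : ℕ) : ℤ) + l = -n by push_cast; ring] at this

/-- The weights depend on `ω`, the bound does not. Integration is thus trivial, and `P₀` need not be
the law from which `p` is built. -/
lemma forgetting_le_of_pathMass {Ω : Type*} [MeasurableSpace Ω] {P₀ : Measure Ω}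
    [IsProbabilityMeasure P₀] (hM : MixingBounds Q ref m σm σp gm gp) {W : ℤ → Ω → α}
    (h : ∀ ω, ∃ f : ℤ → 𝒳 → ℝ, Comparable gm gp f ∧
      ∀ a n, p n (block (fun k => W k ω) a n) = pathMass Q π₀ f a n) (n : ℕ) :
    forgetting P₀ p W n ≤ ENNReal.ofReal ((gp - gm) / gm * rate m σm σp gm gp ^ (n / m)) := by
  refine iSup₂_le fun n' hn => ?_
  calc _ ≤ ∫⁻ _ω, ENNReal.ofReal ((gp - gm) / gm * rate m σm σp gm gp ^ (n / m)) ∂P₀ := by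
        refine lintegral_mono fun ω => ?_
        obtain ⟨f, hf, hp⟩ := h ω
        rw [Real.enorm_eq_ofReal_abs]
        exact ENNReal.ofReal_le_ofReal (abs_logCond_sub_le hM hf hp hn)
    _ = _ := by simp

end Forgetting

/-! ### The densities of the observations -/

section Density

variable {Ω 𝒳 : Type*} [MeasurableSpace Ω] [MeasurableSpace 𝒳] {d : ℕ}
  {P : Measure Ω} [IsProbabilityMeasure P] {Q : Kernel 𝒳 𝒳} [IsMarkovKernel Q]
  {G : Kernel 𝒳 (Obs d)} [IsMarkovKernel G] {X : ℤ → Ω → 𝒳} {Y : ℤ → Ω → Obs d}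
  {𝒴 : Set (Obs d)} {g : 𝒳 → Obs d → ℝ} {gm gp : ℝ}

/-- `pathExp` uses the states at times `1, …, n`, but by stationarity it also describes a window
starting at any `a`. -/
lemma pathExp_block (h : IsStationaryHMM P Q G X Y) {n : ℕ} {u : Fin n → 𝒳 → Obs d → ℝ}
    {f : ℤ → 𝒳 → ℝ} (hf : ∀ t, BddMeas (f t)) {w : ℤ → Obs d} {a : ℤ}
    (huf : ∀ (j : Fin n) x, u j x (w (a + j)) = f (a + j) x) :
    pathExp P X u (block w a n) = pathMass Q (P.map (X 0)) f a n := by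
  rw [← integral_prod_state h hf n a 1, pathExp]
  refine integral_congr_ae (Eventually.of_forall fun ω => ?_)
  simp only [Finset.prod_range]
  exact Finset.prod_congr rfl fun j _ => huf j _

lemma measurable_pathExp (hX : ∀ k, Measurable (X k)) (hg : Measurable (Function.uncurry g))
    (n : ℕ) : Measurable (pathExp P X fun _ : Fin n => g) := by
  have : StronglyMeasurable (Function.uncurry fun (y : Fin n → Obs d) ω =>
      ∏ k : Fin n, g (X (1 + (k : ℤ)) ω) (y k)) := by
    refine Measurable.stronglyMeasurable (Finset.measurable_prod _ fun k _ => ?_)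
    exact hg.comp (((hX _).comp measurable_snd).prodMk
      ((measurable_pi_apply k).comp measurable_fst))
  exact this.integral_prod_right.measurable

lemma comparable_obs (hm : ∀ y ∈ 𝒴, Measurable fun x => g x y)
    (hle : ∀ x, ∀ y ∈ 𝒴, gm ≤ g x y ∧ g x y ≤ gp) {w : ℤ → Obs d} (hw : ∀ t, w t ∈ 𝒴) :
    Comparable gm gp fun t x => g x (w t) := fun t =>
  ⟨hm _ (hw t), 1, one_pos, fun x => by simpa using hle x _ (hw t)⟩

lemma real_eq_setIntegral (h𝒴 : MeasurableSet 𝒴) (hgm : 0 < gm)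
    (hg : Measurable (Function.uncurry g))
    (hG : ∀ x, G x = ((volume : Measure (Obs d)).restrict 𝒴).withDensity
      fun y => ENNReal.ofReal (g x y))
    (hle : ∀ x, ∀ y ∈ 𝒴, gm ≤ g x y ∧ g x y ≤ gp) (x : 𝒳) {B : Set (Obs d)}
    (hB : MeasurableSet B) :
    (G x).real B = ∫ y, g x y ∂((volume.restrict 𝒴).restrict B) := by
  rw [hG, measureReal_def, withDensity_apply _ hB]
  have hgx : Measurable (g x) := hg.comp measurable_prodMk_left
  rw [integral_eq_lintegral_of_nonneg_ae _ hgx.aestronglyMeasurable]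
  refine ae_restrict_of_ae ?_
  filter_upwards [ae_restrict_mem h𝒴] with y hy
  exact hgm.le.trans (hle x y hy).1

/-- Boxes determine the law. The probability of a box is the expectation of `∏ G(X_k, B_k)`; writing
each factor as an integral of `g` and exchanging the integrals gives the density. -/
lemma map_block_eq_withDensity (h : IsStationaryHMM P Q G X Y) (h𝒴 : MeasurableSet 𝒴)
    (hfin : volume 𝒴 ≠ ∞) (hgm : 0 < gm) (hg : Measurable (Function.uncurry g))
    (hG : ∀ x, G x = ((volume : Measure (Obs d)).restrict 𝒴).withDensity
      fun y => ENNReal.ofReal (g x y))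
    (hle : ∀ x, ∀ y ∈ 𝒴, gm ≤ g x y ∧ g x y ≤ gp) (n : ℕ) :
    P.map (fun ω => block (fun k => Y k ω) 1 n) =
      (Measure.pi fun _ : Fin n => (volume : Measure (Obs d)).restrict 𝒴).withDensity
        fun y => ENNReal.ofReal (pathExp P X (fun _ : Fin n => g) y) := by
  have hYb : Measurable fun ω => block (fun k => Y k ω) 1 n :=
    measurable_pi_lambda _ fun j => h.measurable_obs _
  have : IsFiniteMeasure ((volume : Measure (Obs d)).restrict 𝒴) :=
    ⟨by simpa using hfin.lt_top⟩
  set ν : Measure (Obs d) := volume.restrict 𝒴 with hν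
  have hmem : ∀ᵐ y ∂(Measure.pi fun _ : Fin n => ν), y ∈ blocks 𝒴 n := by
    rw [hν, ← Measure.restrict_pi_pi]
    exact ae_restrict_mem (MeasurableSet.univ_pi fun _ => h𝒴)
  have hprodm : Measurable fun z : (Fin n → Obs d) × Ω =>
      ∏ k : Fin n, g (X (1 + (k : ℤ)) z.2) (z.1 k) :=
    Finset.measurable_prod _ fun k _ => hg.comp (((h.measurable_state _).comp measurable_snd).prodMk
      ((measurable_pi_apply k).comp measurable_fst))
  have hbound : ∀ y ∈ blocks 𝒴 n, ∀ ω, 0 ≤ ∏ k : Fin n, g (X (1 + (k : ℤ)) ω) (y k) ∧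
      ∏ k : Fin n, g (X (1 + (k : ℤ)) ω) (y k) ≤ gp ^ n := fun y hy ω => by
    have h0 : ∀ k : Fin n, 0 ≤ g (X (1 + (k : ℤ)) ω) (y k) := fun k =>
      hgm.le.trans (hle _ _ (hy k trivial)).1
    refine ⟨Finset.prod_nonneg fun k _ => h0 k, ?_⟩
    refine (Finset.prod_le_prod (fun k _ => h0 k) fun k _ => (hle _ _ (hy k trivial)).2).trans ?_
    simp
  have box : ∀ B : Fin n → Set (Obs d), (∀ k, MeasurableSet (B k)) →
      P.map (fun ω => block (fun k => Y k ω) 1 n) (Set.univ.pi B) =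
        ((Measure.pi fun _ : Fin n => ν).withDensity
          fun y => ENNReal.ofReal (pathExp P X (fun _ : Fin n => g) y)) (Set.univ.pi B) := by
    intro B hB
    have hBm : MeasurableSet (Set.univ.pi B) := MeasurableSet.univ_pi hB
    set ρ : Measure (Fin n → Obs d) := (Measure.pi fun _ : Fin n => ν).restrict (Set.univ.pi B)
      with hρ
    have hρmem : ∀ᵐ y ∂ρ, y ∈ blocks 𝒴 n := ae_restrict_of_ae hmem
    have hint : Integrable (fun z : (Fin n → Obs d) × Ω =>
        ∏ k : Fin n, g (X (1 + (k : ℤ)) z.2) (z.1 k)) (ρ.prod P) := by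
      refine Integrable.of_bound hprodm.aestronglyMeasurable (gp ^ n) ?_
      have : ∀ᵐ z ∂(ρ.prod P), z.1 ∈ blocks 𝒴 n :=
        Measure.quasiMeasurePreserving_fst.ae hρmem
      filter_upwards [this] with z hz
      rw [Real.norm_of_nonneg (hbound _ hz _).1]
      exact (hbound _ hz _).2
    have hI : Integrable (pathExp P X fun _ : Fin n => g) ρ := hint.integral_prod_left
    rw [withDensity_apply _ hBm, ← ofReal_integral_eq_lintegral_ofReal hI
      (hρmem.mono fun y hy => integral_nonneg fun ω => (hbound y hy ω).1),
      Measure.map_apply hYb hBm, ← ofReal_measureReal]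
    congr 1
    -- The sides are extended to a family over `ℤ`, with index `0` corresponding to time `1`.
    let B' : ℤ → Set (Obs d) := fun t => if ht : 0 ≤ t ∧ t < n then B ⟨t.toNat, by omega⟩
      else Set.univ
    have hB' : ∀ t, MeasurableSet (B' t) := fun t => by
      by_cases ht : 0 ≤ t ∧ t < n
      · simp only [B', dif_pos ht]
        exact hB _
      · simp only [B', dif_neg ht]
        exact MeasurableSet.univ
    have hB'k : ∀ k : Fin n, B' (0 + (k : ℤ)) = B k := fun k => by
      have hk : 0 ≤ 0 + ((k : ℕ) : ℤ) ∧ 0 + ((k : ℕ) : ℤ) < n := by omega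
      simp only [B', dif_pos hk]
      congr 1
      ext
      simp
    have hA : ∀ t, BddMeas fun x => (G x).real (B' t) := fun t =>
      ⟨(G.measurable_coe (hB' t)).ennreal_toReal, 1, fun x => by
        rw [abs_of_nonneg measureReal_nonneg]
        exact measureReal_le_one⟩
    have e1 : (fun ω => block (fun k => Y k ω) 1 n) ⁻¹' Set.univ.pi B =
        {ω | ∀ j : ℕ, j < n → Y (1 + j) ω ∈ B' (0 + j)} := by
      ext ω
      simp only [Set.mem_preimage, Set.mem_univ_pi, Set.mem_ofPred_eq, block]
      constructor
      · intro hω j hj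
        rw [hB'k ⟨j, hj⟩]
        exact hω ⟨j, hj⟩
      · intro hω k
        rw [← hB'k k]
        exact hω k k.2
    rw [e1, real_obs_cylinder h hB' n 0 1, ← integral_prod_state h hA n 0 1]
    have e2 : ∀ ω, ∏ j ∈ Finset.range n, (G (X (1 + j) ω)).real (B' (0 + j)) =
        ∫ y, ∏ k : Fin n, g (X (1 + (k : ℤ)) ω) (y k) ∂ρ := fun ω => by
      rw [hρ, Measure.restrict_pi_pi, integral_fintype_prod_eq_prod, Finset.prod_range]
      refine Finset.prod_congr rfl fun k _ => ?_
      rw [hB'k, real_eq_setIntegral h𝒴 hgm hg hG hle _ (hB k)]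
    simp_rw [e2]
    exact (integral_integral_swap (f := fun (y : Fin n → Obs d) ω =>
      ∏ k : Fin n, g (X (1 + (k : ℤ)) ω) (y k))
      hint).symm
  have : IsProbabilityMeasure (P.map fun ω => block (fun k => Y k ω) 1 n) :=
    Measure.isProbabilityMeasure_map hYb.aemeasurable
  refine ext_of_generate_finite _ generateFrom_pi.symm isPiSystem_pi ?_ ?_
  · rintro _ ⟨B, hB, rfl⟩
    exact box B fun k => hB k trivial
  · have := box (fun _ => Set.univ) fun _ => MeasurableSet.univ
    simpa only [Set.pi_univ] using this

end Density

/-! ### Quantized observations -/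

section Quantized

variable {Ω 𝒳 : Type*} [MeasurableSpace Ω] [MeasurableSpace 𝒳] {d N : ℕ}
  {P : Measure Ω} [IsProbabilityMeasure P] {Q : Kernel 𝒳 𝒳} [IsMarkovKernel Q]
  {G : Kernel 𝒳 (Obs d)} [IsMarkovKernel G] {X : ℤ → Ω → 𝒳} {Y : ℤ → Ω → Obs d}
  {𝒴 : Set (Obs d)} {g : 𝒳 → Obs d → ℝ} {gm gp : ℝ} {Ξ : Type*}

lemma Quantizer.exists_mem_cell (q : Quantizer 𝒴 Ξ N) {y : Obs d} (hy : y ∈ 𝒴) :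
    ∃ j, y ∈ q.cell j := by
  rw [← q.iUnion_cell] at hy
  exact Set.mem_iUnion.1 hy

lemma Quantizer.quant_eq_point_iff (q : Quantizer 𝒴 Ξ N) {y : Obs d} (hy : y ∈ 𝒴) (j : Fin N) :
    q.quant y = q.point j ↔ y ∈ q.cell j := by
  refine ⟨fun h => ?_, q.quant_eq j y⟩
  obtain ⟨j', hj'⟩ := q.exists_mem_cell hy
  rw [q.quant_eq j' y hj'] at h
  rwa [← q.point_injective h]

/-- On `𝒴` a quantized value determines its cell, as the points are distinct; outside `𝒴` the
quantizer is arbitrary, hence the condition `hY`. The event becomes a cylinder with the cells as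
sides. -/
lemma quantProb_block (h : IsStationaryHMM P Q G X Y) (hY : ∀ k ω, Y k ω ∈ 𝒴)
    (q : Quantizer 𝒴 Ξ N) {w : ℤ → Obs d} {idx : ℤ → Fin N} (hidx : ∀ t, w t ∈ q.cell (idx t))
    (a : ℤ) (n : ℕ) :
    quantProb P Y q n (block (fun t => q.quant (w t)) a n) =
      pathMass Q (P.map (X 0)) (fun t x => (G x).real (q.cell (idx t))) a n := by
  rw [← real_obs_cylinder h (fun t => q.measurableSet_cell (idx t)) n a 1, quantProb]
  congr 1
  ext ω
  simp only [Set.mem_ofPred_eq, block]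
  constructor
  · intro hω j hj
    have := hω ⟨j, hj⟩
    rw [q.quant_eq _ _ (hidx _)] at this
    exact (q.quant_eq_point_iff (hY _ _) _).1 this
  · intro hω k
    rw [q.quant_eq _ _ (hidx _)]
    exact q.quant_eq _ _ (hω k k.2)

/-- Integrating the bounds on `g` over a cell gives the same `gm` and `gp`, with the volume of the
cell as scale. This is the source of the uniformity in `N`. -/
lemma comparable_cell (hfin : volume 𝒴 ≠ ∞)
    (hG : ∀ x, G x = ((volume : Measure (Obs d)).restrict 𝒴).withDensity
      fun y => ENNReal.ofReal (g x y))
    (hle : ∀ x, ∀ y ∈ 𝒴, gm ≤ g x y ∧ g x y ≤ gp) (hgm : 0 < gm) (hgp : 0 < gp)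
    (q : Quantizer 𝒴 Ξ N) (idx : ℤ → Fin N) :
    Comparable gm gp fun t x => (G x).real (q.cell (idx t)) := by
  intro t
  set S := q.cell (idx t) with hS
  have hSm : MeasurableSet S := q.measurableSet_cell _
  have hsub : S ⊆ 𝒴 := by
    rw [← q.iUnion_cell]
    exact Set.subset_iUnion _ _
  have hSfin : volume S ≠ ∞ := measure_ne_top_of_subset hsub hfin
  have hc : 0 < volume.real S := ENNReal.toReal_pos (q.volume_cell_ne_zero _) hSfin
  refine ⟨(G.measurable_coe hSm).ennreal_toReal, volume.real S, hc, fun x => ?_⟩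
  have e : G x S = ∫⁻ y in S, ENNReal.ofReal (g x y) := by
    rw [hG, withDensity_apply _ hSm, Measure.restrict_restrict hSm,
      Set.inter_eq_self_of_subset_left hsub]
  have hconst : ∀ c : ℝ, 0 < c → volume.real S * c = (∫⁻ _y in S, ENNReal.ofReal c).toReal :=
    fun c hc => by
      rw [setLIntegral_const, ENNReal.toReal_mul, ENNReal.toReal_ofReal hc.le, mul_comm,
        measureReal_def]
  have h1 : ∫⁻ _y in S, ENNReal.ofReal gm ≤ G x S := by
    rw [e]
    exact setLIntegral_mono' hSm fun y hy => ENNReal.ofReal_le_ofReal (hle x y (hsub hy)).1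
  have h2 : G x S ≤ ∫⁻ _y in S, ENNReal.ofReal gp := by
    rw [e]
    exact setLIntegral_mono' hSm fun y hy => ENNReal.ofReal_le_ofReal (hle x y (hsub hy)).2
  rw [hconst gm hgm, hconst gp hgp]
  refine ⟨ENNReal.toReal_mono (measure_ne_top _ _) h1, ENNReal.toReal_mono ?_ h2⟩
  rw [setLIntegral_const]
  exact ENNReal.mul_ne_top ENNReal.ofReal_ne_top hSfin

end Quantized

/-! ### Gradients of the log-densities -/

section Gradient

variable {Ω 𝒳 : Type*} [MeasurableSpace Ω] [MeasurableSpace 𝒳] {d : ℕ}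
  {P : Measure Ω} [IsProbabilityMeasure P] {Q : Kernel 𝒳 𝒳} [IsMarkovKernel Q]
  {G : Kernel 𝒳 (Obs d)} [IsMarkovKernel G] {X : ℤ → Ω → 𝒳} {Y : ℤ → Ω → Obs d}
  {𝒴 : Set (Obs d)} {g : 𝒳 → Obs d → ℝ} {gm gp : ℝ}

lemma norm_le_of_abs_apply_le {v : Obs d} {C : ℝ} (h : ∀ e, |v e| ≤ C) : ‖v‖ ≤ d * C := by
  conv_lhs => rw [sum_smul_stdVec v]
  refine (norm_sum_le _ _).trans ?_
  refine (Finset.sum_le_sum fun e _ => (?_ : ‖v e • stdVec e‖ ≤ C)).trans (by simp)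
  rw [norm_smul, norm_stdVec, mul_one]
  exact h e

lemma gradientWithin_apply (f : Obs d → ℝ) (S : Set (Obs d)) (y : Obs d) (e : Fin d) :
    gradientWithin f S y e = dirDeriv S (stdVec e) f y := by
  have h1 : inner ℝ (gradientWithin f S y) (stdVec e) = fderivWithin ℝ f S y (stdVec e) := by
    rw [gradientWithin, InnerProductSpace.toDual_symm_apply]
  rw [dirDeriv, ← h1, stdVec, EuclideanSpace.inner_single_right]
  simp

lemma block_update_of_mem {α : Type*} (w : ℤ → α) (a : ℤ) (n : ℕ) (z : α) (k : Fin n)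
    (hk : a + (k : ℤ) = 0) :
    block (Function.update w 0 z) a n = Function.update (block w a n) k z := by
  ext j
  rcases eq_or_ne j k with rfl | hj
  · simp [block, hk]
  · rw [Function.update_of_ne hj, block, block, Function.update_of_ne]
    intro h
    exact hj (Fin.ext (by omega))

lemma block_update_of_notMem {α : Type*} (w : ℤ → α) (a : ℤ) (n : ℕ) (z : α)
    (hn : a + n ≤ 0) : block (Function.update w 0 z) a n = block w a n := by
  ext j
  rw [block, block, Function.update_of_ne]
  have := j.2
  omega

/-- The weights in which the density at time `0` is replaced by its partial derivative. -/
noncomputable def gradWeight (𝒴 : Set (Obs d)) (g : 𝒳 → Obs d → ℝ) (w : ℤ → Obs d) (e : Fin d) :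
    ℤ → 𝒳 → ℝ :=
  Function.update (fun t x => g x (w t)) 0 fun x => dirDeriv 𝒴 (stdVec e) (g x) (w 0)

lemma gradWeight_of_ne (w : ℤ → Obs d) (e : Fin d) (t : ℤ) (ht : t ≠ 0) :
    gradWeight 𝒴 g w e t = fun x => g x (w t) := by
  rw [gradWeight, Function.update_of_ne ht]

lemma gradWeight_zero (w : ℤ → Obs d) (e : Fin d) :
    gradWeight 𝒴 g w e 0 = fun x => dirDeriv 𝒴 (stdVec e) (g x) (w 0) := by
  rw [gradWeight, Function.update_self]

lemma Tame.bddMeas (hg : Tame 𝒴 0 g) {y : Obs d} (hy : y ∈ 𝒴) : BddMeas fun x => g x y :=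
  ⟨hg.2.1 y hy, hg.2.2.choose, fun x => hg.2.2.choose_spec x y hy⟩

lemma Tame.bddMeas_gradWeight (hg : Tame 𝒴 3 g) {w : ℤ → Obs d} (hw : ∀ t, w t ∈ 𝒴) (e : Fin d)
    (t : ℤ) : BddMeas (gradWeight 𝒴 g w e t) := by
  rcases eq_or_ne t 0 with rfl | ht
  · rw [gradWeight_zero]
    exact (hg.2.2.2 e).zero.bddMeas (hw 0)
  · rw [gradWeight_of_ne w e t ht]
    exact hg.zero.bddMeas (hw t)

/-- The logarithm of the density of a block is differentiable in the observation at time `0`. -/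
lemma hasFDerivWithinAt_log_block (h : IsStationaryHMM P Q G X Y) (hconv : Convex ℝ 𝒴)
    (hg : Tame 𝒴 3 g) (hgm : 0 < gm) (hle : ∀ x, ∀ y ∈ 𝒴, gm ≤ g x y)
    {w : ℤ → Obs d} (hw : ∀ t, w t ∈ 𝒴) (n j : ℕ) :
    ∃ L : Obs d →L[ℝ] ℝ, HasFDerivWithinAt (fun z => Real.log (pathExp P X (fun _ => g)
        (block (Function.update w 0 z) (-n) (n + (1 + j))))) L 𝒴 (w 0) ∧
      ∀ e, L (stdVec e) = pathMass Q (P.map (X 0)) (gradWeight 𝒴 g w e) (-n) (n + (1 + j)) /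
        pathMass Q (P.map (X 0)) (fun t x => g x (w t)) (-n) (n + (1 + j)) := by
  let k : Fin (n + (1 + j)) := ⟨n, by omega⟩
  have hk : -(n : ℤ) + ((k : ℕ) : ℤ) = 0 := by simp [k]
  have g1 : Tame 𝒴 1 g := hg.of_succ.of_succ
  set y := block w (-(n : ℤ)) (n + (1 + j)) with hy
  have hyb : y ∈ blocks 𝒴 (n + (1 + j)) := fun i _ => hw _
  have hyk : y k = w 0 := by rw [hy, block, hk]
  have hX := h.measurable_state
  have hD := hasFDerivWithinAt_pathExp (P := P) (X := X) (h := fun _ => g) hX hconv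
    (fun _ => g1) hyb
  have hupd : HasFDerivWithinAt (Function.update y k) _ 𝒴 (w 0) :=
    (hasFDerivAt_update (𝕜 := ℝ) y (w 0)).hasFDerivWithinAt
  have hup0 : Function.update y k (w 0) = y := by rw [← hyk, Function.update_eq_self]
  have hmaps : Set.MapsTo (Function.update y k) 𝒴 (blocks 𝒴 (n + (1 + j))) := fun z hz i _ => by
    rcases eq_or_ne i k with rfl | hi
    · rwa [Function.update_self]
    · rw [Function.update_of_ne hi]
      exact hw _
  have hcomp := HasFDerivWithinAt.comp (w 0) (hup0.symm ▸ hD) hupd hmaps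
  have hpos : 0 < pathExp P X (fun _ => g) y := pathExp_pos hX hg.zero hgm hle hyb
  have hlog := hcomp.log (by rw [Function.comp_apply, hup0]; exact hpos.ne')
  refine ⟨_, hlog.congr_of_eventuallyEq ?_ ?_, fun e => ?_⟩
  · refine Eventually.of_forall fun z => ?_
    simp only [Function.comp_apply]
    rw [block_update_of_mem w _ _ z k hk]
  · simp only [Function.comp_apply]
    rw [block_update_of_mem w _ _ (w 0) k hk]
  · simp only [smul_apply, ContinuousLinearMap.comp_apply, Function.comp_apply, hup0, smul_eq_mul]
    have hs : ContinuousLinearMap.pi (Pi.single k (ContinuousLinearMap.id ℝ (Obs d))) (stdVec e) =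
        (Pi.single k (stdVec e) : Fin (n + (1 + j)) → Obs d) := by
      ext1 i
      rcases eq_or_ne i k with rfl | hi
      · simp
      · simp [hi]
    rw [hs, pathDeriv_single, ← div_eq_inv_mul,
      pathExp_block h (fun t => hg.zero.bddMeas (hw t)) fun i x => rfl,
      pathExp_block h (hg.bddMeas_gradWeight hw e) fun i x => ?_]
    rcases eq_or_ne i k with rfl | hi
    · rw [diffAt, Function.update_self, hk, gradWeight_zero]
    · rw [diffAt, Function.update_of_ne hi, gradWeight_of_ne]
      intro h0
      exact hi (Fin.ext (by omega))

lemma log_condDens_update (h : IsStationaryHMM P Q G X Y)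
    (hg : Tame 𝒴 3 g) (hgm : 0 < gm) (hle : ∀ x, ∀ y ∈ 𝒴, gm ≤ g x y)
    {w : ℤ → Obs d} (hw : ∀ t, w t ∈ 𝒴) (a b : ℤ) (l n : ℕ) (hb : b = a + l) {z : Obs d}
    (hz : z ∈ 𝒴) :
    Real.log (condDens (fun n => pathExp P X fun _ : Fin n => g) l n
        (block (Function.update w 0 z) a l) (block (Function.update w 0 z) b n)) =
      Real.log (pathExp P X (fun _ => g) (block (Function.update w 0 z) a (l + n))) -
        Real.log (pathExp P X (fun _ => g) (block (Function.update w 0 z) a l)) := by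
  have hw' : ∀ t, Function.update w 0 z t ∈ 𝒴 := fun t => by
    rcases eq_or_ne t 0 with rfl | ht
    · rwa [Function.update_self]
    · rw [Function.update_of_ne ht]
      exact hw t
  have hpos : ∀ a n, 0 < pathExp P X (fun _ => g) (block (Function.update w 0 z) a n) :=
    fun a n => pathExp_pos h.measurable_state hg.zero hgm hle fun j _ => hw' _
  rw [condDens_block (M := fun a n => pathExp P X (fun _ => g)
    (block (Function.update w 0 z) a n)) (fun _ _ => rfl) (fun a => by simp [pathExp]) a b l n hb,
    Real.log_div (hpos _ _).ne' (hpos _ _).ne']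

/-- The density of the past does not involve `y_0`, so only the logarithm of the joint density
contributes. -/
lemma gradZero_log_condDens_apply (h : IsStationaryHMM P Q G X Y) (hconv : Convex ℝ 𝒴)
    (hS : UniqueDiffOn ℝ 𝒴)
    (hg : Tame 𝒴 3 g) (hgm : 0 < gm) (hle : ∀ x, ∀ y ∈ 𝒴, gm ≤ g x y)
    {w : ℤ → Obs d} (hw : ∀ t, w t ∈ 𝒴) (n j : ℕ) (e : Fin d) :
    gradZero 𝒴 (fun y => Real.log (condDens (fun n => pathExp P X fun _ : Fin n => g) n (j + 1)
        (block y (-(n : ℤ)) n) (block y 0 (j + 1)))) w e =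
      pathMass Q (P.map (X 0)) (gradWeight 𝒴 g w e) (-n) (n + (1 + j)) /
        pathMass Q (P.map (X 0)) (fun t x => g x (w t)) (-n) (n + (1 + j)) := by
  obtain ⟨L, hL, hLe⟩ := hasFDerivWithinAt_log_block h hconv hg hgm hle hw n j
  rw [gradZero, gradientWithin_apply, ← hLe]
  rw [add_comm 1 j] at hL
  refine HasFDerivWithinAt.dirDeriv ?_ (hS _ (hw 0)) _
  refine (hL.sub_const (Real.log (pathExp P X (fun _ => g) (block w (-n) n)))).congr
    (fun z hz => ?_) ?_
  · rw [log_condDens_update h hg hgm hle hw _ _ _ _ (by simp) hz,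
      block_update_of_notMem w (-n) n z (by simp)]
  · rw [log_condDens_update h hg hgm hle hw _ _ _ _ (by simp) (hw 0),
      block_update_of_notMem w (-n) n _ (by simp)]

/-- Here `y_0` occurs in the numerator and in the denominator of the conditional density, which
produces the difference of the ratios for futures of lengths `j + 1` and `j`. -/
lemma gradZero_log_condDens_future_apply (h : IsStationaryHMM P Q G X Y) (hconv : Convex ℝ 𝒴)
    (hS : UniqueDiffOn ℝ 𝒴)
    (hg : Tame 𝒴 3 g) (hgm : 0 < gm) (hle : ∀ x, ∀ y ∈ 𝒴, gm ≤ g x y)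
    {w : ℤ → Obs d} (hw : ∀ t, w t ∈ 𝒴) (n j : ℕ) (e : Fin d) :
    gradZero 𝒴 (fun y => Real.log (condDens (fun n => pathExp P X fun _ : Fin n => g)
        (n + (j + 1)) 1 (block y (-(n : ℤ)) (n + (j + 1))) (block y ((j + 1 : ℕ) : ℤ) 1))) w e =
      pathMass Q (P.map (X 0)) (gradWeight 𝒴 g w e) (-n) (n + (1 + (j + 1))) /
          pathMass Q (P.map (X 0)) (fun t x => g x (w t)) (-n) (n + (1 + (j + 1))) -
        pathMass Q (P.map (X 0)) (gradWeight 𝒴 g w e) (-n) (n + (1 + j)) /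
          pathMass Q (P.map (X 0)) (fun t x => g x (w t)) (-n) (n + (1 + j)) := by
  obtain ⟨L, hL, hLe⟩ := hasFDerivWithinAt_log_block h hconv hg hgm hle hw n j
  obtain ⟨L', hL', hLe'⟩ := hasFDerivWithinAt_log_block h hconv hg hgm hle hw n (j + 1)
  rw [gradZero, gradientWithin_apply, ← hLe, ← hLe', ← sub_apply]
  rw [add_comm 1 j] at hL
  rw [show n + (1 + (j + 1)) = n + (j + 1) + 1 by ring] at hL'
  refine HasFDerivWithinAt.dirDeriv ?_ (hS _ (hw 0)) _
  refine (hL'.fun_sub hL).congr (fun z hz => ?_) ?_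
  · rw [log_condDens_update h hg hgm hle hw _ _ _ _ (by push_cast; ring) hz]
  · rw [log_condDens_update h hg hgm hle hw _ _ _ _ (by push_cast; ring) (hw 0)]

end Gradient

/-! ### Geometric sequences -/

lemma exists_geometric_le {r : ℝ} (hr0 : 0 ≤ r) (hr1 : r < 1) {m : ℕ} (hm : 1 ≤ m) {c : ℝ}
    (hc : 0 ≤ c) : ∃ C : ℝ, 0 < C ∧ ∀ n : ℕ, c * r ^ (n / m) ≤ C / (1 + (n : ℝ)) ^ 7 := by
  have hlim := tendsto_pow_const_mul_const_pow_of_abs_lt_one 7 (abs_lt.2 ⟨by linarith, hr1⟩)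
  obtain ⟨B, hB⟩ := hlim.bddAbove_range
  have hB' : ∀ j : ℕ, (j : ℝ) ^ 7 * r ^ j ≤ B := fun j => hB ⟨j, rfl⟩
  have hB0 : 0 ≤ B := le_trans (by positivity) (hB' 0)
  -- With `j = n / m` one has `1 + n ≤ m (j + 1)`, and `2 ^ 6` comes from the convexity of the
  -- seventh power. The summand `1` keeps the constant positive when `c = 0`.
  refine ⟨c * (m ^ 7 * (2 ^ 6 * (B + 1))) + 1, by positivity, fun n => ?_⟩
  set j := n / m with hj
  have h1 : 1 + (n : ℝ) ≤ m * (j + 1) := by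
    have : n + 1 ≤ m * (j + 1) := Nat.lt_mul_div_succ n hm
    have h2 : ((n + 1 : ℕ) : ℝ) ≤ ((m * (j + 1) : ℕ) : ℝ) := by exact_mod_cast this
    push_cast at h2
    linarith
  have h2 : ((j : ℝ) + 1) ^ 7 ≤ 2 ^ 6 * (j ^ 7 + 1) := by
    simpa using add_pow_le (Nat.cast_nonneg j : (0 : ℝ) ≤ j) zero_le_one 7
  have hrj : 0 ≤ r ^ j := pow_nonneg hr0 _
  have hrj1 : r ^ j ≤ 1 := pow_le_one₀ hr0 hr1.le
  rw [le_div_iff₀ (by positivity)]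
  calc c * r ^ j * (1 + (n : ℝ)) ^ 7 ≤ c * r ^ j * (m * (j + 1)) ^ 7 := by gcongr
    _ = c * (m ^ 7 * (((j : ℝ) + 1) ^ 7 * r ^ j)) := by ring
    _ ≤ c * (m ^ 7 * (2 ^ 6 * (j ^ 7 + 1) * r ^ j)) := by gcongr
    _ = c * (m ^ 7 * (2 ^ 6 * (j ^ 7 * r ^ j + r ^ j))) := by ring
    _ ≤ c * (m ^ 7 * (2 ^ 6 * (B + 1))) := by
        have := hB' j
        gcongr
    _ ≤ _ := by linarith

lemma summable_geometric_div {r : ℝ} (hr0 : 0 ≤ r) (hr1 : r < 1) {m : ℕ} (hm : 1 ≤ m) {c : ℝ}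
    (hc : 0 ≤ c) : Summable fun n : ℕ => c * r ^ (n / m) := by
  obtain ⟨C, hC, hle⟩ := exists_geometric_le hr0 hr1 hm hc
  have h1 : Summable fun n : ℕ => C / (((n + 1 : ℕ) : ℝ)) ^ 7 := by
    have : Summable fun n : ℕ => C / (n : ℝ) ^ 7 := by
      simpa only [div_eq_mul_inv, one_mul] using
        (Real.summable_one_div_nat_pow.2 (by norm_num : 1 < 7)).mul_left C
    exact (summable_nat_add_iff 1).2 this
  refine Summable.of_nonneg_of_le (fun n => by positivity) (fun n => ?_) h1
  push_cast
  rw [add_comm (n : ℝ)]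
  exact hle n

/-! ### Transition densities -/

lemma minorized_of_density {𝒳 : Type*} [MeasurableSpace 𝒳] {Q : Kernel 𝒳 𝒳} {ref : Measure 𝒳}
    [IsProbabilityMeasure ref] {m : ℕ} {q : 𝒳 → 𝒳 → ℝ} (hq : Measurable (Function.uncurry q))
    (hQ : ∀ x, (Q ^ m) x = ref.withDensity fun x' => ENNReal.ofReal (q x x')) {σm σp : ℝ}
    (hσm : 0 < σm) (hσ : ∀ x x', σm ≤ q x x' ∧ q x x' ≤ σp) : Minorized Q ref m σm σp := by
  intro h hh h0 x
  have hqx : BddMeas (q x) := ⟨hq.comp measurable_prodMk_left, σp, fun x' => by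
    rw [abs_of_nonneg (hσm.le.trans (hσ x x').1)]
    exact (hσ x x').2⟩
  have e : ∫ x', h x' ∂((Q ^ m) x) = ∫ x', q x x' * h x' ∂ref := by
    rw [hQ, integral_withDensity_eq_integral_toReal_smul hqx.1.ennreal_ofReal
      (Eventually.of_forall fun _ => ENNReal.ofReal_lt_top)]
    refine integral_congr_ae (Eventually.of_forall fun x' => ?_)
    simp only [smul_eq_mul]
    rw [ENNReal.toReal_ofReal (hσm.le.trans (hσ x x').1)]
  rw [e, ← integral_const_mul, ← integral_const_mul]
  exact ⟨integral_mono ((hh.const_mul _).integrable _) ((hqx.mul hh).integrable _) fun x' =>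
      mul_le_mul_of_nonneg_right (hσ x x').1 (h0 x'),
    integral_mono ((hqx.mul hh).integrable _) ((hh.const_mul _).integrable _) fun x' =>
      mul_le_mul_of_nonneg_right (hσ x x').2 (h0 x')⟩

lemma rate_mem {m : ℕ} {σm σp gm gp : ℝ} (hσm : 0 < σm) (hσ : σm ≤ σp) (hgm : 0 < gm)
    (hg : gm ≤ gp) : 0 ≤ rate m σm σp gm gp ∧ rate m σm σp gm gp < 1 := by
  have hσp := hσm.trans_le hσ
  have hgp := hgm.trans_le hg
  have h1 : gm ^ m * σm / (gp ^ m * σp) ≤ 1 := by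
    rw [div_le_one (by positivity)]
    gcongr
  have h2 : 0 < gm ^ m * σm / (gp ^ m * σp) := by positivity
  unfold rate
  constructor <;> linarith

/-- The frontier of a convex set is Lebesgue-null, and without interior points the closure is the
frontier. -/
lemma interior_nonempty_of_volume_ne_zero {d : ℕ} {𝒴 : Set (Obs d)} (hconv : Convex ℝ 𝒴)
    (h : volume 𝒴 ≠ 0) : (interior 𝒴).Nonempty := by
  by_contra hne
  rw [Set.not_nonempty_iff_eq_empty] at hne
  have h1 := hconv.addHaar_frontier (volume : Measure (Obs d))
  rw [frontier, hne, Set.sdiff_empty] at h1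
  exact h (measure_mono_null subset_closure h1)

/-! ### Gradients: bounds in mean -/

lemma lintegral_enorm_le_of_norm_le {Ω E : Type*} [MeasurableSpace Ω] [NormedAddCommGroup E]
    {P : Measure Ω} [IsProbabilityMeasure P] {f : Ω → E} {C : ℝ≥0} (h : ∀ ω, ‖f ω‖ ≤ C) :
    ∫⁻ ω, ‖f ω‖ₑ ∂P ≤ C := by
  calc ∫⁻ ω, ‖f ω‖ₑ ∂P ≤ ∫⁻ _ω, (C : ℝ≥0∞) ∂P := lintegral_mono fun ω => by
        rw [enorm_le_coe]
        exact h ω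
    _ = C := by simp

section Gradient

variable {Ω 𝒳 : Type*} [MeasurableSpace Ω] [MeasurableSpace 𝒳] {d : ℕ}
  {P : Measure Ω} [IsProbabilityMeasure P] {Q : Kernel 𝒳 𝒳} [IsMarkovKernel Q]
  {G : Kernel 𝒳 (Obs d)} [IsMarkovKernel G] {X : ℤ → Ω → 𝒳} {Y : ℤ → Ω → Obs d}
  {𝒴 : Set (Obs d)} {g : 𝒳 → Obs d → ℝ} {ref : Measure 𝒳} [IsProbabilityMeasure ref]
  {m : ℕ} {σm σp gm gp : ℝ}

lemma abs_gradWeight_le {K : ℝ} (hK : ∀ e x, ∀ y ∈ 𝒴, |dirDeriv 𝒴 (stdVec e) (g x) y| ≤ K * g x y)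
    {w : ℤ → Obs d} (hw : ∀ t, w t ∈ 𝒴) (e : Fin d) (x : 𝒳) :
    |gradWeight 𝒴 g w e 0 x| ≤ K * g x (w 0) := by
  rw [gradWeight_zero]
  exact hK e x _ (hw 0)

lemma norm_gradZero_sub_le (h : IsStationaryHMM P Q G X Y) (hconv : Convex ℝ 𝒴)
    (hS : UniqueDiffOn ℝ 𝒴) (hM : MixingBounds Q ref m σm σp gm gp)
    (hg : Tame 𝒴 3 g) (hle : ∀ x, ∀ y ∈ 𝒴, gm ≤ g x y ∧ g x y ≤ gp) {K : ℝ}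
    (hK : ∀ e x, ∀ y ∈ 𝒴, |dirDeriv 𝒴 (stdVec e) (g x) y| ≤ K * g x y)
    {w : ℤ → Obs d} (hw : ∀ t, w t ∈ 𝒴) {n n' : ℕ} (hn : n ≤ n') (j : ℕ) :
    ‖gradZero 𝒴 (fun y => Real.log (condDens (fun n => pathExp P X fun _ : Fin n => g) n (j + 1)
        (block y (-(n : ℤ)) n) (block y 0 (j + 1)))) w -
      gradZero 𝒴 (fun y => Real.log (condDens (fun n => pathExp P X fun _ : Fin n => g) n' (j + 1)
        (block y (-(n' : ℤ)) n') (block y 0 (j + 1)))) w‖ ≤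
      d * (2 * K) * rate m σm σp gm gp ^ (n / m) := by
  obtain ⟨l, rfl⟩ := Nat.exists_eq_add_of_le' hn
  have := isProbabilityMeasure_state h
  have hle' : ∀ x, ∀ y ∈ 𝒴, gm ≤ g x y := fun x y hy => (hle x y hy).1
  rw [mul_assoc]
  refine norm_le_of_abs_apply_le fun e => ?_
  rw [PiLp.sub_apply, gradZero_log_condDens_apply h hconv hS hg hM.gm_pos hle' hw,
    gradZero_log_condDens_apply h hconv hS hg hM.gm_pos hle' hw]
  have := abs_modif_ratio_sub_past_le (π₀ := P.map (X 0)) hM (comparable_obs hg.zero.2.1 hle hw)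
    (gradWeight_of_ne w e) (hg.bddMeas_gradWeight hw e 0) (abs_gradWeight_le hK hw e) l n j
  simpa only [zero_sub] using this

lemma norm_gradZero_future_le (h : IsStationaryHMM P Q G X Y) (hconv : Convex ℝ 𝒴)
    (hS : UniqueDiffOn ℝ 𝒴) (hM : MixingBounds Q ref m σm σp gm gp)
    (hg : Tame 𝒴 3 g) (hle : ∀ x, ∀ y ∈ 𝒴, gm ≤ g x y ∧ g x y ≤ gp) {K : ℝ} (hK0 : 0 ≤ K)
    (hK : ∀ e x, ∀ y ∈ 𝒴, |dirDeriv 𝒴 (stdVec e) (g x) y| ≤ K * g x y)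
    {w : ℤ → Obs d} (hw : ∀ t, w t ∈ 𝒴) (n k : ℕ) (hr : 0 ≤ rate m σm σp gm gp) :
    ‖gradZero 𝒴 (fun y => Real.log (condDens (fun n => pathExp P X fun _ : Fin n => g)
        (n + k) 1 (block y (-(n : ℤ)) (n + k)) (block y k 1))) w‖ ≤
      d * (2 * K * ((gp - gm) / gm) + K) * rate m σm σp gm gp ^ ((k - 1) / m) := by
  have := isProbabilityMeasure_state h
  have hle' : ∀ x, ∀ y ∈ 𝒴, gm ≤ g x y := fun x y hy => (hle x y hy).1
  have hf := comparable_obs hg.zero.2.1 hle hw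
  have hgm := hM.gm_pos
  have hgg : 0 ≤ (gp - gm) / gm := div_nonneg (sub_nonneg.2 hM.gm_le) hgm.le
  rw [mul_assoc]
  refine norm_le_of_abs_apply_le fun e => ?_
  cases k with
  -- At `k = 0` there is nothing to forget: the conditional mean is bounded by `K`, whence the
  -- summand `K` in the constant. Truncated subtraction makes the exponent `0`.
  | zero =>
    have h1 := gradZero_log_condDens_apply h hconv hS hg hM.gm_pos hle' hw n 0 e
    have h2 := abs_modif_ratio_le (Q := Q) (π₀ := P.map (X 0)) hgm hf (gradWeight_of_ne w e)
      (hg.bddMeas_gradWeight hw e 0) (abs_gradWeight_le hK hw e) n 0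
    rw [zero_sub, ← h1] at h2
    refine h2.trans ?_
    simp only [zero_tsub, Nat.zero_div, pow_zero, mul_one]
    have : 0 ≤ 2 * K * ((gp - gm) / gm) := by positivity
    linarith
  | succ j =>
    rw [gradZero_log_condDens_future_apply h hconv hS hg hM.gm_pos hle' hw]
    have := abs_modif_ratio_sub_future_le (π₀ := P.map (X 0)) hM hf (gradWeight_of_ne w e)
      (hg.bddMeas_gradWeight hw e 0) (abs_gradWeight_le hK hw e) n j
    rw [zero_sub] at this
    refine this.trans ?_
    rw [Nat.add_sub_cancel, add_mul]
    have : 0 ≤ K * rate m σm σp gm gp ^ (j / m) := by positivity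
    linarith

end Gradient

/-! ### Convergence of the conditional log-densities -/

section Converge

variable {Ω 𝒳 : Type*} [MeasurableSpace Ω] [MeasurableSpace 𝒳] {α : Type*} [MeasurableSpace α]
  {P₀ : Measure Ω} [IsProbabilityMeasure P₀] {p : ∀ n : ℕ, (Fin n → α) → ℝ} {W : ℤ → Ω → α}

lemma measurable_logCond (hp : ∀ n, Measurable (p n)) (hW : ∀ k, Measurable (W k)) (n : ℕ) :
    Measurable fun ω => logCond p n fun k => W k ω := by
  have hb : ∀ (a : ℤ) n, Measurable fun ω => block (fun k => W k ω) a n := fun a n =>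
    measurable_pi_lambda _ fun j => hW _
  unfold logCond condDens
  split_ifs with h
  · exact ((hp 1).comp (hb 0 1)).log
  · have happ : Measurable fun ω => Fin.append (block (fun k => W k ω) (-(n : ℤ)) n)
        (block (fun k => W k ω) 0 1) := by
      simp only [append_block _ (-(n : ℤ)) 0 n 1 (by simp)]
      exact hb _ _
    exact (((hp (n + 1)).comp happ).div ((hp n).comp (hb _ _))).log

/-- The Cauchy estimate is uniform in `ω`, so a limit exists everywhere and convergence in mean
follows from the uniform bound. -/
lemma exists_limit_logCond (hp : ∀ n, Measurable (p n)) (hW : ∀ k, Measurable (W k))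
    {B : ℝ} (hB : ∀ n ω, |logCond p n fun k => W k ω| ≤ B) {b : ℕ → ℝ}
    (hb : Tendsto b atTop (𝓝 0))
    (hle : ∀ n n' ω, n ≤ n' →
      |logCond p n (fun k => W k ω) - logCond p n' fun k => W k ω| ≤ b n) :
    ∃ L : Ω → ℝ, Integrable L P₀ ∧ Tendsto (fun n : ℕ =>
      ∫⁻ ω, ‖logCond p n (fun k => W k ω) - L ω‖ₑ ∂P₀) atTop (𝓝 0) := by
  have hcauchy : ∀ ω, CauchySeq fun n => logCond p n fun k => W k ω := fun ω =>
    cauchySeq_of_le_tendsto_0' b (fun n n' hn => by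
      rw [Real.dist_eq]
      exact hle n n' ω hn) hb
  choose L hL using fun ω => cauchySeq_tendsto_of_complete (hcauchy ω)
  have hLm : Measurable L := measurable_of_tendsto_metrizable
    (fun n => measurable_logCond hp hW n) (tendsto_pi_nhds.2 hL)
  refine ⟨L, Integrable.of_bound hLm.aestronglyMeasurable B (Eventually.of_forall fun ω =>
    le_of_tendsto (hL ω).norm (Eventually.of_forall fun n => hB n ω)), ?_⟩
  have hlim : Tendsto (fun n => ENNReal.ofReal (b n)) atTop (𝓝 0) := by
    simpa [Function.comp_def] using (ENNReal.continuous_ofReal.tendsto 0).comp hb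
  refine tendsto_of_tendsto_of_tendsto_of_le_of_le tendsto_const_nhds hlim
    (fun _ => zero_le) fun n => ?_
  calc ∫⁻ ω, ‖logCond p n (fun k => W k ω) - L ω‖ₑ ∂P₀
      ≤ ∫⁻ _ω, ENNReal.ofReal (b n) ∂P₀ := by
        refine lintegral_mono fun ω => ?_
        rw [Real.enorm_eq_ofReal_abs]
        refine ENNReal.ofReal_le_ofReal ?_
        refine le_of_tendsto ((tendsto_const_nhds.sub (hL ω)).abs) ?_
        filter_upwards [eventually_ge_atTop n] with n' hn
        exact hle n n' ω hn
    _ = _ := by simp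

end Converge

end HMMDetection

/-! ### Assembly of the proposition -/

open HMMDetection

theorem proposition1 {Ω 𝒳 : Type*} [MeasurableSpace Ω] [MeasurableSpace 𝒳] {d : ℕ}
    -- the observation space
    (𝒴 : Set (HMMDetection.Obs d)) (h𝒴_meas : MeasurableSet 𝒴)
    (h𝒴_bdd : Bornology.IsBounded 𝒴) (h𝒴_conv : Convex ℝ 𝒴)
    -- the Markov transition kernels and the densities of their iterates
    (Q : Fin 2 → Kernel 𝒳 𝒳) [∀ i, IsMarkovKernel (Q i)]
    (ref : Measure 𝒳) [IsProbabilityMeasure ref]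
    (qd : Fin 2 → ℕ → 𝒳 → 𝒳 → ℝ)
    (hqd_meas : ∀ i t, 1 ≤ t → Measurable (Function.uncurry (qd i t)))
    (hqd_nonneg : ∀ i t, 1 ≤ t → ∀ x x', 0 ≤ qd i t x x')
    (hqd : ∀ i t, 1 ≤ t → ∀ x,
      (Q i ^ t) x = ref.withDensity fun x' => ENNReal.ofReal (qd i t x x'))
    (m : ℕ) (hm : 1 ≤ m) (σm σp : ℝ) (hσm : 0 < σm)
    (hσ : ∀ i x x', σm ≤ qd i m x x' ∧ qd i m x x' ≤ σp)
    -- the observation kernel and its density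
    (G : Kernel 𝒳 (HMMDetection.Obs d)) [IsMarkovKernel G]
    (g : 𝒳 → HMMDetection.Obs d → ℝ) (hg_meas : Measurable (Function.uncurry g))
    (hG : ∀ x, G x = ((volume : Measure (HMMDetection.Obs d)).restrict 𝒴).withDensity
      fun y => ENNReal.ofReal (g x y))
    (hg_bdd : ∃ gm gp : ℝ, 0 < gm ∧ ∀ x, ∀ y ∈ 𝒴, gm ≤ g x y ∧ g x y ≤ gp)
    (hg_smooth : ∀ x, ContDiffOn ℝ 3 (g x) 𝒴)
    (hg_partial3 : ∃ C : ℝ, ∀ x, ∀ y ∈ 𝒴, ∀ a b c : Fin d,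
      |HMMDetection.partial3 𝒴 (g x) a b c y| ≤ C)
    -- the hidden Markov process under the two hypotheses
    (P : Fin 2 → Measure Ω) [∀ i, IsProbabilityMeasure (P i)]
    (X : ℤ → Ω → 𝒳) (Y : ℤ → Ω → HMMDetection.Obs d) (hY : ∀ k ω, Y k ω ∈ 𝒴)
    (hHMM : ∀ i, HMMDetection.IsStationaryHMM (P i) (Q i) G X Y) :
    (∀ i, Ergodic HMMDetection.shift ((P i).map fun ω k => Y k ω)) ∧
    ∃ p : Fin 2 → ∀ n : ℕ, (Fin n → HMMDetection.Obs d) → ℝ,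
      HMMDetection.DensityAssumption 𝒴 P Y p ∧
      HMMDetection.LogCondConverges P Y p ∧
      ∀ (Ξ : Type*) (q : ∀ N : ℕ, 2 ≤ N → HMMDetection.Quantizer 𝒴 Ξ N),
        HMMDetection.LossAssumption 𝒴 P Y p q := by 
  have hm0 : m ≠ 0 := by omega
  have h𝒳 : Nonempty 𝒳 := nonempty_of_isProbabilityMeasure ref
  have hΩ : Nonempty Ω := nonempty_of_isProbabilityMeasure (P 0)
  obtain ⟨x₀⟩ := h𝒳
  obtain ⟨ω₀⟩ := hΩ
  obtain ⟨gm, gp, hgm, hle⟩ := hg_bdd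
  obtain ⟨C₃, hC₃⟩ := hg_partial3
  have hgmp : gm ≤ gp := (hle x₀ _ (hY 0 ω₀)).1.trans (hle x₀ _ (hY 0 ω₀)).2
  have hgp : 0 < gp := hgm.trans_le hgmp
  have hσmp : σm ≤ σp := (hσ 0 x₀ x₀).1.trans (hσ 0 x₀ x₀).2
  have hσp : 0 < σp := hσm.trans_le hσmp
  -- A null set `𝒴` could not carry the probability measure `G x₀`.
  have hvol : volume 𝒴 ≠ 0 := fun h0 => by
    have h1 : G x₀ = 0 := by
      rw [hG, Measure.restrict_eq_zero.2 h0, withDensity_zero_left]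
    exact IsProbabilityMeasure.ne_zero (G x₀) h1
  have hfin : volume 𝒴 ≠ ∞ := h𝒴_bdd.measure_lt_top.ne
  have hint : (interior 𝒴).Nonempty := interior_nonempty_of_volume_ne_zero h𝒴_conv hvol
  have hS : UniqueDiffOn ℝ 𝒴 := uniqueDiffOn_convex h𝒴_conv hint
  have hle' : ∀ x, ∀ y ∈ 𝒴, gm ≤ g x y := fun x y hy => (hle x y hy).1
  have hg : Tame 𝒴 3 g := tame_three h𝒴_bdd h𝒴_conv hint hS hg_smooth
    (fun y _ => hg_meas.comp measurable_prodMk_right) (A := gp) (C := C₃)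
    (fun x y hy => by
      rw [abs_of_pos (hgm.trans_le (hle' x y hy))]
      exact (hle x y hy).2) fun x y hy a b c => hC₃ x y hy a b c
  have hMin : ∀ i, Minorized (Q i) ref m σm σp := fun i =>
    minorized_of_density (hqd_meas i m hm) (hqd i m hm) hσm (hσ i)
  have hM : ∀ i, MixingBounds (Q i) ref m σm σp gm gp := fun i =>
    ⟨hσm, hσp, hgm, hgmp, hMin i⟩
  -- Mixing uses the chain without observation weights, hence `gm = gp = 1` and a rate of its own.
  have hM1 : ∀ i, MixingBounds (Q i) ref m σm σp 1 1 := fun i =>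
    ⟨hσm, hσp, one_pos, le_rfl, hMin i⟩
  obtain ⟨hr0, hr1⟩ := rate_mem (m := m) hσm hσmp hgm hgmp
  obtain ⟨hr0', hr1'⟩ := rate_mem (m := m) hσm hσmp one_pos (le_refl (1 : ℝ))
  set r := rate m σm σp gm gp with hr
  have hX : ∀ k, Measurable (X k) := (hHMM 0).measurable_state
  have hYm : ∀ k, Measurable (Y k) := (hHMM 0).measurable_obs
  have hprob : ∀ i, IsProbabilityMeasure ((P i).map (X 0)) := fun i =>
    isProbabilityMeasure_state (hHMM i)
  have hcmp : ∀ ω, Comparable gm gp fun t x => g x (Y t ω) := fun ω =>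
    comparable_obs hg.zero.2.1 hle fun t => hY t ω
  have hblock : ∀ i ω a n, pathExp (P i) X (fun _ : Fin n => g) (block (fun k => Y k ω) a n) =
      pathMass (Q i) ((P i).map (X 0)) (fun t x => g x (Y t ω)) a n := fun i ω a n =>
    pathExp_block (hHMM i) (fun t => hg.zero.bddMeas (hY t ω)) fun _ _ => rfl
  have hpm : ∀ i n, Measurable (pathExp (P i) X fun _ : Fin n => g) := fun i n =>
    measurable_pathExp hX hg_meas n
  have hc0 : 0 ≤ (gp - gm) / gm := div_nonneg (sub_nonneg.2 hgmp) hgm.le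
  have hlog : ∀ i n ω, |logCond (fun n => pathExp (P i) X fun _ : Fin n => g) n
      fun k => Y k ω| ≤ |Real.log gm| + |Real.log gp| := fun i n ω => by
    rw [logCond_eq (hblock i ω)]
    obtain ⟨h1, h2⟩ := pathMass_ratio_mem (Q := Q i) (π₀ := (P i).map (X 0)) hgm (hcmp ω) (-n) n
      (fun x => hle x _ (hY _ ω))
    have h3 := Real.log_le_log hgm h1
    have h4 := Real.log_le_log (hgm.trans_le h1) h2
    rw [abs_le]
    constructor <;> linarith [neg_abs_le (Real.log gm), le_abs_self (Real.log gp),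
      abs_nonneg (Real.log gm), abs_nonneg (Real.log gp)]
  refine ⟨fun i => ergodic_observations (hHMM i) (hM1 i) hm hr0' hr1',
    fun i n => pathExp (P i) X fun _ => g, ?_, ?_, ?_⟩
  · refine ⟨fun i n _ => hpm i n, fun i n _ =>
      map_block_eq_withDensity (hHMM i) h𝒴_meas hfin hgm hg_meas hG hle n,
      fun i n _ y hy => pathExp_pos hX hg.zero hgm hle' hy, fun i => ?_⟩
    -- With a void past the conditional log-density is `log p_i(Y_0)`.
    have h1 := measurable_logCond (W := Y) (hpm i) hYm 0
    have h2 := Integrable.of_bound (μ := P 0) h1.aestronglyMeasurable _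
      (Eventually.of_forall (hlog i 0))
    exact h2
  · intro i
    refine ⟨fun n => Integrable.of_bound (measurable_logCond (hpm i) hYm n).aestronglyMeasurable _
      (Eventually.of_forall (hlog i n)), ?_⟩
    exact exists_limit_logCond (hpm i) hYm (hlog i)
      (summable_geometric_div hr0 hr1 hm hc0).tendsto_atTop_zero
      fun n n' ω hn => abs_logCond_sub_le (hM i) (hcmp ω) (hblock i ω) hn
  · intro Ξ q
    obtain ⟨Clog, hClog⟩ := exists_blockPartial3_log_le (Ω := Ω) h𝒴_conv hS hg hgm hle'
    obtain ⟨Ce, hCe, hCe_le⟩ := exists_geometric_le hr0 hr1 hm hc0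
    obtain ⟨C₁, hC₁⟩ := hg.exists_derivLe
    set K := |C₁| / gm with hK
    have hK0 : 0 ≤ K := by positivity
    have hKle : ∀ e x, ∀ y ∈ 𝒴, |dirDeriv 𝒴 (stdVec e) (g x) y| ≤ K * g x y :=
      fun e x y hy => by
        have h1 := ((hC₁.2 e).bound x y hy).trans (le_abs_self C₁)
        have h2 : |C₁| = K * gm := by
          rw [hK]
          field_simp
        rw [h2] at h1
        exact h1.trans (mul_le_mul_of_nonneg_left (hle' x y hy) hK0)
    refine ⟨fun i n _ => ?_, ⟨Clog, fun i n _ y hy k l s a b c => hClog (P i) X hX n y hy k l s a b c⟩,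
      ⟨Ce, 1, hCe, one_pos, fun i N hN n => ?_⟩, ?_⟩
    · exact_mod_cast contDiffOn_pathExp hX h𝒴_conv hS 3 fun _ => hg
    · have hbound : ENNReal.ofReal ((gp - gm) / gm * r ^ (n / m)) ≤
          ENNReal.ofReal (Ce / (1 + (n : ℝ)) ^ ((6 : ℝ) + 1)) := by
        refine ENNReal.ofReal_le_ofReal ?_
        -- The choice `ε = 1` turns the real exponent into the natural number `7`.
        rw [show (6 : ℝ) + 1 = ((7 : ℕ) : ℝ) by norm_num, Real.rpow_natCast]
        exact hCe_le n
      refine max_le ?_ ?_ <;> refine le_trans ?_ hbound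
      · exact forgetting_le_of_pathMass (π₀ := (P i).map (X 0)) (hM i)
          (fun ω => ⟨_, hcmp ω, hblock i ω⟩) n
      · refine forgetting_le_of_pathMass (π₀ := (P i).map (X 0)) (hM i) (fun ω => ?_) n
        -- For each trajectory, the indices of the cells visited define the weights.
        choose idx hidx using fun t => (q N hN).exists_mem_cell (hY t ω)
        exact ⟨_, comparable_cell hfin hG hle hgm hgp (q N hN) idx,
          quantProb_block (hHMM i) hY (q N hN) hidx⟩
    · have hφ := summable_geometric_div hr0 hr1 hm (c := d * (2 * K)) (by positivity)
      have hψ := summable_geometric_div hr0 hr1 hm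
        (c := d * (2 * K * ((gp - gm) / gm) + K)) (by positivity)
      -- The bound for the gradient at time `k` has exponent `(k - 1) / m`; shifting the index by
      -- one gives back the summable sequence above.
      have hψ' : Summable fun k : ℕ =>
          d * (2 * K * ((gp - gm) / gm) + K) * r ^ ((k - 1) / m) :=
        (summable_nat_add_iff 1).1 (by simpa using hψ)
      refine ⟨fun n => ⟨d * (2 * K) * r ^ (n / m), by positivity⟩,
        fun k => ⟨d * (2 * K * ((gp - gm) / gm) + K) * r ^ ((k - 1) / m), by positivity⟩,
        (NNReal.summable_mk (fun _ => by positivity)).2 hφ,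
        (NNReal.summable_mk (fun _ => by positivity)).2 hψ', fun i n n' k hn => ⟨?_, ?_⟩⟩
      · exact lintegral_enorm_le_of_norm_le fun ω =>
          norm_gradZero_sub_le (hHMM i) h𝒴_conv hS (hM i) hg hle hKle (fun t => hY t ω) hn k
      · exact lintegral_enorm_le_of_norm_le fun ω =>
          norm_gradZero_future_le (hHMM i) h𝒴_conv hS (hM i) hg hle hK0 hKle (fun t => hY t ω)
            n k hr0
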